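/- All sequences are finite sequences of pairwise distinct integers. The Cartesian tree $C(x)$ of a sequence $x$ is the binary tree whose root is the position of the minimum of $x$ and whose left and right subtrees are the Cartesian trees of the parts of $x$ before and after the minimum (empty for empty $x$). The parent-distance table $PD_x$ has $PD_x[i]=i-\max\{j<i : x[j]<x[i]\}$, or $0$ if there is no such $j$. Let $\tau(x,i)$ be $x$ with the entries at positions $i,i+1$ exchanged. Sequences $x,y$ of equal length $CT_\tau$-match if $C(x)=C(y)$, or if $C(\tau(x,i))=C(y)$ or $C(\tau(y,i))=C(x)$ for some $i$. The swap-neighbours of a tree $T$ are the trees $C(\tau(x,i))$ over all $x$ with $C(x)=T$ and all $i<|x|$. **Theorem.** Let $p$ and $t$ be sequences of lengths $m\ge 1$ and $n\ge 0$. On a word RAM with unit-cost instructions and words of $O(\log(m+n))$ bits, which accesses the entries of the read-only input $p,t$ only by comparing two entries of the same sequence, the following can be done in total worst-case time $O((m^2+n)\log (m+1))$ (that is, $O((m^2+n)\log m)$ for $m\ge 2$) and with $O(m^2)$ words of working memory. First, from $p$ alone, build the Aho–Corasick automaton of the parent-distance tables of $C(p)$ and of all swap-neighbours of $C(p)$;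 its states are the prefixes of these tables, the complete tables are final, and the failure function sends a state $PD_x$ to the longest $PD_{x'}$, $x'$ a proper suffix of $x$, that is a state. Then scan $t$ and report, each exactly once, the positions $j$, $1\le j\le n-m+1$, at which the factor $t[j\ldots j+m-1]$ matches $p$. This holds for each of the two notions of a match: (a) $C(t[j\ldots j+m-1])$ is $C(p)$ or a swap-neighbour of $C(p)$; (b) $t[j\ldots j+m-1]$ and $p$ $CT_\tau$-match. The programs and the constants in the bounds do not depend on $p$ and $t$. -/

import Mathlib

namespace CTSwap

/-! ### Sequences, Cartesian trees, swaps -/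

/-- The shape of the Cartesian tree of a sequence: the root is the position of the minimum, the
subtrees are the Cartesian trees of the part before and of the part after it. (The labels of the
nodes, which are positions, are determined by the shape.) -/
def cartesianTree : List ℤ → BinaryTree Unit
  | [] => .nil
  | a :: l =>
    let i := (a :: l).idxOf ((a :: l).min (List.cons_ne_nil a l))
    .node () (cartesianTree ((a :: l).take i)) (cartesianTree ((a :: l).drop (i + 1)))
termination_by x => x.length
decreasing_by
  · have h := List.idxOf_lt_length_of_mem (List.min_mem (List.cons_ne_nil a l))
    simp only [List.length_take]
    omega
  · simp only [List.length_drop, List.length_cons]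
    omega

/-- The parent-distance table: its entry at position `i` is `i - j` for the last `j < i` with
`x[j] < x[i]`, and `0` if there is no such `j`. -/
def parentDistance (x : List ℤ) : List ℕ :=
  List.ofFn fun i : Fin x.length =>
    let S := Finset.univ.filter fun j : Fin x.length => j < i ∧ x.get j < x.get i
    if h : S.Nonempty then (i : ℕ) - (S.max' h : ℕ) else 0

/-- Exchange the entries at the (0-based) positions `i` and `i + 1`. It is used only for
`i + 1 < x.length`. -/
def swapAt : List ℤ → ℕ → List ℤ
  | a :: b :: l, 0 => b :: a :: l
  | a :: l, i + 1 => a :: swapAt l i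
  | x, _ => x

/-- `CT_τ` matching of two sequences: they have the same Cartesian tree, or one swap in one of them
gives a sequence that has the Cartesian tree of the other one. -/
def SwapMatch (x y : List ℤ) : Prop :=
  x.length = y.length ∧
    (cartesianTree x = cartesianTree y ∨
      ∃ i, i + 1 < x.length ∧
        (cartesianTree (swapAt x i) = cartesianTree y ∨
          cartesianTree (swapAt y i) = cartesianTree x))

/-- The neighbours of a tree `T` in the swap graph: the Cartesian trees of all sequences that arise
by one swap from some sequence with Cartesian tree `T`. -/
def neighbours (T : BinaryTree Unit) : Set (BinaryTree Unit) :=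
  {T' | ∃ x : List ℤ, x.Nodup ∧ cartesianTree x = T ∧
    ∃ i, i + 1 < x.length ∧ T' = cartesianTree (swapAt x i)}

/-- Matching on the level of trees: the Cartesian tree of `y` is that of `x` or one of its
neighbours in the swap graph. -/
def NeighbourMatch (x y : List ℤ) : Prop :=
  cartesianTree y = cartesianTree x ∨ cartesianTree y ∈ neighbours (cartesianTree x)

/-! ### The Aho–Corasick automaton of the parent-distance tables -/

/-- The parent-distance tables of the Cartesian tree of `p` and of all its neighbours. -/
def tables (p : List ℤ) : Set (List ℕ) :=
  {w | ∃ y : List ℤ, y.Nodup ∧ NeighbourMatch p y ∧ w = parentDistance y}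

/-- The states of the automaton (the nodes of the trie): all prefixes of the tables. The empty
prefix is the initial state; there is an edge with label `c` from `u` to `u ++ [c]`. -/
def states (p : List ℤ) : Set (List ℕ) :=
  {s | ∃ w ∈ tables p, s <+: w}

/-- If `s` is the parent-distance table of a sequence, this is the table of the suffix of length
`l` of that sequence (for `l ≤ s.length`): an entry which points to the left of the suffix is
replaced by `0`. -/
def suffixTable (s : List ℕ) (l : ℕ) : List ℕ :=
  (s.drop (s.length - l)).mapIdx fun k v => if v ≤ k then v else 0

open Classical in
/-- The failure function of the automaton: the longest proper suffix whose parent-distance table is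
a state. -/
noncomputable def failure (p : List ℤ) (s : List ℕ) : List ℕ :=
  suffixTable s (Nat.findGreatest (fun l => suffixTable s l ∈ states p) (s.length - 1))

/-! ### The machine: a word RAM whose access to the input is by comparisons only -/

/-- The input: two read-only sequences. -/
structure Input where
  pattern : List ℤ
  text : List ℤ

/-- Which of the two input sequences is meant. -/
inductive Source
  | pattern
  | text

/-- The sequence named by a source. -/
def Input.get (I : Input) : Source → List ℤ
  | .pattern => I.pattern
  | .text => I.text

/-- The arithmetic operations and tests of the machine (truncated subtraction, division with
remainder dropped, tests with values `0` and `1`). -/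
inductive Op
  | add
  | sub
  | mul
  | div
  | lt
  | eq

/-- The value of an operation. -/
def Op.apply : Op → ℕ → ℕ → ℕ
  | .add, a, b => a + b
  | .sub, a, b => a - b
  | .mul, a, b => a * b
  | .div, a, b => a / b
  | .lt, a, b => if a < b then 1 else 0
  | .eq, a, b => if a = b then 1 else 0

/-- Expressions: constants, registers, operations, memory access `load a`, the length of an input
sequence, and the comparison of the entries of an input sequence at two positions. -/
inductive Expr
  | const (c : ℕ)
  | reg (r : ℕ)
  | op (o : Op) (a b : Expr)
  | load (a : Expr)
  | len (s : Source)
  | less (s : Source) (a b : Expr)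

/-- A state of the machine: registers (a program uses only those it names), memory, output. -/
structure Store where
  reg : ℕ → ℕ
  mem : ℕ → ℕ
  out : List ℕ

/-- The start: registers and memory are zero, nothing has been output. -/
def Store.init : Store := ⟨fun _ => 0, fun _ => 0, []⟩

/-- The time to evaluate an expression: one unit for each of its nodes. -/
def Expr.cost : Expr → ℕ
  | .const _ => 1
  | .reg _ => 1
  | .op _ a b => a.cost + b.cost + 1
  | .load a => a.cost + 1
  | .len _ => 1
  | .less _ a b => a.cost + b.cost + 1

/-- The resources of a machine: the memory consists of the cells with address below `space`, and
every word is a number below `word`. -/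
structure Limits where
  space : ℕ
  word : ℕ

/-- A value that fits in a word. -/
def Limits.fit (L : Limits) (v : ℕ) : Option ℕ := if v < L.word then some v else none

/-- The value of an expression; `none` is a fault (a value that does not fit in a word, an address
outside of the memory, a position outside of the input sequence). -/
def Expr.eval (I : Input) (L : Limits) (σ : Store) : Expr → Option ℕ
  | .const c => L.fit c
  | .reg r => some (σ.reg r)
  | .op o a b => do
      let u ← a.eval I L σ
      let v ← b.eval I L σ
      L.fit (o.apply u v)
  | .load a => do
      let u ← a.eval I L σ
      if u < L.space then some (σ.mem u) else none
  | .len s => L.fit (I.get s).length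
  | .less s a b => do
      let u ← a.eval I L σ
      let v ← b.eval I L σ
      let y ← (I.get s)[u]?
      let z ← (I.get s)[v]?
      L.fit (if y < z then 1 else 0)

/-- Programs. `store a e` writes `e` to the memory cell with address `a`; `emit e` appends `e` to
the write-only output; `ite` and `loop` (a while loop) take a value other than `0` as true. -/
inductive Cmd
  | skip
  | assign (r : ℕ) (e : Expr)
  | store (a e : Expr)
  | emit (e : Expr)
  | seq (c d : Cmd)
  | ite (b : Expr) (c d : Cmd)
  | loop (b : Expr) (c : Cmd)

/-- `Exec I L c σ σ' T`: on input `I` and with resources `L`, the program `c`, started in `σ`,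
halts without a fault in `σ'` after time `T`. -/
inductive Exec (I : Input) (L : Limits) : Cmd → Store → Store → ℕ → Prop
  | skip (σ : Store) : Exec I L .skip σ σ 1
  | assign (σ : Store) (r : ℕ) (e : Expr) (v : ℕ) (he : e.eval I L σ = some v) :
      Exec I L (.assign r e) σ { σ with reg := Function.update σ.reg r v } (e.cost + 1)
  | store (σ : Store) (a e : Expr) (i v : ℕ) (ha : a.eval I L σ = some i) (hi : i < L.space)
      (he : e.eval I L σ = some v) :
      Exec I L (.store a e) σ { σ with mem := Function.update σ.mem i v } (a.cost + e.cost + 1)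
  | emit (σ : Store) (e : Expr) (v : ℕ) (he : e.eval I L σ = some v) :
      Exec I L (.emit e) σ { σ with out := σ.out ++ [v] } (e.cost + 1)
  | seq {σ σ' σ'' : Store} {c d : Cmd} {T T' : ℕ} (h : Exec I L c σ σ' T)
      (h' : Exec I L d σ' σ'' T') : Exec I L (.seq c d) σ σ'' (T + T')
  | ite_true {σ σ' : Store} {b : Expr} {c d : Cmd} {v T : ℕ} (hb : b.eval I L σ = some v)
      (hv : v ≠ 0) (h : Exec I L c σ σ' T) : Exec I L (.ite b c d) σ σ' (b.cost + 1 + T)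
  | ite_false {σ σ' : Store} {b : Expr} {c d : Cmd} {T : ℕ} (hb : b.eval I L σ = some 0)
      (h : Exec I L d σ σ' T) : Exec I L (.ite b c d) σ σ' (b.cost + 1 + T)
  | loop_true {σ σ' σ'' : Store} {b : Expr} {c : Cmd} {v T T' : ℕ} (hb : b.eval I L σ = some v)
      (hv : v ≠ 0) (h : Exec I L c σ σ' T) (h' : Exec I L (.loop b c) σ' σ'' T') :
      Exec I L (.loop b c) σ σ'' (b.cost + 1 + T + T')
  | loop_false {σ : Store} {b : Expr} {c : Cmd} (hb : b.eval I L σ = some 0) :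
      Exec I L (.loop b c) σ σ (b.cost + 1)

/-- The memory holds the Aho–Corasick automaton of the tables of `p`. Register `0` has the address
of an array of records of four cells, register `1` the number of records. There is one record for
each state, that of the initial state being the first one, and it consists of the number of the
parent in the trie, the label of the edge from the parent, the number of the failure state, and a
flag that says whether the state is final. (The first three are not specified for the initial
state.) -/
def HoldsAutomaton (p : List ℤ) (L : Limits) (σ : Store) : Prop :=
  σ.reg 0 + 4 * σ.reg 1 ≤ L.space ∧
  ∃ num : List ℕ → ℕ, Set.BijOn num (states p) (Set.Iio (σ.reg 1)) ∧ num [] = 0 ∧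
    (∀ s c, s ++ [c] ∈ states p →
      σ.mem (σ.reg 0 + 4 * num (s ++ [c])) = num s ∧
      σ.mem (σ.reg 0 + 4 * num (s ++ [c]) + 1) = c ∧
      σ.mem (σ.reg 0 + 4 * num (s ++ [c]) + 2) = num (failure p (s ++ [c]))) ∧
    ∀ s ∈ states p,
      (s ∈ tables p → σ.mem (σ.reg 0 + 4 * num s + 3) = 1) ∧
      (s ∉ tables p → σ.mem (σ.reg 0 + 4 * num s + 3) = 0)

end CTSwap

namespace CTSwap

/-! ### A structured language with two-dimensional arrays, compiled to the word RAM -/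

/-! Trees are replaced by tables throughout: for sequences of distinct entries, the Cartesian tree
and the parent-distance table determine each other (`cartesianTree_eq_iff`), because the root is the
last zero of the table. A swap at `i` changes the table in a way that depends on the table and on
one further number only. If the left entry is the smaller one, this number is the new distance at
`i` (`isTable_tableUp`). If it is the larger one, it is the place from which on the children of `i +
1` lie below the entry at `i` (`isTable_tableDown`). Which numbers are admissible can be read off
the tree, and each admissible number occurs for a suitable sequence with that tree
(`ValidUp.exists`, `ValidDown.exists`). So `mem_tables_iff` lists all the words of the automaton.
Their number is at most `5 * m`: the numbers of the first kind are points on a chain of previous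
smaller entries, counted by an amortisation; those of the second kind are children, and every entry
has one parent.

For matching of sequences, the table of a neighbour determines the position `i` and the number `z`
(`newTable_unique`). A factor `y` with this table therefore matches `p` exactly if the swap at `i`
in `p` itself has the number `z`, or if the swap at `i` in `y` gives the table of `p` back
(`swapMatch_iff`). The latter amounts to two comparisons of entries of `y`, at places that depend on
`p` and `i` only (`back_iff`). They are precomputed.

A state is stored as a depth together with the first table that has the given prefix. The child on
that same table is implicit; the other children of a node are listed in an array row indexed by the
label. One row per table is enough, since a table leaves the paths of its predecessors only once
(`Trie.inj`). A transition is thus found by a constant number of memory accesses in quadratic space.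
The label seen by a state depends on its depth, since an entry that points out of a suffix counts as
zero; as such cuts compose (`suffixTable_suffixTable`), the usual argument for failure links still
applies (`Searching.fail`). Links are computed for every table at every depth, so that the depth of
the link is a potential along each table (`run_advance`, `run_buildFail`). While the text is read,
the depth of the state and the length of the chain of previous smaller entries are the two
potentials (`run_scanText`). The total is `O(m ^ 2 + n)`; the logarithm enters only as a factor
bounded below (`le_mul_log`).

The programs are written in a small structured language with two-dimensional arrays, in which only
loop iterations are counted. `HExec.compile` translates a run into one of the word RAM whose time is
a constant multiple of the number of iterations plus one, and whose values are bounded by a fixed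
power of a bound for the registers and array entries. -/

/-- Expressions over registers, two-dimensional arrays and the input. -/
inductive HExpr
  | const (c : ℕ)
  | reg (r : ℕ)
  | op (o : Op) (a b : HExpr)
  | cond (a b c : HExpr)
  | arr (a : ℕ) (x y : HExpr)
  | len (s : Source)
  | less (s : Source) (a b : HExpr)

/-- A state: registers, arrays, the fields of the output records, the output. -/
structure HState where
  reg : ℕ → ℕ
  arr : ℕ → ℕ → ℕ → ℕ
  fld : ℕ → ℕ → ℕ
  out : List ℕ

/-- The state in which everything is zero. -/
def HState.zero : HState := ⟨fun _ => 0, fun _ _ _ => 0, fun _ _ => 0, []⟩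

/-- Assign a register. -/
def HState.setReg (h : HState) (r v : ℕ) : HState :=
  { h with reg := fun r' => if r' = r then v else h.reg r' }

/-- Write an array entry. -/
def HState.setArr (h : HState) (a x y v : ℕ) : HState :=
  { h with arr := fun a' x' y' => if a' = a ∧ x' = x ∧ y' = y then v else h.arr a' x' y' }

/-- Write a field of a record. -/
def HState.setFld (h : HState) (f i v : ℕ) : HState :=
  { h with fld := fun f' i' => if f' = f ∧ i' = i then v else h.fld f' i' }

/-- Append to the output. -/
def HState.emit (h : HState) (v : ℕ) : HState := { h with out := h.out ++ [v] }

section simps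
variable (h : HState) (r r' a a' x x' y y' f f' i i' v : ℕ)

@[simp] theorem HState.setReg_reg : (h.setReg r v).reg r' = if r' = r then v else h.reg r' := rfl
@[simp] theorem HState.setReg_arr : (h.setReg r v).arr = h.arr := rfl
@[simp] theorem HState.setReg_fld : (h.setReg r v).fld = h.fld := rfl
@[simp] theorem HState.setReg_out : (h.setReg r v).out = h.out := rfl
@[simp] theorem HState.setArr_reg : (h.setArr a x y v).reg = h.reg := rfl
@[simp] theorem HState.setArr_arr : (h.setArr a x y v).arr a' x' y' =
    if a' = a ∧ x' = x ∧ y' = y then v else h.arr a' x' y' := rfl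
@[simp] theorem HState.setArr_fld : (h.setArr a x y v).fld = h.fld := rfl
@[simp] theorem HState.setArr_out : (h.setArr a x y v).out = h.out := rfl
@[simp] theorem HState.setFld_reg : (h.setFld f i v).reg = h.reg := rfl
@[simp] theorem HState.setFld_arr : (h.setFld f i v).arr = h.arr := rfl
@[simp] theorem HState.setFld_fld : (h.setFld f i v).fld f' i' =
    if f' = f ∧ i' = i then v else h.fld f' i' := rfl
@[simp] theorem HState.setFld_out : (h.setFld f i v).out = h.out := rfl
@[simp] theorem HState.emit_reg : (h.emit v).reg = h.reg := rfl
@[simp] theorem HState.emit_arr : (h.emit v).arr = h.arr := rfl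
@[simp] theorem HState.emit_fld : (h.emit v).fld = h.fld := rfl
@[simp] theorem HState.emit_out : (h.emit v).out = h.out ++ [v] := rfl

end simps

/-- The choice between two values; a value other than `0` counts as true. -/
def select (a b c : ℕ) : ℕ := if a ≠ 0 then b else c

/-- The result of a comparison of two entries of an input sequence. -/
def Input.cmp (I : Input) (s : Source) (u v : ℕ) : ℕ :=
  if (I.get s).getD u 0 < (I.get s).getD v 0 then 1 else 0

/-- The value of an expression. -/
def HExpr.val (I : Input) (h : HState) : HExpr → ℕ
  | .const c => c
  | .reg r => h.reg r
  | .op o a b => o.apply (a.val I h) (b.val I h)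
  | .cond a b c => select (a.val I h) (b.val I h) (c.val I h)
  | .arr a x y => h.arr a (x.val I h) (y.val I h)
  | .len s => (I.get s).length
  | .less s a b => I.cmp s (a.val I h) (b.val I h)

/-- The evaluation of an expression does not fault. -/
def HExpr.ok (I : Input) (S : ℕ) (h : HState) : HExpr → Prop
  | .const _ => True
  | .reg _ => True
  | .op _ a b => a.ok I S h ∧ b.ok I S h
  | .cond a b c => a.ok I S h ∧ b.ok I S h ∧ c.ok I S h
  | .arr _ x y => x.ok I S h ∧ y.ok I S h ∧ x.val I h < S ∧ y.val I h < S
  | .len _ => True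
  | .less s a b => a.ok I S h ∧ b.ok I S h ∧
      a.val I h < (I.get s).length ∧ b.val I h < (I.get s).length

/-- The expression of the word RAM for the address of an array entry. Register `2` holds the side
length `S` of the arrays; the cells below `4 * S * S` are used for the records. -/
def addrExpr (a : ℕ) (x y : Expr) : Expr :=
  .op .add (.op .mul (.op .add (.op .mul (.const (a + 4)) (.reg 2)) x) (.reg 2)) y

/-- The address of an array entry. -/
def addr (S a x y : ℕ) : ℕ := ((a + 4) * S + x) * S + y

/-- Compilation of expressions. -/
def HExpr.compile : HExpr → Expr
  | .const c => .const c
  | .reg r => .reg (r + 3)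
  | .op o a b => .op o a.compile b.compile
  | .cond a b c => .op .add (.op .mul (.op .lt (.const 0) a.compile) b.compile)
      (.op .mul (.op .eq (.const 0) a.compile) c.compile)
  | .arr a x y => .load (addrExpr a x.compile y.compile)
  | .len s => .len s
  | .less s a b => .less s a.compile b.compile

/-- An exponent `w` such that all intermediate values are below `B ^ w`. -/
def HExpr.weight : HExpr → ℕ
  | .const c => c + 1
  | .reg _ => 1
  | .op _ a b => a.weight + b.weight + 1
  | .cond a b c => a.weight + b.weight + c.weight + 3
  | .arr a x y => a + 20 + x.weight + y.weight
  | .len _ => 1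
  | .less _ a b => a.weight + b.weight + 1

section
variable (I : Input) (S : ℕ) (h : HState) (a b c : HExpr) (s : Source) (n : ℕ) (o : Op)

@[simp] theorem HExpr.val_const : (HExpr.const n).val I h = n := rfl
@[simp] theorem HExpr.val_reg : (HExpr.reg n).val I h = h.reg n := rfl
@[simp] theorem HExpr.val_op : (HExpr.op o a b).val I h = o.apply (a.val I h) (b.val I h) := rfl
@[simp] theorem HExpr.val_cond :
    (HExpr.cond a b c).val I h = select (a.val I h) (b.val I h) (c.val I h) := rfl
@[simp] theorem HExpr.val_arr : (HExpr.arr n a b).val I h = h.arr n (a.val I h) (b.val I h) := rfl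
@[simp] theorem HExpr.val_len : (HExpr.len s).val I h = (I.get s).length := rfl
@[simp] theorem HExpr.val_less :
    (HExpr.less s a b).val I h = I.cmp s (a.val I h) (b.val I h) := rfl
@[simp] theorem HExpr.ok_const : (HExpr.const n).ok I S h := trivial
@[simp] theorem HExpr.ok_reg : (HExpr.reg n).ok I S h := trivial
@[simp] theorem HExpr.ok_op : (HExpr.op o a b).ok I S h ↔ a.ok I S h ∧ b.ok I S h := .rfl
@[simp] theorem HExpr.ok_cond :
    (HExpr.cond a b c).ok I S h ↔ a.ok I S h ∧ b.ok I S h ∧ c.ok I S h := .rfl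
@[simp] theorem HExpr.ok_arr : (HExpr.arr n a b).ok I S h ↔
    a.ok I S h ∧ b.ok I S h ∧ a.val I h < S ∧ b.val I h < S := .rfl
@[simp] theorem HExpr.ok_len : (HExpr.len s).ok I S h := trivial
@[simp] theorem HExpr.ok_less : (HExpr.less s a b).ok I S h ↔ a.ok I S h ∧ b.ok I S h ∧
    a.val I h < (I.get s).length ∧ b.val I h < (I.get s).length := .rfl

end

section
variable (u v w x : ℕ)

@[simp] theorem Op.apply_add : Op.add.apply u v = u + v := rfl
@[simp] theorem Op.apply_sub : Op.sub.apply u v = u - v := rfl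
@[simp] theorem Op.apply_mul : Op.mul.apply u v = u * v := rfl
@[simp] theorem Op.apply_div : Op.div.apply u v = u / v := rfl
@[simp] theorem Op.apply_lt_eq_zero : Op.lt.apply u v = 0 ↔ v ≤ u := by simp [Op.apply]
@[simp] theorem Op.apply_eq_eq_zero : Op.eq.apply u v = 0 ↔ u ≠ v := by simp [Op.apply]
@[simp] theorem select_lt : select (Op.lt.apply u v) w x = if u < v then w else x := by
  by_cases h : u < v <;> simp [select, h]
@[simp] theorem select_eq : select (Op.eq.apply u v) w x = if u = v then w else x := by
  by_cases h : u = v <;> simp [select, h]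
@[simp] theorem select_eq_zero : select u v w = 0 ↔ (u ≠ 0 → v = 0) ∧ (u = 0 → w = 0) := by
  by_cases h : u = 0 <;> simp [select, h]
@[simp] theorem Input.cmp_eq_zero (I : Input) (s : Source) :
    I.cmp s u v = 0 ↔ (I.get s).getD v 0 ≤ (I.get s).getD u 0 := by simp [Input.cmp]
@[simp] theorem Input.get_pattern (I : Input) : I.get .pattern = I.pattern := rfl
@[simp] theorem Input.get_text (I : Input) : I.get .text = I.text := rfl

end

/-- A bound for the arrays that are used. -/
def HExpr.top : HExpr → ℕ
  | .const _ => 0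
  | .reg _ => 0
  | .op _ a b => a.top + b.top
  | .cond a b c => a.top + b.top + c.top
  | .arr a x y => a + 1 + x.top + y.top
  | .len _ => 0
  | .less _ a b => a.top + b.top

/-- The store `σ` represents the state `h`, with `A` arrays of side length `S` and values
below `B`. -/
structure Represents (S B A : ℕ) (σ : Store) (h : HState) : Prop where
  reg : ∀ r, σ.reg (r + 3) = h.reg r
  zero : σ.reg 0 = 0
  side : σ.reg 2 = S
  lt : ∀ r, h.reg r < B
  arr : ∀ a x y, a < A → x < S → y < S → σ.mem (addr S a x y) = h.arr a x y
  arr_lt : ∀ a x y, a < A → x < S → y < S → h.arr a x y < B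
  fld : ∀ f i, f < 4 → i < S * S → σ.mem (4 * i + f) = h.fld f i
  out : σ.out = h.out

/-- The resources suffice for side length `S`, values below `B`, `A` arrays, and intermediate
values below `B ^ q`. -/
structure Suffices (I : Input) (L : Limits) (S B A q : ℕ) : Prop where
  two : 2 ≤ B
  side : S < B
  len : ∀ s, (I.get s).length < B
  space : (A + 5) * S * S ≤ L.space
  word : B ^ q ≤ L.word

/-! ### Memory layout and evaluation of compiled expressions -/

theorem addr_lt {S A a x y : ℕ} (ha : a < A) (hx : x < S) (hy : y < S) :
    addr S a x y < (A + 5) * S * S := by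
  unfold addr
  have h1 : (a + 4) * S + x < (A + 4) * S := by nlinarith
  nlinarith

/-- The three indices are digits of the address in base `S`, so a write to one array entry disturbs
no other. -/
theorem addr_inj {S a a' x x' y y' : ℕ} (hx : x < S) (hy : y < S) (hx' : x' < S) (hy' : y' < S)
    (h : addr S a x y = addr S a' x' y') : a = a' ∧ x = x' ∧ y = y' := by
  unfold addr at h
  have hS : 0 < S := by omega
  have e1 : (a + 4) * S + x = (a' + 4) * S + x' := by
    have := congrArg (· / S) h
    simpa [Nat.add_div_of_dvd_right, Nat.mul_add_div, Nat.div_eq_of_lt hy,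
      Nat.div_eq_of_lt hy', mul_comm _ S, Nat.mul_add_div hS] using this
  have e2 : a + 4 = a' + 4 := by
    have := congrArg (· / S) e1
    simpa [Nat.div_eq_of_lt hx, Nat.div_eq_of_lt hx', mul_comm _ S, Nat.mul_add_div hS] using this
  have e3 : x = x' := by rw [e2] at e1; omega
  refine ⟨by omega, e3, ?_⟩
  rw [e2, e3] at h; omega

theorem fld_lt {S f i : ℕ} (hf : f < 4) (hi : i < S * S) : 4 * i + f < 4 * S * S := by
  nlinarith

/-- Records occupy the cells below `4 * S * S` and arrays the cells from there on, so neither kind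
of write touches the other. -/
theorem le_addr {S a x y : ℕ} : 4 * S * S ≤ addr S a x y := by
  unfold addr
  nlinarith [Nat.zero_le (a * S * S), Nat.zero_le (x * S)]

theorem Limits.fit_eq {L : Limits} {v : ℕ} (h : v < L.word) : L.fit v = some v := by
  simp [Limits.fit, h]

/-- Exponents add under multiplication. The spare factor `B ≥ 2` absorbs the carry of an addition
and the values of the tests. -/
theorem Op.apply_lt {B u v i j : ℕ} (hB : 2 ≤ B) (hu : u < B ^ i) (hv : v < B ^ j) (o : Op) :
    o.apply u v < B ^ (i + j + 1) := by
  have hi : 1 ≤ B ^ i := Nat.one_le_pow _ _ (by omega)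
  have hj : 1 ≤ B ^ j := Nat.one_le_pow _ _ (by omega)
  have e : B ^ (i + j + 1) = B ^ i * B ^ j * B := by ring
  have h1 : B ^ i * B ^ j * 2 ≤ B ^ i * B ^ j * B := Nat.mul_le_mul_left _ hB
  have h2 : B ^ i ≤ B ^ i * B ^ j := Nat.le_mul_of_pos_right _ hj
  have h3 : B ^ j ≤ B ^ i * B ^ j := Nat.le_mul_of_pos_left _ hi
  rw [e]
  cases o <;> simp only [Op.apply]
  · omega
  · omega
  · have : u * v < B ^ i * B ^ j := Nat.mul_lt_mul'' hu hv
    omega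
  · have := Nat.div_le_self u v
    omega
  · split <;> omega
  · split <;> omega

theorem pow_lt_word {I : Input} {L : Limits} {S B A q v w : ℕ} (hL : Suffices I L S B A q)
    (hv : v < B ^ w) (hw : w ≤ q) : v < L.word :=
  lt_of_lt_of_le hv ((Nat.pow_le_pow_right (by have := hL.two; omega) hw).trans hL.word)

/-- Value and bound are proved together, since each intermediate result must be seen to fit in a
word. The machine has no conditional expression: both alternatives are evaluated and multiplied by
complementary tests, so `HExpr.ok` demands that all three parts are free of faults. -/
theorem HExpr.eval_compile {I : Input} {L : Limits} {S B A q : ℕ} (hL : Suffices I L S B A q)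
    {σ : Store} {h : HState} (R : Represents S B A σ h) (e : HExpr) (hok : e.ok I S h)
    (hw : e.weight ≤ q) (ht : e.top ≤ A) :
    e.compile.eval I L σ = some (e.val I h) ∧ e.val I h < B ^ e.weight := by
  have hB := hL.two
  have fit : ∀ {v w : ℕ}, v < B ^ w → w ≤ q → L.fit v = some v := fun hv hw =>
    Limits.fit_eq (pow_lt_word hL hv hw)
  have one : ∀ {w}, 1 ≤ w → 1 < B ^ w := fun hw => Nat.one_lt_pow (by omega) (by omega)
  induction e with
  | const c =>
    have : c < B ^ (c + 1) := lt_of_lt_of_le (Nat.lt_pow_self (by omega : 1 < B))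
      (Nat.pow_le_pow_right (by omega) (by omega))
    exact ⟨fit this hw, this⟩
  | reg r => exact ⟨by simp [HExpr.compile, Expr.eval, HExpr.val, R.reg], by
      simpa [HExpr.val, HExpr.weight] using R.lt r⟩
  | op o a b iha ihb =>
    simp only [HExpr.weight, HExpr.top, HExpr.ok] at *
    obtain ⟨ea, la⟩ := iha hok.1 (by omega) (by omega)
    obtain ⟨eb, lb⟩ := ihb hok.2 (by omega) (by omega)
    have := Op.apply_lt hB la lb o
    refine ⟨?_, this⟩
    simp only [HExpr.compile, Expr.eval, ea, eb, HExpr.val, Option.bind_eq_bind, Option.bind_some]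
    exact fit this hw
  | cond a b c iha ihb ihc =>
    simp only [HExpr.weight, HExpr.top, HExpr.ok] at *
    obtain ⟨ea, la⟩ := iha hok.1 (by omega) (by omega)
    obtain ⟨eb, lb⟩ := ihb hok.2.1 (by omega) (by omega)
    obtain ⟨ec, lc⟩ := ihc hok.2.2 (by omega) (by omega)
    have l1 : b.val I h < B ^ (a.weight + b.weight + c.weight + 3) :=
      lt_of_lt_of_le lb (Nat.pow_le_pow_right (by omega) (by omega))
    have l2 : c.val I h < B ^ (a.weight + b.weight + c.weight + 3) :=
      lt_of_lt_of_le lc (Nat.pow_le_pow_right (by omega) (by omega))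
    have f0 : L.fit 0 = some 0 := fit (w := 1) (by simp; omega) (by omega)
    have f1 : L.fit 1 = some 1 := fit (w := 1) (by simp; omega) (by omega)
    have fb : L.fit (b.val I h) = some (b.val I h) := fit l1 hw
    have fc : L.fit (c.val I h) = some (c.val I h) := fit l2 hw
    by_cases h0 : a.val I h = 0
    · refine ⟨?_, by simpa [HExpr.val, select, h0] using l2⟩
      simp [HExpr.compile, Expr.eval, ea, eb, ec, HExpr.val, select, h0, Op.apply, f0, f1, fc]
    · refine ⟨?_, by simpa [HExpr.val, select, h0] using l1⟩
      have h1 : 0 < a.val I h := by omega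
      have h2 : ¬ 0 = a.val I h := by omega
      simp [HExpr.compile, Expr.eval, ea, eb, ec, HExpr.val, select, h0, h1, h2, Op.apply, f0, f1, fb]
  | arr a x y ihx ihy =>
    simp only [HExpr.weight, HExpr.top, HExpr.ok] at *
    obtain ⟨hx, hy, lx, ly⟩ := hok
    obtain ⟨ex, -⟩ := ihx hx (by omega) (by omega)
    obtain ⟨ey, -⟩ := ihy hy (by omega) (by omega)
    have lS : S < B ^ 1 := by simpa using hL.side
    have lx' : x.val I h < B ^ 1 := lx.trans lS
    have ly' : y.val I h < B ^ 1 := ly.trans lS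
    have w0 : a + 4 < B ^ (a + 5) := lt_of_lt_of_le (Nat.lt_pow_self (by omega : 1 < B))
      (Nat.pow_le_pow_right (by omega) (by omega))
    have w1 := Op.apply_lt hB w0 lS .mul
    have w2 := Op.apply_lt hB w1 lx' .add
    have w3 := Op.apply_lt hB w2 lS .mul
    have w4 := Op.apply_lt hB w3 ly' .add
    simp only [Op.apply] at w1 w2 w3 w4
    have hlt : addr S a (x.val I h) (y.val I h) < L.space :=
      lt_of_lt_of_le (addr_lt (by omega) lx ly) hL.space
    constructor
    · simp only [HExpr.compile, addrExpr, Expr.eval, ex, ey, HExpr.val, Option.bind_eq_bind,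
        Option.bind_some, R.side, Op.apply, fit w0 (by omega), fit w1 (by omega),
        fit w2 (by omega), fit w3 (by omega), fit w4 (by omega)]
      rw [show ((a + 4) * S + x.val I h) * S + y.val I h = addr S a (x.val I h) (y.val I h) from rfl,
        if_pos hlt, R.arr _ _ _ (by omega) lx ly]
    · have := R.arr_lt a _ _ (by omega) lx ly
      exact lt_of_lt_of_le this (Nat.le_self_pow (by omega) _)
  | len s =>
    have : (I.get s).length < B ^ 1 := by simpa using hL.len s
    exact ⟨fit this hw, this⟩
  | less s a b iha ihb =>
    simp only [HExpr.weight, HExpr.top, HExpr.ok] at *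
    obtain ⟨ha, hb, la', lb'⟩ := hok
    obtain ⟨ea, la⟩ := iha ha (by omega) (by omega)
    obtain ⟨eb, lb⟩ := ihb hb (by omega) (by omega)
    have : (HExpr.less s a b).val I h < B ^ (a.weight + b.weight + 1) := by
      simp only [HExpr.val, Input.cmp]
      have := one (show 1 ≤ a.weight + b.weight + 1 by omega)
      split <;> omega
    refine ⟨?_, this⟩
    rw [← fit this hw]
    simp only [HExpr.compile, Expr.eval, ea, eb, HExpr.val, Input.cmp, Option.bind_eq_bind,
      Option.bind_some, List.getElem?_eq_getElem la', List.getElem?_eq_getElem lb', List.getD_eq_getElem?_getD,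
      Option.getD_some]

/-! ### Programs and the correctness of their compilation -/

/-- Programs of the structured language. -/
inductive HCmd
  | skip
  | assign (r : ℕ) (e : HExpr)
  | put (a : ℕ) (x y e : HExpr)
  | field (f : ℕ) (i e : HExpr)
  | emit (e : HExpr)
  | seq (c d : HCmd)
  | ite (b : HExpr) (c d : HCmd)
  | loop (b : HExpr) (c : HCmd)

/-- Compilation of programs. -/
def HCmd.compile : HCmd → Cmd
  | .skip => .skip
  | .assign r e => .assign (r + 3) e.compile
  | .put a x y e => .store (addrExpr a x.compile y.compile) e.compile
  | .field f i e => .store (.op .add (.op .mul (.const 4) i.compile) (.const f)) e.compile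
  | .emit e => .emit e.compile
  | .seq c d => .seq c.compile d.compile
  | .ite b c d => .ite b.compile c.compile d.compile
  | .loop b c => .loop b.compile c.compile

/-- A bound for the time spent outside of loop bodies. -/
def HCmd.size : HCmd → ℕ
  | .skip => 1
  | .assign _ e => e.compile.cost + 1
  | .put a x y e => (addrExpr a x.compile y.compile).cost + e.compile.cost + 1
  | .field f i e => (Expr.op .add (.op .mul (.const 4) i.compile) (.const f)).cost +
      e.compile.cost + 1
  | .emit e => e.compile.cost + 1
  | .seq c d => c.size + d.size
  | .ite b c d => b.compile.cost + 1 + c.size + d.size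
  | .loop b c => b.compile.cost + 1 + c.size

/-- An exponent as for expressions. -/
def HCmd.weight : HCmd → ℕ
  | .skip => 0
  | .assign _ e => e.weight
  | .put a x y e => a + 20 + x.weight + y.weight + e.weight
  | .field f i e => f + 20 + i.weight + e.weight
  | .emit e => e.weight
  | .seq c d => c.weight + d.weight
  | .ite b c d => b.weight + c.weight + d.weight
  | .loop b c => b.weight + c.weight

/-- A bound for the arrays that are used. -/
def HCmd.top : HCmd → ℕ
  | .skip => 0
  | .assign _ e => e.top
  | .put a x y e => a + 1 + x.top + y.top + e.top
  | .field _ i e => i.top + e.top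
  | .emit e => e.top
  | .seq c d => c.top + d.top
  | .ite b c d => b.top + c.top + d.top
  | .loop b c => b.top + c.top

/-- Execution of programs without a fault; the last argument is the number of loop iterations. -/
inductive HExec (I : Input) (S B : ℕ) : HCmd → HState → HState → ℕ → Prop
  | skip (h : HState) : HExec I S B .skip h h 0
  | assign (h : HState) (r : ℕ) (e : HExpr) (he : e.ok I S h) (hv : e.val I h < B) :
      HExec I S B (.assign r e) h (h.setReg r (e.val I h)) 0
  | put (h : HState) (a : ℕ) (x y e : HExpr) (hx : x.ok I S h) (hy : y.ok I S h)
      (lx : x.val I h < S) (ly : y.val I h < S) (he : e.ok I S h) (hv : e.val I h < B) :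
      HExec I S B (.put a x y e) h (h.setArr a (x.val I h) (y.val I h) (e.val I h)) 0
  | field (h : HState) (f : ℕ) (i e : HExpr) (hi : i.ok I S h) (li : i.val I h < S * S)
      (hf : f < 4) (he : e.ok I S h) :
      HExec I S B (.field f i e) h (h.setFld f (i.val I h) (e.val I h)) 0
  | emit (h : HState) (e : HExpr) (he : e.ok I S h) :
      HExec I S B (.emit e) h (h.emit (e.val I h)) 0
  | seq {h h' h'' : HState} {c d : HCmd} {t t' : ℕ} (hc : HExec I S B c h h' t)
      (hd : HExec I S B d h' h'' t') : HExec I S B (.seq c d) h h'' (t + t')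
  | ite_true {h h' : HState} {b : HExpr} {c d : HCmd} {t : ℕ} (hb : b.ok I S h)
      (hv : b.val I h ≠ 0) (hc : HExec I S B c h h' t) : HExec I S B (.ite b c d) h h' t
  | ite_false {h h' : HState} {b : HExpr} {c d : HCmd} {t : ℕ} (hb : b.ok I S h)
      (hv : b.val I h = 0) (hd : HExec I S B d h h' t) : HExec I S B (.ite b c d) h h' t
  | loop_true {h h' h'' : HState} {b : HExpr} {c : HCmd} {t t' : ℕ} (hb : b.ok I S h)
      (hv : b.val I h ≠ 0) (hc : HExec I S B c h h' t) (hl : HExec I S B (.loop b c) h' h'' t') :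
      HExec I S B (.loop b c) h h'' (t + 1 + t')
  | loop_false {h : HState} {b : HExpr} {c : HCmd} (hb : b.ok I S h) (hv : b.val I h = 0) :
      HExec I S B (.loop b c) h h 0

/-- The code between two loop tests costs at most `size`, so all time can be charged to the
iterations; the `+ 1` pays for the code that runs even if no loop is entered. -/
theorem HExec.compile {I : Input} {L : Limits} {S B A q : ℕ} (hL : Suffices I L S B A q)
    {c : HCmd} {h h' : HState} {t : ℕ} (H : HExec I S B c h h' t) :
    ∀ {σ : Store}, Represents S B A σ h → c.weight ≤ q → c.top ≤ A →
      ∃ σ' T, Exec I L c.compile σ σ' T ∧ Represents S B A σ' h' ∧ T ≤ c.size * (t + 1) := by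
  have hB := hL.two
  have fit : ∀ {v w : ℕ}, v < B ^ w → w ≤ q → L.fit v = some v := fun hv hw =>
    Limits.fit_eq (pow_lt_word hL hv hw)
  induction H with
  | skip h =>
    intro σ R _ _
    exact ⟨σ, 1, .skip σ, R, by simp [HCmd.size]⟩
  | assign h r e he hv =>
    intro σ R hw ht
    obtain ⟨ev, -⟩ := e.eval_compile hL R he hw ht
    refine ⟨_, _, .assign σ (r + 3) _ _ ev, ?_, by simp [HCmd.size]⟩
    refine ⟨fun r' => ?_, ?_, ?_, fun r' => ?_, R.arr, R.arr_lt, R.fld, R.out⟩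
    · by_cases h1 : r' = r <;> simp [h1, R.reg]
    · simp [R.zero]
    · simp [R.side]
    · by_cases h1 : r' = r <;> simp [h1, hv, R.lt]
  | put h a x y e hx hy lx ly he hv =>
    intro σ R hw ht
    simp only [HCmd.weight, HCmd.top] at hw ht
    obtain ⟨ee, -⟩ := e.eval_compile hL R he (by omega) (by omega)
    have ea : (addrExpr a x.compile y.compile).eval I L σ =
        some (addr S a (x.val I h) (y.val I h)) := by
      obtain ⟨ex, -⟩ := x.eval_compile hL R hx (by omega) (by omega)
      obtain ⟨ey, -⟩ := y.eval_compile hL R hy (by omega) (by omega)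
      have lS : S < B ^ 1 := by simpa using hL.side
      have w0 : a + 4 < B ^ (a + 5) := lt_of_lt_of_le (Nat.lt_pow_self (by omega : 1 < B))
        (Nat.pow_le_pow_right (by omega) (by omega))
      have w1 := Op.apply_lt hB w0 lS .mul
      have w2 := Op.apply_lt hB w1 (lx.trans lS) .add
      have w3 := Op.apply_lt hB w2 lS .mul
      have w4 := Op.apply_lt hB w3 (ly.trans lS) .add
      simp only [Op.apply] at w1 w2 w3 w4
      simp only [addrExpr, Expr.eval, ex, ey, Option.bind_eq_bind,
        Option.bind_some, R.side, Op.apply, fit w0 (by omega), fit w1 (by omega),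
        fit w2 (by omega), fit w3 (by omega), fit w4 (by omega)]
      rfl
    have hlt : addr S a (x.val I h) (y.val I h) < L.space :=
      lt_of_lt_of_le (addr_lt (by omega) lx ly) hL.space
    refine ⟨_, _, .store σ _ _ _ _ ea hlt ee, ?_, by simp [HCmd.size]⟩
    refine ⟨R.reg, R.zero, R.side, R.lt, fun a' x' y' ha' hx' hy' => ?_,
      fun a' x' y' ha' hx' hy' => ?_, fun f i hf hi => ?_, R.out⟩
    · simp only [Function.update_apply, HState.setArr_arr]
      by_cases h1 : a' = a ∧ x' = x.val I h ∧ y' = y.val I h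
      · rw [if_pos h1, h1.1, h1.2.1, h1.2.2, if_pos rfl]
      · rw [if_neg h1, if_neg fun h2 => h1 (addr_inj hx' hy' lx ly h2), R.arr _ _ _ ha' hx' hy']
    · simp only [HState.setArr_arr]
      split
      · exact hv
      · exact R.arr_lt _ _ _ ha' hx' hy'
    · simp only [Function.update_apply, HState.setArr_fld]
      rw [if_neg, R.fld f i hf hi]
      exact ((fld_lt hf hi).trans_le le_addr).ne
  | field h f i e hi li hf he =>
    intro σ R hw ht
    simp only [HCmd.weight, HCmd.top] at hw ht
    obtain ⟨ee, -⟩ := e.eval_compile hL R he (by omega) (by omega)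
    obtain ⟨ei, lw⟩ := i.eval_compile hL R hi (by omega) (by omega)
    have ea : (Expr.op .add (.op .mul (.const 4) i.compile) (.const f)).eval I L σ =
        some (4 * i.val I h + f) := by
      have w0 : 4 < B ^ 5 := lt_of_lt_of_le (Nat.lt_pow_self (by omega : 1 < B))
        (Nat.pow_le_pow_right (by omega) (by omega))
      have wf : f < B ^ (f + 1) := lt_of_lt_of_le (Nat.lt_pow_self (by omega : 1 < B))
        (Nat.pow_le_pow_right (by omega) (by omega))
      have w1 := Op.apply_lt hB w0 lw .mul
      have w2 := Op.apply_lt hB w1 wf .add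
      simp only [Op.apply] at w1 w2
      simp only [Expr.eval, ei, Option.bind_eq_bind, Option.bind_some, Op.apply,
        fit w0 (by omega), fit w1 (by omega), fit w2 (by omega), fit wf (by omega)]
    have hlt : 4 * i.val I h + f < L.space := by
      refine (fld_lt hf li).trans_le (le_trans ?_ hL.space)
      exact Nat.mul_le_mul_right _ (Nat.mul_le_mul_right _ (by omega))
    refine ⟨_, _, .store σ _ _ _ _ ea hlt ee, ?_, by simp [HCmd.size]⟩
    refine ⟨R.reg, R.zero, R.side, R.lt, fun a' x' y' ha' hx' hy' => ?_, R.arr_lt,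
      fun f' i' hf' hi' => ?_, R.out⟩
    · simp only [Function.update_apply, HState.setFld_arr]
      rw [if_neg, R.arr _ _ _ ha' hx' hy']
      exact ((fld_lt hf li).trans_le le_addr).ne'
    · simp only [Function.update_apply, HState.setFld_fld]
      by_cases h1 : f' = f ∧ i' = i.val I h
      · rw [if_pos h1, h1.1, h1.2, if_pos rfl]
      · rw [if_neg h1, if_neg (by omega), R.fld _ _ hf' hi']
  | emit h e he =>
    intro σ R hw ht
    obtain ⟨ev, -⟩ := e.eval_compile hL R he hw ht
    refine ⟨_, _, .emit σ _ _ ev, ?_, by simp [HCmd.size]⟩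
    exact ⟨R.reg, R.zero, R.side, R.lt, R.arr, R.arr_lt, R.fld, by simp [R.out]⟩
  | @seq _ _ _ c d t t' _ _ ihc ihd =>
    intro σ R hw ht
    simp only [HCmd.weight, HCmd.top] at hw ht
    obtain ⟨σ', T, E, R', hT⟩ := ihc R (by omega) (by omega)
    obtain ⟨σ'', T', E', R'', hT'⟩ := ihd R' (by omega) (by omega)
    refine ⟨σ'', _, .seq E E', R'', ?_⟩
    simp only [HCmd.size]
    nlinarith [Nat.zero_le (c.size * t'), Nat.zero_le (d.size * t)]
  | @ite_true _ _ b c d t hb hv _ ihc =>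
    intro σ R hw ht
    simp only [HCmd.weight, HCmd.top] at hw ht
    obtain ⟨ev, -⟩ := b.eval_compile hL R hb (by omega) (by omega)
    obtain ⟨σ', T, E, R', hT⟩ := ihc R (by omega) (by omega)
    refine ⟨σ', _, .ite_true ev hv E, R', ?_⟩
    simp only [HCmd.size]
    nlinarith [Nat.zero_le (b.compile.cost * t), Nat.zero_le (d.size * t)]
  | @ite_false _ _ b c d t hb hv _ ihd =>
    intro σ R hw ht
    simp only [HCmd.weight, HCmd.top] at hw ht
    obtain ⟨ev, -⟩ := b.eval_compile hL R hb (by omega) (by omega)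
    obtain ⟨σ', T, E, R', hT⟩ := ihd R (by omega) (by omega)
    refine ⟨σ', _, .ite_false (hv ▸ ev) E, R', ?_⟩
    simp only [HCmd.size]
    nlinarith [Nat.zero_le (b.compile.cost * t), Nat.zero_le (c.size * t)]
  | @loop_true _ _ _ b c t t' hb hv _ _ ihc ihl =>
    intro σ R hw ht
    have hw' := hw
    have ht' := ht
    simp only [HCmd.weight, HCmd.top] at hw ht
    obtain ⟨ev, -⟩ := b.eval_compile hL R hb (by omega) (by omega)
    obtain ⟨σ', T, E, R', hT⟩ := ihc R (by omega) (by omega)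
    obtain ⟨σ'', T', E', R'', hT'⟩ := ihl R' hw' ht'
    refine ⟨σ'', _, .loop_true ev hv E E', R'', ?_⟩
    simp only [HCmd.size] at *
    nlinarith [Nat.zero_le (b.compile.cost * t)]
  | @loop_false _ b c hb hv =>
    intro σ R hw ht
    simp only [HCmd.weight, HCmd.top] at hw ht
    obtain ⟨ev, -⟩ := b.eval_compile hL R hb (by omega) (by omega)
    refine ⟨σ, _, .loop_false (hv ▸ ev), R, ?_⟩
    simp only [HCmd.size]
    omega

/-! ### Total correctness -/

/-- Started in `h`, the program halts without a fault, and `Q` holds for the final state and the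
number of loop iterations. -/
def Run (I : Input) (S B : ℕ) (c : HCmd) (h : HState) (Q : HState → ℕ → Prop) : Prop :=
  ∃ h' t, HExec I S B c h h' t ∧ Q h' t

section rules
variable {I : Input} {S B : ℕ} {h : HState} {Q : HState → ℕ → Prop}

@[simp] theorem run_skip : Run I S B .skip h Q ↔ Q h 0 :=
  ⟨fun ⟨_, _, E, q⟩ => by cases E; exact q, fun q => ⟨_, _, .skip h, q⟩⟩

@[simp] theorem run_assign {r : ℕ} {e : HExpr} : Run I S B (.assign r e) h Q ↔
    e.ok I S h ∧ e.val I h < B ∧ Q (h.setReg r (e.val I h)) 0 :=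
  ⟨fun ⟨_, _, E, q⟩ => by cases E; exact ⟨‹_›, ‹_›, q⟩, fun ⟨a, b, q⟩ => ⟨_, _, .assign h r e a b, q⟩⟩

@[simp] theorem run_put {a : ℕ} {x y e : HExpr} : Run I S B (.put a x y e) h Q ↔
    x.ok I S h ∧ y.ok I S h ∧ x.val I h < S ∧ y.val I h < S ∧ e.ok I S h ∧ e.val I h < B ∧
      Q (h.setArr a (x.val I h) (y.val I h) (e.val I h)) 0 :=
  ⟨fun ⟨_, _, E, q⟩ => by cases E; exact ⟨‹_›, ‹_›, ‹_›, ‹_›, ‹_›, ‹_›, q⟩,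
    fun ⟨hx, hy, lx, ly, he, hv, q⟩ => ⟨_, _, .put h a x y e hx hy lx ly he hv, q⟩⟩

@[simp] theorem run_field {f : ℕ} {i e : HExpr} : Run I S B (.field f i e) h Q ↔
    i.ok I S h ∧ i.val I h < S * S ∧ f < 4 ∧ e.ok I S h ∧
      Q (h.setFld f (i.val I h) (e.val I h)) 0 :=
  ⟨fun ⟨_, _, E, q⟩ => by cases E; exact ⟨‹_›, ‹_›, ‹_›, ‹_›, q⟩,
    fun ⟨hi, li, hf, he, q⟩ => ⟨_, _, .field h f i e hi li hf he, q⟩⟩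

@[simp] theorem run_emit {e : HExpr} : Run I S B (.emit e) h Q ↔ e.ok I S h ∧ Q (h.emit (e.val I h)) 0 :=
  ⟨fun ⟨_, _, E, q⟩ => by cases E; exact ⟨‹_›, q⟩, fun ⟨a, q⟩ => ⟨_, _, .emit h e a, q⟩⟩

@[simp] theorem run_seq {c d : HCmd} : Run I S B (.seq c d) h Q ↔
    Run I S B c h fun h' t => Run I S B d h' fun h'' t' => Q h'' (t + t') :=
  ⟨fun ⟨_, _, E, q⟩ => by cases E with | seq E E' => exact ⟨_, _, E, _, _, E', q⟩,
    fun ⟨_, _, E, _, _, E', q⟩ => ⟨_, _, .seq E E', q⟩⟩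

@[simp] theorem run_ite {b : HExpr} {c d : HCmd} : Run I S B (.ite b c d) h Q ↔
    b.ok I S h ∧ (b.val I h ≠ 0 → Run I S B c h Q) ∧ (b.val I h = 0 → Run I S B d h Q) := by
  constructor
  · rintro ⟨_, _, E, q⟩
    cases E with
    | ite_true hb hv E => exact ⟨hb, fun _ => ⟨_, _, E, q⟩, fun h => absurd h hv⟩
    | ite_false hb hv E => exact ⟨hb, fun h => absurd hv h, fun _ => ⟨_, _, E, q⟩⟩
  · rintro ⟨hb, h1, h2⟩
    by_cases hv : b.val I h = 0
    · obtain ⟨_, _, E, q⟩ := h2 hv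
      exact ⟨_, _, .ite_false hb hv E, q⟩
    · obtain ⟨_, _, E, q⟩ := h1 hv
      exact ⟨_, _, .ite_true hb hv E, q⟩

/-- The registers that are assigned. -/
def HCmd.regs : HCmd → List ℕ
  | .assign r _ => [r]
  | .seq c d => c.regs ++ d.regs
  | .ite _ c d => c.regs ++ d.regs
  | .loop _ c => c.regs
  | _ => []

/-- The arrays that are written. -/
def HCmd.arrs : HCmd → List ℕ
  | .put a _ _ _ => [a]
  | .seq c d => c.arrs ++ d.arrs
  | .ite _ c d => c.arrs ++ d.arrs
  | .loop _ c => c.arrs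
  | _ => []

/-- Whether there is output. -/
def HCmd.emits : HCmd → Bool
  | .emit _ => true
  | .seq c d => c.emits || d.emits
  | .ite _ c d => c.emits || d.emits
  | .loop _ c => c.emits
  | _ => false

/-- What a program leaves unchanged. -/
structure Frame (c : HCmd) (h h' : HState) : Prop where
  reg : ∀ r, r ∉ c.regs → h'.reg r = h.reg r
  arr : ∀ a, a ∉ c.arrs → h'.arr a = h.arr a
  out : c.emits = false → h'.out = h.out

theorem Frame.refl (c : HCmd) (h : HState) : Frame c h h :=
  ⟨fun _ _ => rfl, fun _ _ => rfl, fun _ => rfl⟩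

theorem Frame.trans {c : HCmd} {h h' h'' : HState} (F : Frame c h h') (F' : Frame c h' h'') :
    Frame c h h'' :=
  ⟨fun r hr => (F'.reg r hr).trans (F.reg r hr), fun a ha => (F'.arr a ha).trans (F.arr a ha),
    fun e => (F'.out e).trans (F.out e)⟩

theorem Frame.mono {c d : HCmd} {h h' : HState} (F : Frame c h h')
    (h1 : ∀ r ∈ c.regs, r ∈ d.regs) (h2 : ∀ a ∈ c.arrs, a ∈ d.arrs)
    (h3 : d.emits = false → c.emits = false) : Frame d h h' :=
  ⟨fun r hr => F.reg r fun h => hr (h1 r h), fun a ha => F.arr a fun h => ha (h2 a h),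
    fun e => F.out (h3 e)⟩

theorem HExec.frame {c : HCmd} {h h' : HState} {t : ℕ} (H : HExec I S B c h h' t) :
    Frame c h h' := by
  induction H with
  | skip h => exact .refl _ _
  | assign h r e => exact ⟨fun r' hr' => by simpa [HCmd.regs] using fun h => absurd h (by
      simpa [HCmd.regs] using hr'), fun _ _ => rfl, fun _ => rfl⟩
  | put h a x y e =>
    refine ⟨fun _ _ => rfl, fun a' ha' => ?_, fun _ => rfl⟩
    have : a' ≠ a := by simpa [HCmd.arrs] using ha'
    funext x y
    simp [this]
  | field => exact ⟨fun _ _ => rfl, fun _ _ => rfl, fun _ => rfl⟩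
  | emit => exact ⟨fun _ _ => rfl, fun _ _ => rfl, fun h => by simp [HCmd.emits] at h⟩
  | seq _ _ F F' =>
    refine Frame.trans (F.mono ?_ ?_ ?_) (F'.mono ?_ ?_ ?_) <;>
      simp +contextual [HCmd.regs, HCmd.arrs, HCmd.emits]
  | ite_true _ _ _ F => refine F.mono ?_ ?_ ?_ <;> simp +contextual [HCmd.regs, HCmd.arrs, HCmd.emits]
  | ite_false _ _ _ F => refine F.mono ?_ ?_ ?_ <;> simp +contextual [HCmd.regs, HCmd.arrs, HCmd.emits]
  | loop_true _ _ _ _ F F' =>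
    exact Frame.trans (F.mono (fun _ h => h) (fun _ h => h) fun h => h) F'
  | loop_false => exact .refl _ _

/-- The continuation also receives the frame of the command. The specifications below therefore
prove a postcondition about what matters, and get the preservation of everything else from the
syntax. -/
theorem Run.mono {c : HCmd} {Q' : HState → ℕ → Prop} (H : Run I S B c h Q')
    (hQ : ∀ h' t, Frame c h h' → Q' h' t → Q h' t) : Run I S B c h Q := by
  obtain ⟨h', t, E, q⟩ := H
  exact ⟨h', t, E, hQ h' t E.frame q⟩

/-- The rule for loops: an invariant that may mention the number of iterations so far, and a
measure that decreases. -/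
theorem run_loop {b : HExpr} {c : HCmd} (J : HState → ℕ → Prop) (μ : HState → ℕ) (h0 : J h 0)
    (hb : ∀ h' t, Frame c h h' → J h' t → b.ok I S h')
    (hc : ∀ h' t, Frame c h h' → J h' t → b.val I h' ≠ 0 →
      Run I S B c h' fun h'' t' => J h'' (t + t' + 1) ∧ μ h'' < μ h')
    (hQ : ∀ h' t, Frame c h h' → J h' t → b.val I h' = 0 → Q h' t) :
    Run I S B (.loop b c) h Q := by
  have key : ∀ n h' t, μ h' ≤ n → Frame c h h' → J h' t →
      ∃ h'' t', HExec I S B (.loop b c) h' h'' t' ∧ Q h'' (t + t') := by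
    intro n
    induction n with
    | zero =>
      intro h' t hμ F j
      by_cases hv : b.val I h' = 0
      · exact ⟨h', 0, .loop_false (hb _ _ F j) hv, hQ _ _ F j hv⟩
      · obtain ⟨h'', t', E, j', hlt⟩ := hc _ _ F j hv
        omega
    | succ n ih =>
      intro h' t hμ F j
      by_cases hv : b.val I h' = 0
      · exact ⟨h', 0, .loop_false (hb _ _ F j) hv, hQ _ _ F j hv⟩
      · obtain ⟨h'', t', E, j', hlt⟩ := hc _ _ F j hv
        obtain ⟨h3, t3, E3, q⟩ := ih h'' _ (by omega) (F.trans E.frame) j'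
        exact ⟨h3, _, .loop_true (hb _ _ F j) hv E E3, by
          rwa [show t + (t' + 1 + t3) = t + t' + 1 + t3 by omega]⟩
  obtain ⟨h', t, E, q⟩ := key (μ h) h 0 le_rfl (.refl _ _) h0
  exact ⟨h', t, E, by simpa using q⟩

/-- The loop in which register `i` runs up to the value of `n`. -/
def HCmd.upto (i : ℕ) (n : HExpr) (c : HCmd) : HCmd :=
  .loop (.op .lt (.reg i) n) (.seq c (.assign i (.op .add (.reg i) (.const 1))))

/-- The assignment of `0` inside the frames only adds the counter to the registers that may have
changed; its value plays no role. The increment is left to the rule, which is why the invariant is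
asked for in the state with the counter already set. -/
theorem run_upto {i : ℕ} {n : HExpr} {c : HCmd} (N : ℕ) (J : ℕ → HState → ℕ → Prop)
    (hN : N < B) (h0 : J (h.reg i) h 0) (hle : h.reg i ≤ N) (hi : i ∉ c.regs)
    (hn : ∀ h', Frame (c.seq (.assign i (.const 0))) h h' → n.ok I S h' ∧ n.val I h' = N)
    (hc : ∀ h' t, Frame (c.seq (.assign i (.const 0))) h h' → h.reg i ≤ h'.reg i → h'.reg i < N →
      J (h'.reg i) h' t →
      Run I S B c h' fun h'' t' => J (h'.reg i + 1) (h''.setReg i (h'.reg i + 1)) (t + t' + 1))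
    (hQ : ∀ h' t, Frame (c.seq (.assign i (.const 0))) h h' → h'.reg i = N → J N h' t → Q h' t) :
    Run I S B (.upto i n c) h Q := by
  have fr : ∀ {h'}, Frame (c.seq (.assign i (.op .add (.reg i) (.const 1)))) h h' →
      Frame (c.seq (.assign i (.const 0))) h h' := fun F => F.mono (fun _ h => h) (fun _ h => h)
        fun h => h
  refine run_loop (fun h' t => J (h'.reg i) h' t ∧ h.reg i ≤ h'.reg i ∧ h'.reg i ≤ N)
    (fun h' => N - h'.reg i) ⟨h0, le_rfl, hle⟩ ?_ ?_ ?_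
  · intro h' t F j
    exact ⟨trivial, (hn h' (fr F)).1⟩
  · rintro h' t F ⟨j, l1, l2⟩ hv
    have lt : h'.reg i < N := by
      simpa [HExpr.val, Op.apply, (hn h' (fr F)).2] using hv
    rw [run_seq]
    refine (hc h' t (fr F) l1 lt j).mono fun h'' t' F' j' => ?_
    rw [run_assign]
    have e : h''.reg i = h'.reg i := F'.reg i hi
    refine ⟨⟨trivial, trivial⟩, ?_, ?_, ?_⟩
    · simp only [HExpr.val, Op.apply, e]; omega
    · simp only [HExpr.val, Op.apply, e, HState.setReg_reg, if_true, add_zero]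
      exact ⟨j', by omega, by omega⟩
    · simp only [HExpr.val, Op.apply, e, HState.setReg_reg, if_true]
      omega
  · rintro h' t F ⟨j, l1, l2⟩ hv
    have : h'.reg i = N := by
      have : N ≤ h'.reg i := by
        simpa [HExpr.val, Op.apply, (hn h' (fr F)).2] using hv
      omega
    exact hQ _ _ (fr F) this (this ▸ j)

end rules

end CTSwap

namespace CTSwap

/-! ### Parent distances -/

/-- `d` is the distance from position `i` to the previous entry of `f` below `v`, or `0` if there
is none among the last `m - 1` positions. -/
def PrevBelow (m : ℕ) (f : ℕ → ℤ) (i : ℕ) (v : ℤ) (d : ℕ) : Prop :=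
  (d = 0 ∧ ∀ j, j < i → i < j + m → v ≤ f j) ∨
    (0 < d ∧ d ≤ i ∧ d < m ∧ f (i - d) < v ∧ ∀ j, i - d < j → j < i → v ≤ f j)

/-- Of two different candidates, the nearer one contradicts the claim that the farther one skips no
smaller entry. The window `m` allows the exact distances of the pattern and the truncated ones of
the text to be treated alike. -/
theorem PrevBelow.unique {m : ℕ} {f : ℕ → ℤ} {i : ℕ} {v : ℤ} {d d' : ℕ} (h : PrevBelow m f i v d)
    (h' : PrevBelow m f i v d') : d = d' := by
  rcases h with ⟨h1, h2⟩ | ⟨h1, h2, h3, h4, h5⟩ <;>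
    rcases h' with ⟨h1', h2'⟩ | ⟨h1', h2', h3', h4', h5'⟩
  · omega
  · have := h2 (i - d') (by omega) (by omega)
    omega
  · have := h2' (i - d) (by omega) (by omega)
    omega
  · rcases lt_trichotomy d d' with h | h | h
    · have := h5' (i - d) (by omega) (by omega)
      omega
    · exact h
    · have := h5 (i - d') (by omega) (by omega)
      omega

theorem PrevBelow.exists (m : ℕ) (f : ℕ → ℤ) (i : ℕ) (v : ℤ) : ∃ d, PrevBelow m f i v d := by
  classical
  by_cases h : ∃ d, 0 < d ∧ d ≤ i ∧ d < m ∧ f (i - d) < v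
  · obtain ⟨h1, h2, h3, h4⟩ := Nat.find_spec h
    refine ⟨Nat.find h, .inr ⟨h1, h2, h3, h4, fun j hj hj' => ?_⟩⟩
    have := Nat.find_min h (m := i - j) (by omega)
    by_contra hlt
    exact this ⟨by omega, by omega, by omega, by
      rw [show i - (i - j) = j by omega]; omega⟩
  · refine ⟨0, .inl ⟨rfl, fun j hj hj' => ?_⟩⟩
    by_contra hlt
    exact h ⟨i - j, by omega, by omega, by omega, by
      rw [show i - (i - j) = j by omega]; omega⟩

theorem PrevBelow.congr {m : ℕ} {f g : ℕ → ℤ} {i : ℕ} {v : ℤ} {d : ℕ} (h : PrevBelow m f i v d)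
    (hfg : ∀ j, j < i → f j = g j) : PrevBelow m g i v d := by
  rcases h with ⟨h1, h2⟩ | ⟨h1, h2, h3, h4, h5⟩
  · exact .inl ⟨h1, fun j hj hj' => by rw [← hfg j hj]; exact h2 j hj hj'⟩
  · exact .inr ⟨h1, h2, h3, by rw [← hfg _ (by omega)]; exact h4,
      fun j hj hj' => by rw [← hfg j hj']; exact h5 j hj hj'⟩

theorem PrevBelow.le {m : ℕ} {f : ℕ → ℤ} {i : ℕ} {v : ℤ} {d : ℕ} (h : PrevBelow m f i v d) :
    d ≤ i := by
  rcases h with ⟨h1, -⟩ | ⟨-, h2, -⟩ <;> omega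

theorem PrevBelow.lt {m : ℕ} {f : ℕ → ℤ} {i : ℕ} {v : ℤ} {d : ℕ} (h : PrevBelow m f i v d)
    (hm : 0 < m) : d < m := by
  rcases h with ⟨h1, -⟩ | ⟨-, -, h2, -⟩ <;> omega

/-- Entry of a sequence as a function of the position. -/
abbrev entry (x : List ℤ) (k : ℕ) : ℤ := x.getD k 0

theorem entry_take {x : List ℤ} {n k : ℕ} (h : k < n) : entry (x.take n) k = entry x k := by
  simp [entry, List.getD_eq_getElem?_getD, h]

theorem entry_drop {x : List ℤ} {n k : ℕ} : entry (x.drop n) k = entry x (n + k) := by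
  simp [entry, List.getD_eq_getElem?_getD, List.getElem?_drop]

theorem entry_inj {x : List ℤ} (hx : x.Nodup) {i j : ℕ} (hi : i < x.length) (hj : j < x.length)
    (h : entry x i = entry x j) : i = j := by
  simp only [entry, List.getD_eq_getElem _ _ hi, List.getD_eq_getElem _ _ hj] at h
  exact (List.Nodup.getElem_inj_iff hx).1 h

@[simp] theorem length_parentDistance (x : List ℤ) : (parentDistance x).length = x.length := by
  simp [parentDistance]

/-- The window is no restriction here, as distances from a position below `m` stay below `m`. From
here on the maximum in the definition is not needed any more. -/
theorem parentDistance_spec {x : List ℤ} {m i : ℕ} (hi : i < x.length) (hm : i < m) :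
    PrevBelow m (entry x) i (entry x i) ((parentDistance x).getD i 0) := by
  have hi' : i < (parentDistance x).length := by simpa using hi
  rw [List.getD_eq_getElem _ _ hi']
  simp only [parentDistance, List.getElem_ofFn]
  split
  · next h =>
    have h1 := (Finset.mem_filter.1 (Finset.max'_mem _ h)).2
    have h2 : ∀ k : Fin x.length, k < ⟨i, hi⟩ ∧ x.get k < x.get ⟨i, hi⟩ → k ≤ Finset.max' _ h :=
      fun k hk => Finset.le_max' _ k (Finset.mem_filter.2 ⟨Finset.mem_univ _, hk⟩)
    generalize Finset.max' _ h = M at h1 h2 ⊢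
    have hlt : (M : ℕ) < i := h1.1
    have e1 : entry x M = x.get M := by simp [entry]
    have e2 : entry x i = x.get ⟨i, hi⟩ := by simp [entry, List.getD_eq_getElem?_getD, hi]
    refine .inr ⟨by omega, by omega, by omega, ?_, fun j hj hj' => ?_⟩
    · rw [show i - (i - (M : ℕ)) = M by omega, e1, e2]
      exact h1.2
    · by_contra hlt'
      have e3 : entry x j = x.get ⟨j, hj'.trans hi⟩ := by
        simp [entry, List.getD_eq_getElem?_getD, hj'.trans hi]
      have h3 : (⟨j, by omega⟩ : Fin x.length) ≤ M := by
        refine h2 _ ⟨hj', ?_⟩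
        rw [← e2, ← e3]
        omega
      have h4 : j ≤ (M : ℕ) := h3
      omega
  · next h =>
    refine .inl ⟨rfl, fun j hj _ => ?_⟩
    by_contra hlt'
    refine h ⟨⟨j, hj.trans hi⟩, Finset.mem_filter.2 ⟨Finset.mem_univ _, hj, ?_⟩⟩
    simp only [entry, List.getD_eq_getElem _ _ hi, List.getD_eq_getElem _ _ (hj.trans hi)] at hlt'
    simpa using hlt'

theorem parentDistance_getD {x : List ℤ} {m i d : ℕ} (hi : i < x.length) (hm : i < m)
    (h : PrevBelow m (entry x) i (entry x i) d) : (parentDistance x).getD i 0 = d :=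
  (parentDistance_spec hi hm).unique h

theorem ext_getD {u v : List ℕ} (hl : u.length = v.length)
    (h : ∀ i, i < u.length → u.getD i 0 = v.getD i 0) : u = v := by
  refine List.ext_getElem hl fun i h1 h2 => ?_
  have := h i h1
  rwa [List.getD_eq_getElem _ _ h1, List.getD_eq_getElem _ _ h2] at this

theorem parentDistance_take (x : List ℤ) (n : ℕ) :
    parentDistance (x.take n) = (parentDistance x).take n := by
  refine ext_getD (by simp) fun i hi => ?_
  simp only [length_parentDistance, List.length_take] at hi
  refine parentDistance_getD (by simpa using hi) (Nat.lt_succ_self i) ?_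
  rw [entry_take (by omega)]
  have e : ((parentDistance x).take n).getD i 0 = (parentDistance x).getD i 0 := by
    simp [List.getD_eq_getElem?_getD, show i < n by omega]
  rw [e]
  exact (parentDistance_spec (by omega) (Nat.lt_succ_self i)).congr fun j hj =>
    (entry_take (by omega)).symm

theorem PrevBelow.drop {m : ℕ} {f : ℕ → ℤ} {i l : ℕ} {v : ℤ} {d : ℕ}
    (h : PrevBelow m f (l + i) v d) (hm : i < m) :
    PrevBelow (i + 1) (fun k => f (l + k)) i v (if d ≤ i then d else 0) := by
  rcases h with ⟨h1, h2⟩ | ⟨h1, h2, h3, h4, h5⟩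
  · exact .inl ⟨by simp [h1], fun j hj _ => h2 _ (by omega) (by omega)⟩
  · split
    · exact .inr ⟨h1, by omega, by omega, by
        simpa only [show l + (i - d) = l + i - d by omega] using h4,
        fun j hj hj' => h5 _ (by omega) (by omega)⟩
    · exact .inl ⟨rfl, fun j hj _ => h5 _ (by omega) (by omega)⟩

/-- The nearest smaller entry stays the same in a suffix unless it is cut off, and then no smaller
entry is left in front. -/
theorem parentDistance_drop_getD {x : List ℤ} {l i : ℕ} (hi : l + i < x.length) :
    (parentDistance (x.drop l)).getD i 0 =
      if (parentDistance x).getD (l + i) 0 ≤ i then (parentDistance x).getD (l + i) 0 else 0 := by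
  refine parentDistance_getD (by simp; omega) (Nat.lt_succ_self i) ?_
  have := (parentDistance_spec hi (Nat.lt_succ_self (l + i))).drop (i := i) (l := l) (by omega)
  rw [entry_drop]
  exact this.congr fun j _ => entry_drop.symm

/-! ### Cartesian trees and parent distances -/

theorem cartesianTree_nil : cartesianTree [] = .nil := by rw [cartesianTree]

theorem cartesianTree_eq {x : List ℤ} (hx : x.Nodup) (h0 : x ≠ []) :
    ∃ i, i < x.length ∧ (∀ k, k < x.length → k ≠ i → entry x i < entry x k) ∧
      cartesianTree x = .node () (cartesianTree (x.take i)) (cartesianTree (x.drop (i + 1))) := by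
  obtain ⟨a, l, rfl⟩ := List.exists_cons_of_ne_nil h0
  have hm := List.min_mem (List.cons_ne_nil a l)
  have hi := List.idxOf_lt_length_of_mem hm
  refine ⟨(a :: l).idxOf ((a :: l).min (List.cons_ne_nil a l)), hi, fun k hk hne => ?_,
    by rw [cartesianTree]⟩
  have e : entry (a :: l) ((a :: l).idxOf ((a :: l).min (List.cons_ne_nil a l))) =
      (a :: l).min (List.cons_ne_nil a l) := by
    simp only [entry, List.getD_eq_getElem _ _ hi, List.getElem_idxOf]
  refine lt_of_le_of_ne ?_ fun h => hne (entry_inj hx hk hi h.symm)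
  rw [e]
  refine List.min_le_of_mem ?_
  simp only [entry, List.getD_eq_getElem _ _ hk, List.getElem_mem]

theorem numNodes_cartesianTree {x : List ℤ} (hx : x.Nodup) :
    (cartesianTree x).numNodes = x.length := by
  induction hn : x.length using Nat.strong_induction_on generalizing x with
  | _ n ih =>
    by_cases h0 : x = []
    · subst h0; subst hn; simp [cartesianTree_nil]
    · obtain ⟨i, hi, -, e⟩ := cartesianTree_eq hx h0
      rw [e, BinaryTree.numNodes, ih i (by omega) (hx.sublist (List.take_sublist _ _)) (by simp; omega),
        ih (n - (i + 1)) (by omega) (hx.sublist (List.drop_sublist _ _)) (by simp; omega)]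
      omega

/-- The minimum sits at the last zero of the table: nothing in front of it is smaller, and it is
itself smaller than everything behind. -/
theorem parentDistance_argmin {x : List ℤ} {i k : ℕ} (hi : i < x.length)
    (hm : ∀ k, k < x.length → k ≠ i → entry x i < entry x k) (hk : k < x.length) :
    (k = i → (parentDistance x).getD k 0 = 0) ∧
    (i < k → 0 < (parentDistance x).getD k 0) := by
  have := parentDistance_spec hk hk
  constructor
  · rintro rfl
    rcases this with ⟨h, -⟩ | ⟨h1, h2, h3, h4, -⟩
    · exact h
    · have := hm (k - (parentDistance x).getD k 0) (by omega) (by omega)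
      omega
  · intro h
    rcases this with ⟨-, h1⟩ | ⟨h1, -⟩
    · have := h1 i h (by omega)
      have := hm k hk (by omega)
      omega
    · exact h1

/-- Right of the minimum, an entry that has lost its parent in the suffix had the minimum as its
parent. -/
theorem parentDistance_right {x : List ℤ} {i k : ℕ} (hi : i < x.length)
    (hm : ∀ k, k < x.length → k ≠ i → entry x i < entry x k) (hk : i + 1 + k < x.length) :
    (parentDistance x).getD (i + 1 + k) 0 =
      if (parentDistance (x.drop (i + 1))).getD k 0 = 0 then k + 1
      else (parentDistance (x.drop (i + 1))).getD k 0 := by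
  have h1 := parentDistance_spec hk hk
  have h2 := parentDistance_drop_getD hk
  have h3 := (parentDistance_argmin hi hm hk).2 (by omega)
  rw [h2]
  by_cases h : (parentDistance x).getD (i + 1 + k) 0 ≤ k
  · rw [if_pos h, if_neg (by omega)]
  · rw [if_neg h, if_pos rfl]
    rcases h1 with ⟨h1, -⟩ | ⟨h1, h4, h5, h6, h7⟩
    · omega
    · by_contra hne
      have := h7 i (by omega) (by omega)
      have := hm _ hk (by omega)
      omega

/-- Induction on the length. Either side determines the position of the minimum, as the number of
nodes of the left subtree or as the last zero, and then splits into the same statement for the two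
parts. The left part is a prefix of the table, and the table of the right part and that of the whole
determine each other. -/
theorem cartesianTree_eq_iff {x y : List ℤ} (hx : x.Nodup) (hy : y.Nodup) :
    cartesianTree x = cartesianTree y ↔ parentDistance x = parentDistance y := by
  induction hn : x.length using Nat.strong_induction_on generalizing x y with
  | _ n ih =>
    by_cases hl : x.length = y.length
    swap
    · constructor
      · intro h
        have := congrArg BinaryTree.numNodes h
        rw [numNodes_cartesianTree hx, numNodes_cartesianTree hy] at this
        exact absurd this hl
      · intro h
        have := congrArg List.length h
        simp only [length_parentDistance] at this
        exact absurd this hl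
    by_cases h0 : x = []
    · have : y = [] := by
        rw [← List.length_eq_zero_iff, ← hl, h0]; rfl
      simp [h0, this]
    have h0' : y ≠ [] := by
      rintro rfl
      exact h0 (List.length_eq_zero_iff.1 hl)
    obtain ⟨i, hi, mi, ei⟩ := cartesianTree_eq hx h0
    obtain ⟨j, hj, mj, ej⟩ := cartesianTree_eq hy h0'
    have hxt : ∀ l, (x.take l).Nodup := fun l => hx.sublist (List.take_sublist _ _)
    have hyt : ∀ l, (y.take l).Nodup := fun l => hy.sublist (List.take_sublist _ _)
    have hxd : ∀ l, (x.drop l).Nodup := fun l => hx.sublist (List.drop_sublist _ _)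
    have hyd : ∀ l, (y.drop l).Nodup := fun l => hy.sublist (List.drop_sublist _ _)
    rw [ei, ej]
    constructor
    · intro h
      injection h with _ h1 h2
      have hij : i = j := by
        have := congrArg BinaryTree.numNodes h1
        rw [numNodes_cartesianTree (hxt i), numNodes_cartesianTree (hyt j)] at this
        simp only [List.length_take] at this
        omega
      subst hij
      rw [ih i (by omega) (hxt i) (hyt i) (by simp; omega), parentDistance_take,
        parentDistance_take] at h1
      rw [ih (n - (i + 1)) (by omega) (hxd _) (hyd _) (by simp; omega)] at h2
      refine ext_getD (by simpa using hl) fun k hk => ?_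
      simp only [length_parentDistance] at hk
      rcases lt_trichotomy k i with hki | hki | hki
      · have := congrArg (fun l => l.getD k 0) h1
        simpa [List.getD_eq_getElem?_getD, hki] using this
      · rw [(parentDistance_argmin hi mi hk).1 hki, (parentDistance_argmin hj mj (hl ▸ hk)).1 hki]
      · obtain ⟨k, rfl⟩ := Nat.exists_eq_add_of_lt hki
        rw [show i + k + 1 = i + 1 + k by omega] at *
        rw [parentDistance_right hi mi (by omega), parentDistance_right hj mj (by omega), h2]
    · intro h
      have hij : i = j := by
        rcases lt_trichotomy i j with h1 | h1 | h1
        · have h2 := (parentDistance_argmin hi mi (k := j) (by omega)).2 h1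
          rw [h, (parentDistance_argmin hj mj hj).1 rfl] at h2
          omega
        · exact h1
        · have h2 := (parentDistance_argmin hj mj (k := i) (by omega)).2 h1
          rw [← h, (parentDistance_argmin hi mi hi).1 rfl] at h2
          omega
      subst hij
      congr 1
      · rw [ih i (by omega) (hxt i) (hyt i) (by simp; omega), parentDistance_take,
          parentDistance_take, h]
      · rw [ih (n - (i + 1)) (by omega) (hxd _) (hyd _) (by simp; omega)]
        refine ext_getD (by simp; omega) fun k hk => ?_
        simp only [length_parentDistance, List.length_drop] at hk
        rw [parentDistance_drop_getD (by omega), parentDistance_drop_getD (by omega), h]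

theorem length_eq_of_cartesianTree_eq {x y : List ℤ} (hx : x.Nodup) (hy : y.Nodup)
    (h : cartesianTree x = cartesianTree y) : x.length = y.length := by
  rw [← numNodes_cartesianTree hx, h, numNodes_cartesianTree hy]

/-! ### Swaps -/

@[simp] theorem length_swapAt (x : List ℤ) (i : ℕ) : (swapAt x i).length = x.length := by
  induction i generalizing x with
  | zero => rcases x with _ | ⟨a, _ | ⟨b, l⟩⟩ <;> simp [swapAt]
  | succ i ih => rcases x with _ | ⟨a, l⟩ <;> simp [swapAt, ih]

theorem entry_swapAt {x : List ℤ} {i : ℕ} (hi : i + 1 < x.length) (k : ℕ) :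
    entry (swapAt x i) k =
      if k = i then entry x (i + 1) else if k = i + 1 then entry x i else entry x k := by
  induction i generalizing x k with
  | zero =>
    rcases x with _ | ⟨a, _ | ⟨b, l⟩⟩
    · simp at hi
    · simp at hi
    · rcases k with _ | _ | k <;> simp [swapAt, entry]
  | succ i ih =>
    rcases x with _ | ⟨a, l⟩
    · simp at hi
    · rcases k with _ | k
      · simp [swapAt, entry]
      · have := ih (x := l) (by simpa using hi) k
        simpa [swapAt, entry] using this

theorem swapAt_swapAt (x : List ℤ) (i : ℕ) : swapAt (swapAt x i) i = x := by
  induction i generalizing x with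
  | zero => rcases x with _ | ⟨a, _ | ⟨b, l⟩⟩ <;> simp [swapAt]
  | succ i ih => rcases x with _ | ⟨a, l⟩ <;> simp [swapAt, ih]

theorem swapAt_perm (x : List ℤ) (i : ℕ) : (swapAt x i).Perm x := by
  induction i generalizing x with
  | zero => rcases x with _ | ⟨a, _ | ⟨b, l⟩⟩ <;> simp [swapAt, List.Perm.swap]
  | succ i ih => rcases x with _ | ⟨a, l⟩ <;> simp [swapAt, ih]

theorem nodup_swapAt {x : List ℤ} {i : ℕ} (hx : x.Nodup) : (swapAt x i).Nodup :=
  (swapAt_perm x i).nodup_iff.2 hx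

end CTSwap

namespace CTSwap

/-! ### The effect of a swap on the parent distances -/

/-- `D` gives the parent distances of the first `m` entries of `f`. -/
def IsTable (m : ℕ) (f : ℕ → ℤ) (D : ℕ → ℕ) : Prop :=
  ∀ k, k < m → PrevBelow m f k (f k) (D k)

/-- The first `m` entries of `f` are distinct. -/
def Distinct (m : ℕ) (f : ℕ → ℤ) : Prop := ∀ k l, k < m → l < m → f k = f l → k = l

/-- Exchange the entries at `i` and `i + 1`. -/
def swapFun (f : ℕ → ℤ) (i k : ℕ) : ℤ := if k = i then f (i + 1) else if k = i + 1 then f i else f k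

/-- The table after a swap at `i` if entry `i` is the smaller one: `e` is the new distance at `i`. -/
def tableUp (D : ℕ → ℕ) (i e k : ℕ) : ℕ :=
  if k = i then e else if k = i + 1 then (if D i = 0 then 0 else D i + 1)
  else if i + 1 < k ∧ D k + i = k then D k - 1 else D k

/-- The table after a swap at `i` if entry `i` is the larger one: the children of `i + 1` from
`z` on become children of `i`. -/
def tableDown (D : ℕ → ℕ) (i z k : ℕ) : ℕ :=
  if k = i then D (i + 1) - 1 else if k = i + 1 then 1
  else if i + 1 < k ∧ z ≤ k ∧ D k + (i + 1) = k then D k + 1 else D k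

section
variable {m : ℕ} {f g : ℕ → ℤ} {D D' : ℕ → ℕ} {i : ℕ}

theorem IsTable.unique (h : IsTable m f D) (h' : IsTable m f D') {k : ℕ} (hk : k < m) :
    D k = D' k := (h k hk).unique (h' k hk)

theorem IsTable.congr (h : IsTable m f D) (hfg : ∀ k, k < m → f k = g k) : IsTable m g D :=
  fun k hk => by
    rw [← hfg k hk]
    exact (h k hk).congr fun j hj => hfg j (hj.trans hk)

theorem IsTable.congr' (h : IsTable m f D) (hD : ∀ k, k < m → D k = D' k) : IsTable m f D' :=
  fun k hk => by
    rw [← hD k hk]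
    exact h k hk

/-- The two cases of a table entry, with strict inequalities. -/
theorem IsTable.cases (h : IsTable m f D) (hf : Distinct m f) {k : ℕ} (hk : k < m) :
    (D k = 0 ∧ ∀ j, j < k → f k < f j) ∨
    ∃ q, q < k ∧ D k + q = k ∧ f q < f k ∧ ∀ j, q < j → j < k → f k < f j := by
  have st : ∀ j, j < k → f k ≤ f j → f k < f j := fun j hj hle =>
    lt_of_le_of_ne hle fun he => by have := hf _ _ hk (hj.trans hk) he; omega
  rcases h k hk with ⟨h1, h2⟩ | ⟨h1, h2, h3, h4, h5⟩
  · exact .inl ⟨h1, fun j hj => st j hj (h2 j hj (by omega))⟩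
  · exact .inr ⟨k - D k, by omega, by omega, h4, fun j hj hj' => st j hj' (h5 j hj hj')⟩

theorem PrevBelow.zero {v : ℤ} {k : ℕ} (h : ∀ j, j < k → v ≤ f j) : PrevBelow m f k v 0 :=
  .inl ⟨rfl, fun j hj _ => h j hj⟩

theorem PrevBelow.pos {v : ℤ} {k d : ℕ} (q : ℕ) (hk : k < m) (hq : q < k) (hd : d + q = k)
    (h : f q < v) (h' : ∀ j, q < j → j < k → v ≤ f j) : PrevBelow m f k v d :=
  .inr ⟨by omega, by omega, by omega, by rwa [show k - d = q by omega], fun j hj hj' =>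
    h' j (by omega) hj'⟩

theorem IsTable.lt_of_one (h : IsTable m f D) (hi : i + 1 < m) (h1 : D (i + 1) = 1) :
    f i < f (i + 1) := by
  rcases h _ hi with ⟨h2, -⟩ | ⟨h2, h3, h4, h5, -⟩
  · omega
  · rwa [h1] at h5

theorem IsTable.lt_of_ne_one (h : IsTable m f D) (hf : Distinct m f) (hi : i + 1 < m)
    (h1 : D (i + 1) ≠ 1) : f (i + 1) < f i := by
  rcases h.cases hf hi with ⟨h2, h3⟩ | ⟨q, h2, h3, h4, h5⟩
  · exact h3 i (by omega)
  · exact h5 i (by omega) (by omega)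

theorem swapFun_of_ne {k : ℕ} (h : k ≠ i) (h' : k ≠ i + 1) : swapFun f i k = f k := by
  simp [swapFun, h, h']

theorem swapFun_left : swapFun f i i = f (i + 1) := by simp [swapFun]

theorem swapFun_right : swapFun f i (i + 1) = f i := by simp [swapFun]

/-- After the swap the smaller entry stands at `i + 1`. Its parent is the old one, one step further
away, since the entry now at `i` is larger. It hides `i` from everything to the right, so the other
children of `i` move to `i + 1`, and the children of `i + 1` keep their distance. Only the distance
at `i` is not determined by the old table. -/
theorem isTable_tableUp (h : IsTable m f D) (hf : Distinct m f) (hi : i + 1 < m)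
    (h1 : D (i + 1) = 1) {e : ℕ} (he : PrevBelow m f i (f (i + 1)) e) :
    IsTable m (swapFun f i) (tableUp D i e) := by
  intro k hk
  have hlt := h.lt_of_one hi h1
  have below : ∀ j, j < i → f j = swapFun f i j := fun j hj =>
    (swapFun_of_ne (by omega) (by omega)).symm
  rcases lt_trichotomy k i with hki | hki | hki
  · have e1 : tableUp D i e k = D k := by unfold tableUp; split_ifs <;> omega
    rw [e1, swapFun_of_ne (by omega) (by omega)]
    exact (h k hk).congr fun j hj => below j (by omega)
  · subst hki
    have e1 : tableUp D k e k = e := by simp [tableUp]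
    rw [e1, swapFun_left]
    exact he.congr below
  by_cases hki' : k = i + 1
  · subst hki'
    rw [swapFun_right]
    rcases h.cases hf (show i < m by omega) with ⟨h2, h3⟩ | ⟨q, h2, h3, h4, h5⟩
    · have e1 : tableUp D i e (i + 1) = 0 := by simp [tableUp, h2]
      rw [e1]
      refine .zero fun j hj => ?_
      by_cases hj' : j = i
      · subst hj'; rw [swapFun_left]; exact hlt.le
      · rw [← below j (by omega)]; exact (h3 j (by omega)).le
    · have e1 : tableUp D i e (i + 1) = D i + 1 := by simp [tableUp]; omega
      rw [e1]
      refine .pos q hk (by omega) (by omega) (by rwa [← below q h2]) fun j hj hj' => ?_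
      by_cases hj' : j = i
      · subst hj'; rw [swapFun_left]; exact hlt.le
      · rw [← below j (by omega)]; exact (h5 j hj (by omega)).le
  · rw [swapFun_of_ne (by omega) hki']
    rcases h.cases hf hk with ⟨h2, h3⟩ | ⟨q, h2, h3, h4, h5⟩
    · have e1 : tableUp D i e k = 0 := by unfold tableUp; split_ifs <;> omega
      rw [e1]
      refine .zero fun j hj => ?_
      unfold swapFun
      split_ifs
      · exact (h3 _ (by omega)).le
      · exact (h3 _ (by omega)).le
      · exact (h3 _ (by omega)).le
    · by_cases hq : q = i
      · subst hq
        have e1 : tableUp D q e k = D k - 1 := by unfold tableUp; split_ifs <;> omega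
        rw [e1]
        refine .pos (q + 1) hk (by omega) (by omega) (by rwa [swapFun_right]) fun j hj hj' => ?_
        rw [swapFun_of_ne (by omega) (by omega)]
        exact (h5 j (by omega) hj').le
      · have e1 : tableUp D i e k = D k := by unfold tableUp; split_ifs <;> omega
        rw [e1]
        refine .pos q hk h2 h3 ?_ fun j hj hj' => ?_
        · unfold swapFun
          split_ifs
          · next h6 => subst h6; omega
          · exact h4
        · unfold swapFun
          split_ifs
          · exact (h5 _ (by omega) (by omega)).le
          · refine (h5 i ?_ (by omega)).le
            omega
          · exact (h5 _ hj hj').le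

/-- After the swap the larger entry stands at `i + 1` and has distance `1`. A child of the old `i +
1` keeps its distance if it exceeds this entry, and otherwise has its parent at `i`. Nothing right
of `i + 1` had `i` as parent. At `i` the distance `D (i + 1) - 1` is right also without a parent, by
truncation. -/
theorem isTable_tableDown (h : IsTable m f D) (hf : Distinct m f) (hi : i + 1 < m)
    (h1 : D (i + 1) ≠ 1) {z : ℕ}
    (hz : ∀ k, i + 1 < k → k < m → D k + (i + 1) = k → (f k < f i ↔ z ≤ k)) :
    IsTable m (swapFun f i) (tableDown D i z) := by
  intro k hk
  have hlt := h.lt_of_ne_one hf hi h1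
  have below : ∀ j, j < i → f j = swapFun f i j := fun j hj =>
    (swapFun_of_ne (by omega) (by omega)).symm
  rcases lt_trichotomy k i with hki | hki | hki
  · have e1 : tableDown D i z k = D k := by unfold tableDown; split_ifs <;> omega
    rw [e1, swapFun_of_ne (by omega) (by omega)]
    exact (h k hk).congr fun j hj => below j (by omega)
  · subst hki
    have e1 : tableDown D k z k = D (k + 1) - 1 := by simp [tableDown]
    rw [e1, swapFun_left]
    rcases h.cases hf hi with ⟨h2, h3⟩ | ⟨q, h2, h3, h4, h5⟩
    · rw [h2]
      exact .zero fun j hj => by rw [← below j hj]; exact (h3 j (by omega)).le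
    · refine .pos q hk (by omega) (by omega) ?_ fun j hj hj' => ?_
      · rwa [← below q (by omega)]
      · rw [← below j hj']; exact (h5 j hj (by omega)).le
  by_cases hki' : k = i + 1
  · subst hki'
    have e1 : tableDown D i z (i + 1) = 1 := by simp [tableDown]
    rw [swapFun_right, e1]
    exact .pos i hk (by omega) (by omega) (by rwa [swapFun_left]) fun j hj hj' => by omega
  · rw [swapFun_of_ne (by omega) hki']
    rcases h.cases hf hk with ⟨h2, h3⟩ | ⟨q, h2, h3, h4, h5⟩
    · have e1 : tableDown D i z k = 0 := by unfold tableDown; split_ifs <;> omega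
      rw [e1]
      refine .zero fun j hj => ?_
      unfold swapFun
      split_ifs
      · exact (h3 _ (by omega)).le
      · exact (h3 _ (by omega)).le
      · exact (h3 _ (by omega)).le
    · by_cases hq : q = i + 1
      · subst hq
        have hzk := hz k (by omega) hk h3
        by_cases hzk' : z ≤ k
        · have e1 : tableDown D i z k = D k + 1 := by unfold tableDown; split_ifs <;> omega
          rw [e1]
          have := hzk.2 hzk'
          refine .pos i hk (by omega) (by omega) (by rwa [swapFun_left]) fun j hj hj' => ?_
          by_cases hj2 : j = i + 1
          · subst hj2; rw [swapFun_right]; omega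
          · rw [swapFun_of_ne (by omega) hj2]; exact (h5 j (by omega) hj').le
        · have e1 : tableDown D i z k = D k := by unfold tableDown; split_ifs <;> omega
          rw [e1]
          have h6 : f i < f k := by
            have : f i ≠ f k := fun he => by have := hf _ _ (by omega) hk he; omega
            have : ¬ f k < f i := fun h7 => hzk' (hzk.1 h7)
            omega
          refine .pos (i + 1) hk (by omega) (by omega) (by rwa [swapFun_right]) fun j hj hj' => ?_
          rw [swapFun_of_ne (by omega) (by omega)]; exact (h5 j (by omega) hj').le
      · have e1 : tableDown D i z k = D k := by unfold tableDown; split_ifs <;> omega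
        rw [e1]
        have hqi : q ≠ i := by
          rintro rfl
          have := h5 (q + 1) (by omega) (by omega)
          omega
        refine .pos q hk h2 h3 ?_ fun j hj hj' => ?_
        · rwa [swapFun_of_ne hqi hq]
        · unfold swapFun
          split_ifs
          · exact (h5 _ (by omega) (by omega)).le
          · exact (h5 i (by omega) (by omega)).le
          · exact (h5 _ hj hj').le

/-- The values `e` that occur in `tableUp`. -/
def ValidUp (m : ℕ) (f : ℕ → ℤ) (D : ℕ → ℕ) (i e : ℕ) : Prop :=
  i + 1 < m ∧ D (i + 1) = 1 ∧ e ≤ i ∧ (e = 0 → D i = 0) ∧ (0 < D i → e ≤ D i) ∧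
    ∀ j, 0 < e → i < j + e → j < i → f (i - e) < f j

/-- The values `z` that occur in `tableDown`. -/
def ValidDown (m : ℕ) (D : ℕ → ℕ) (i z : ℕ) : Prop :=
  i + 1 < m ∧ D (i + 1) ≠ 1 ∧ i + 1 < z ∧ z ≤ m ∧ (z < m → D z + (i + 1) = z)

/-- Raising entries by `H` puts them above all entries that are not raised, and raising by `2 * H`
above those raised by `H`. -/
theorem exists_spread (m : ℕ) (f : ℕ → ℤ) : ∃ H : ℤ, 0 < H ∧
    ∀ k l, k < m → l < m → f k - f l < H := by
  refine ⟨2 * ∑ k ∈ Finset.range m, |f k| + 1, ?_, fun k l hk hl => ?_⟩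
  · have : 0 ≤ ∑ k ∈ Finset.range m, |f k| := Finset.sum_nonneg fun _ _ => abs_nonneg _
    omega
  · have h : ∀ k, k < m → |f k| ≤ ∑ k ∈ Finset.range m, |f k| := fun k hk =>
      Finset.single_le_sum (f := fun k => |f k|) (fun _ _ => abs_nonneg _) (Finset.mem_range.2 hk)
    have := h k hk
    have := h l hl
    have := le_abs_self (f k)
    have := neg_abs_le (f l)
    omega

/-- Raising some of the entries does not change the table if parents are raised at most as much as
their children, and entries between a parent and a child at least as much as the child. -/
theorem IsTable.raise (h : IsTable m f D) (hf : Distinct m f) {u : ℕ → ℤ}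
    (h1 : ∀ k q, k < m → q < k → D k + q = k → f q < f k → (∀ j, q < j → j < k → f k < f j) →
      u q ≤ u k ∧ ∀ j, q < j → j < k → u k ≤ u j)
    (h2 : ∀ k, k < m → (∀ j, j < k → f k < f j) → ∀ j, j < k → u k ≤ u j) :
    IsTable m (fun k => f k + u k) D := by
  intro k hk
  rcases h.cases hf hk with ⟨h3, h4⟩ | ⟨q, h3, h4, h5, h6⟩
  · rw [h3]
    refine .zero fun j hj => ?_
    have := h4 j hj
    have := h2 k hk h4 j hj
    simp only; omega
  · obtain ⟨h7, h8⟩ := h1 k q hk h3 h4 h5 h6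
    refine .pos q hk h3 h4 (by simp only; omega) fun j hj hj' => ?_
    have := h6 j hj hj'
    have := h8 j hj hj'
    simp only; omega

/-- The aim is to place the entry at `i + 1` between the entry at `i - e` and the entries at the
positions between `i - e` and `i`. These are all larger than entry `i`, so nothing in the tree
compares them with the right subtree of `i`, and whole blocks can be shifted against each other. -/
theorem ValidUp.exists (h : IsTable m f D) (hf : Distinct m f) {e : ℕ} (hv : ValidUp m f D i e) :
    ∃ f', IsTable m f' D ∧ Distinct m f' ∧ PrevBelow m f' i (f' (i + 1)) e := by
  classical
  obtain ⟨hi, h1, he, h0, hD, hvis⟩ := hv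
  obtain ⟨H, H0, hH⟩ := exists_spread m f
  have hlt := h.lt_of_one hi h1
  have hleft : ∀ j, j < i → (0 < e → i < j + e) → f i < f j := by
    intro j hj hje
    rcases h.cases hf (show i < m by omega) with ⟨h2, h3⟩ | ⟨q, h2, h3, h4, h5⟩
    · exact h3 j hj
    · have := hD (by omega)
      exact h5 j (by omega) hj
  -- Everything between `i - e` and `i` (everything left of `i` if `e = 0`) goes up by `2 * H`, and
  -- the right subtree of `i` by `H`. Hence entry `i + 1` ends above position `i - e` and below the
  -- positions in between.
  set u : ℕ → ℤ := fun k => if k < i ∧ (0 < e → i < k + e) then 2 * H else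
    if i < k ∧ ∀ l, i < l → l ≤ k → f i < f l then H else 0 with hu
  have u0 : ∀ k, 0 ≤ u k ∧ u k ≤ 2 * H := by
    intro k; simp only [hu]; split_ifs <;> omega
  refine ⟨fun k => f k + u k, h.raise hf ?_ ?_, ?_, ?_⟩
  · intro k q hk hq hd hqk hb
    constructor
    · by_cases c1 : q < i ∧ (0 < e → i < q + e)
      · have hki : k < i := by
          by_contra hki
          have := hleft q c1.1 c1.2
          rcases Nat.eq_or_lt_of_le (not_lt.1 hki) with h3 | h3
          · subst h3; omega
          · have := hb i c1.1 h3; omega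
        have c2 : k < i ∧ (0 < e → i < k + e) := ⟨hki, by omega⟩
        simp only [hu, if_pos c1, if_pos c2]; omega
      · by_cases c2 : i < q ∧ ∀ l, i < l → l ≤ q → f i < f l
        · have c3 : i < k ∧ ∀ l, i < l → l ≤ k → f i < f l := by
            refine ⟨by omega, fun l hl hlk => ?_⟩
            have := c2.2 q c2.1 le_rfl
            rcases le_or_gt l q with h3 | h3
            · exact c2.2 l hl h3
            · rcases Nat.eq_or_lt_of_le hlk with h4 | h4
              · subst h4; omega
              · have := hb l h3 h4; omega
          have c4 : ¬ (k < i ∧ (0 < e → i < k + e)) := by omega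
          simp only [hu, if_neg c1, if_neg c4, if_pos c2, if_pos c3]; omega
        · have e1 : u q = 0 := by simp only [hu, if_neg c1, if_neg c2]
          rw [e1]; exact (u0 k).1
    · intro j hj hjk
      by_cases c1 : k < i ∧ (0 < e → i < k + e)
      · have c2 : j < i ∧ (0 < e → i < j + e) := by
          refine ⟨by omega, fun he0 => ?_⟩
          by_contra hne
          have hie : i - e < k := by omega
          have := hvis k he0 (c1.2 he0) c1.1
          have : q < i - e ∨ q = i - e ∨ i - e < q := by omega
          rcases this with h3 | h3 | h3
          · have := hb _ h3 hie; omega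
          · omega
          · omega
        simp only [hu, if_pos c1, if_pos c2]; omega
      · by_cases c2 : i < k ∧ ∀ l, i < l → l ≤ k → f i < f l
        · have hqi : i ≤ q := by
            by_contra hqi
            have := hb i (by omega) c2.1
            have := c2.2 k c2.1 le_rfl
            omega
          have c3 : i < j ∧ ∀ l, i < l → l ≤ j → f i < f l :=
            ⟨by omega, fun l hl hlj => c2.2 l hl (by omega)⟩
          have c4 : ¬ (j < i ∧ (0 < e → i < j + e)) := by omega
          simp only [hu, if_neg c1, if_neg c4, if_pos c2, if_pos c3]; omega
        · have e1 : u k = 0 := by simp only [hu, if_neg c1, if_neg c2]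
          rw [e1]; exact (u0 j).1
  · intro k hk hb j hj
    by_cases c1 : k < i ∧ (0 < e → i < k + e)
    · have c2 : j < i ∧ (0 < e → i < j + e) := by
        refine ⟨by omega, fun he0 => ?_⟩
        have := hvis k he0 (c1.2 he0) c1.1
        have := hb (i - e) (by omega)
        omega
      simp only [hu, if_pos c1, if_pos c2]; omega
    · by_cases c2 : i < k ∧ ∀ l, i < l → l ≤ k → f i < f l
      · have := hb i c2.1
        have := c2.2 k c2.1 le_rfl
        omega
      · have e1 : u k = 0 := by simp only [hu, if_neg c1, if_neg c2]
        rw [e1]; exact (u0 j).1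
  · intro k l hk hl hkl
    have h3 := hH k l hk hl
    have h4 := hH l k hl hk
    refine hf k l hk hl ?_
    simp only [hu] at hkl
    split_ifs at hkl <;> omega
  · have e1 : u (i + 1) = H := by
      simp only [hu]
      rw [if_neg (by omega), if_pos]
      refine ⟨by omega, fun l hl hl' => ?_⟩
      obtain rfl : l = i + 1 := by omega
      exact hlt
    have e2 : ∀ j, j < i → (0 < e → i < j + e) → f (i + 1) + H ≤ f j + u j := by
      intro j hj hje
      simp only [hu, if_pos (And.intro hj hje)]
      have := hH (i + 1) j hi (by omega)
      omega
    simp only [e1]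
    by_cases he0 : e = 0
    · subst he0
      exact .zero fun j hj => e2 j hj (by omega)
    · refine .pos (i - e) (by omega) (by omega) (by omega) ?_ fun j hj hj' => e2 j hj' (by omega)
      have e3 : u (i - e) = 0 := by
        simp only [hu]
        rw [if_neg (by omega), if_neg (by omega)]
      simp only [e3]
      have := hH (i - e) (i + 1) (by omega) hi
      omega

/-- The children of `i + 1` to its right are not compared by the tree with the left subtree of `i +
1`, to which `i` belongs. So entry `i` can be moved to any place in their decreasing sequence. -/
theorem ValidDown.exists (h : IsTable m f D) (hf : Distinct m f) {z : ℕ}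
    (hv : ValidDown m D i z) : ∃ f', IsTable m f' D ∧ Distinct m f' ∧
      ∀ k, i + 1 < k → k < m → D k + (i + 1) = k → (f' k < f' i ↔ z ≤ k) := by
  classical
  obtain ⟨hi, h1, hz, hzm, hz'⟩ := hv
  obtain ⟨H, H0, hH⟩ := exists_spread m f
  have hlt := h.lt_of_ne_one hf hi h1
  have hleft : ∀ j, j ≤ i → (0 < D (i + 1) → i + 1 < j + D (i + 1)) → f (i + 1) < f j := by
    intro j hj hje
    rcases h.cases hf hi with ⟨h2, h3⟩ | ⟨q, h2, h3, h4, h5⟩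
    · exact h3 j (by omega)
    · exact h5 j (by omega) (by omega)
  have hpar : 0 < D (i + 1) → f (i + 1 - D (i + 1)) < f (i + 1) ∧ D (i + 1) ≤ i + 1 := by
    intro h0
    rcases h.cases hf hi with ⟨h2, h3⟩ | ⟨q, h2, h3, h4, h5⟩
    · omega
    · exact ⟨by rwa [show i + 1 - D (i + 1) = q by omega], by omega⟩
  have hzb : ∀ k, i + 1 < k → k < z → z < m → f z < f k := by
    intro k hk hkz hzm
    have := hz' hzm
    rcases h.cases hf hzm with ⟨h2, h3⟩ | ⟨q, h2, h3, h4, h5⟩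
    · omega
    · exact h5 k (by omega) hkz
  -- The left subtree of `i + 1` goes up by `H`, and the part of its right subtree before `z` by `2
  -- * H`. Children before `z` end above entry `i`, those from `z` on below it.
  set u : ℕ → ℤ := fun k => if k ≤ i ∧ (0 < D (i + 1) → i + 1 < k + D (i + 1)) then H else
    if i + 1 < k ∧ k < z ∧ ∀ l, i + 1 < l → l ≤ k → f (i + 1) < f l then 2 * H else 0 with hu
  have u0 : ∀ k, 0 ≤ u k ∧ u k ≤ 2 * H := by
    intro k; simp only [hu]; split_ifs <;> omega
  refine ⟨fun k => f k + u k, h.raise hf ?_ ?_, ?_, ?_⟩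
  · intro k q hk hq hd hqk hb
    constructor
    · by_cases c1 : q ≤ i ∧ (0 < D (i + 1) → i + 1 < q + D (i + 1))
      · have hki : k ≤ i := by
          by_contra hki
          have := hleft q c1.1 c1.2
          rcases Nat.eq_or_lt_of_le (not_le.1 hki) with h3 | h3
          · have : k = i + 1 := by omega
            subst this; omega
          · have := hb (i + 1) (by omega) (by omega); omega
        have c2 : k ≤ i ∧ (0 < D (i + 1) → i + 1 < k + D (i + 1)) := ⟨hki, by omega⟩
        simp only [hu, if_pos c1, if_pos c2]; omega
      · by_cases c2 : i + 1 < q ∧ q < z ∧ ∀ l, i + 1 < l → l ≤ q → f (i + 1) < f l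
        · have c3 : i + 1 < k ∧ k < z ∧ ∀ l, i + 1 < l → l ≤ k → f (i + 1) < f l := by
            refine ⟨by omega, ?_, fun l hl hlk => ?_⟩
            · by_contra hkz
              have h3 := hzb q c2.1 c2.2.1 (by omega)
              rcases Nat.eq_or_lt_of_le (not_lt.1 hkz) with h4 | h4
              · subst h4; omega
              · have := hb z (by omega) h4; omega
            · have := c2.2.2 q c2.1 le_rfl
              rcases le_or_gt l q with h3 | h3
              · exact c2.2.2 l hl h3
              · rcases Nat.eq_or_lt_of_le hlk with h4 | h4
                · subst h4; omega
                · have := hb l h3 h4; omega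
          have c4 : ¬ (k ≤ i ∧ (0 < D (i + 1) → i + 1 < k + D (i + 1))) := by omega
          simp only [hu, if_neg c1, if_neg c4, if_pos c2, if_pos c3]; omega
        · have e1 : u q = 0 := by simp only [hu, if_neg c1, if_neg c2]
          rw [e1]; exact (u0 k).1
    · intro j hj hjk
      by_cases c1 : k ≤ i ∧ (0 < D (i + 1) → i + 1 < k + D (i + 1))
      · have c2 : j ≤ i ∧ (0 < D (i + 1) → i + 1 < j + D (i + 1)) := by
          refine ⟨by omega, fun he0 => ?_⟩
          by_contra hne
          obtain ⟨h3, h4⟩ := hpar he0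
          have := hleft k c1.1 c1.2
          have := c1.2 he0
          have := hb (i + 1 - D (i + 1)) (by omega) (by omega)
          omega
        simp only [hu, if_pos c1, if_pos c2]; omega
      · by_cases c2 : i + 1 < k ∧ k < z ∧ ∀ l, i + 1 < l → l ≤ k → f (i + 1) < f l
        · have hqi : i + 1 ≤ q := by
            by_contra hqi
            have := hb (i + 1) (by omega) c2.1
            have := c2.2.2 k c2.1 le_rfl
            omega
          have c3 : i + 1 < j ∧ j < z ∧ ∀ l, i + 1 < l → l ≤ j → f (i + 1) < f l :=
            ⟨by omega, by omega, fun l hl hlj => c2.2.2 l hl (by omega)⟩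
          have c4 : ¬ (j ≤ i ∧ (0 < D (i + 1) → i + 1 < j + D (i + 1))) := by omega
          simp only [hu, if_neg c1, if_neg c4, if_pos c2, if_pos c3]; omega
        · have e1 : u k = 0 := by simp only [hu, if_neg c1, if_neg c2]
          rw [e1]; exact (u0 j).1
  · intro k hk hb j hj
    by_cases c1 : k ≤ i ∧ (0 < D (i + 1) → i + 1 < k + D (i + 1))
    · have c2 : j ≤ i ∧ (0 < D (i + 1) → i + 1 < j + D (i + 1)) := by
        refine ⟨by omega, fun he0 => ?_⟩
        obtain ⟨h3, h4⟩ := hpar he0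
        have := hleft k c1.1 c1.2
        have := c1.2 he0
        have := hb (i + 1 - D (i + 1)) (by omega)
        omega
      simp only [hu, if_pos c1, if_pos c2]; omega
    · by_cases c2 : i + 1 < k ∧ k < z ∧ ∀ l, i + 1 < l → l ≤ k → f (i + 1) < f l
      · have := hb (i + 1) c2.1
        have := c2.2.2 k c2.1 le_rfl
        omega
      · have e1 : u k = 0 := by simp only [hu, if_neg c1, if_neg c2]
        rw [e1]; exact (u0 j).1
  · intro k l hk hl hkl
    have h3 := hH k l hk hl
    have h4 := hH l k hl hk
    refine hf k l hk hl ?_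
    simp only [hu] at hkl
    split_ifs at hkl <;> omega
  · intro k hk hkm hch
    have e1 : u i = H := by
      simp only [hu]
      rw [if_pos ⟨le_rfl, by omega⟩]
    have h3 := hH k i hkm (by omega)
    have h4 := hH i k (by omega) hkm
    have hsub : ∀ l, i + 1 < l → l ≤ k → f (i + 1) < f l := by
      intro l hl hlk
      rcases h.cases hf hkm with ⟨h5, -⟩ | ⟨q, h5, h6, h7, h8⟩
      · omega
      · obtain rfl : q = i + 1 := by omega
        rcases Nat.eq_or_lt_of_le hlk with h9 | h9
        · subst h9; exact h7
        · have := h8 l hl h9; omega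
    have c4 : ¬ (k ≤ i ∧ (0 < D (i + 1) → i + 1 < k + D (i + 1))) := by omega
    by_cases hkz : k < z
    · have c3 : i + 1 < k ∧ k < z ∧ ∀ l, i + 1 < l → l ≤ k → f (i + 1) < f l := ⟨hk, hkz, hsub⟩
      have e2 : u k = 2 * H := by simp only [hu, if_neg c4, if_pos c3]
      simp only [e1, e2]
      constructor <;> intro _ <;> omega
    · have e2 : u k = 0 := by
        simp only [hu]
        rw [if_neg c4, if_neg fun h => hkz h.2.1]
      simp only [e1, e2]
      constructor <;> intro _ <;> omega

end

end CTSwap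

namespace CTSwap

/-! ### Neighbours of a tree as parameters of its table -/

/-- The first `m` values of `g` as a list. -/
def tableList (m : ℕ) (g : ℕ → ℕ) : List ℕ := (List.range m).map g

@[simp] theorem length_tableList (m : ℕ) (g : ℕ → ℕ) : (tableList m g).length = m := by
  simp [tableList]

theorem tableList_getD {m : ℕ} {g : ℕ → ℕ} {k : ℕ} (hk : k < m) :
    (tableList m g).getD k 0 = g k := by
  simp [tableList, List.getD_eq_getElem?_getD, hk]

theorem tableList_eq_iff {m : ℕ} {g g' : ℕ → ℕ} :
    tableList m g = tableList m g' ↔ ∀ k, k < m → g k = g' k := by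
  simp [tableList]

theorem parentDistance_eq_tableList {x : List ℤ} {m : ℕ} (hx : x.length = m) {g : ℕ → ℕ} :
    parentDistance x = tableList m g ↔ IsTable m (entry x) g := by
  constructor
  · intro h k hk
    have := parentDistance_spec (x := x) (m := m) (i := k) (by omega) hk
    rwa [h, tableList_getD hk] at this
  · intro h
    refine ext_getD (by simpa using hx) fun k hk => ?_
    simp only [length_parentDistance, hx] at hk
    rw [tableList_getD hk]
    exact parentDistance_getD (by omega) hk (h k hk)

theorem isTable_parentDistance {x : List ℤ} {m : ℕ} (hx : x.length = m) :
    IsTable m (entry x) fun k => (parentDistance x).getD k 0 :=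
  fun _ hk => parentDistance_spec (by omega) hk

theorem distinct_entry {x : List ℤ} (hx : x.Nodup) {m : ℕ} (hm : x.length = m) :
    Distinct m (entry x) := fun _ _ hk hl h => entry_inj hx (by omega) (by omega) h

theorem entry_ofFun {m : ℕ} {f : ℕ → ℤ} {k : ℕ} (hk : k < m) :
    entry ((List.range m).map f) k = f k := by
  simp [entry, List.getD_eq_getElem?_getD, hk]

theorem nodup_ofFun {m : ℕ} {f : ℕ → ℤ} (hf : Distinct m f) : ((List.range m).map f).Nodup := by
  rw [List.nodup_map_iff_inj_on List.nodup_range]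
  intro k hk l hl h
  exact hf k l (List.mem_range.1 hk) (List.mem_range.1 hl) h

/-- The table after a swap at `i`, in both cases. -/
def newTable (D : ℕ → ℕ) (i z : ℕ) : ℕ → ℕ :=
  if D (i + 1) = 1 then tableUp D i z else tableDown D i z

/-- The parameters for which `newTable` belongs to a neighbour. -/
def Valid (m : ℕ) (f : ℕ → ℤ) (D : ℕ → ℕ) (i z : ℕ) : Prop :=
  ValidUp m f D i z ∨ ValidDown m D i z

/-- `z` is the parameter that belongs to the swap at `i` in `f`. -/
def IsParam (m : ℕ) (f : ℕ → ℤ) (D : ℕ → ℕ) (i z : ℕ) : Prop :=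
  if D (i + 1) = 1 then PrevBelow m f i (f (i + 1)) z else ValidDown m D i z ∧
    ∀ k, i + 1 < k → k < m → D k + (i + 1) = k → (f k < f i ↔ z ≤ k)

section
variable {m : ℕ} {f g : ℕ → ℤ} {D D' : ℕ → ℕ} {i z : ℕ}

theorem Valid.lt (h : Valid m f D i z) : i + 1 < m := by
  rcases h with h | h <;> exact h.1

theorem IsParam.isTable (h : IsTable m f D) (hf : Distinct m f) (hi : i + 1 < m)
    (hz : IsParam m f D i z) : IsTable m (swapFun f i) (newTable D i z) := by
  unfold IsParam at hz
  unfold newTable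
  split_ifs at * with h1
  · exact isTable_tableUp h hf hi h1 hz
  · exact isTable_tableDown h hf hi h1 hz.2

/-- No smaller entry lies between a later child and its parent, so the entries of siblings to the
right of their parent do not increase. A comparison with a fixed value cuts them at one place. -/
theorem IsTable.children_anti (h : IsTable m f D) {k k' q : ℕ} (hk : q < k) (hk' : k' < m)
    (hq' : D k' + q = k') (hkk : k < k') : f k' ≤ f k := by
  rcases h k' hk' with ⟨h1, h2⟩ | ⟨h1, h2, h3, h4, h5⟩
  · omega
  · exact h5 k (by omega) hkk

/-- In the second case the parameter is the first child of `i + 1` below entry `i`, or `m` if there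
is none. -/
theorem IsParam.exists (h : IsTable m f D) (hi : i + 1 < m) :
    ∃ z, IsParam m f D i z := by
  classical
  unfold IsParam
  by_cases h1 : D (i + 1) = 1
  · simp only [if_pos h1]
    exact PrevBelow.exists _ _ _ _
  · simp only [if_neg h1]
    by_cases hc : ∃ z, i + 1 < z ∧ z < m ∧ D z + (i + 1) = z ∧ f z < f i
    · obtain ⟨h2, h3, h4, h5⟩ := Nat.find_spec hc
      refine ⟨Nat.find hc, ⟨hi, h1, h2, h3.le, fun _ => h4⟩, fun k hk hkm hkc => ⟨fun hlt => ?_,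
        fun hle => ?_⟩⟩
      · exact Nat.find_min' hc ⟨hk, hkm, hkc, hlt⟩
      · rcases Nat.eq_or_lt_of_le hle with h6 | h6
        · rwa [← h6]
        · exact (h.children_anti h2 hkm hkc h6).trans_lt h5
    · refine ⟨m, ⟨hi, h1, hi, le_rfl, fun h => by omega⟩, fun k hk hkm hkc => ⟨fun hlt => ?_,
        fun hle => by omega⟩⟩
      exact absurd ⟨k, hk, hkm, hkc, hlt⟩ hc

/-- That `q` lies below everything after it is a property of the table: it means that no later
position has its parent in front of `q`. -/
theorem vis_transfer {n : ℕ} (h : ∀ k, k < n → PrevBelow m f k (f k) (D k))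
    (h' : ∀ k, k < n → PrevBelow m g k (g k) (D k)) (hn : n ≤ m) {q : ℕ}
    (hq : ∀ j, q < j → j < n → f q < f j) : ∀ j, q < j → j < n → g q < g j := by
  intro j
  induction j using Nat.strong_induction_on with
  | _ j ih =>
    intro h1 h2
    by_contra hlt
    have h3 := hq j h1 h2
    rcases h j h2 with ⟨h4, h5⟩ | ⟨h4, h5, h6, h7, h8⟩
    · have := h5 q h1 (by omega); omega
    rcases h' j h2 with ⟨h4', h5'⟩ | ⟨h4', h5', h6', h7', h8'⟩
    · omega
    -- Entry `q` is below entry `j` in `f`, so the parent of `j` cannot lie left of `q`.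
    have h9 : q ≤ j - D j := by
      by_contra h9
      have := h8 q (by omega) h1
      omega
    rcases Nat.eq_or_lt_of_le h9 with h10 | h10
    · rw [← h10] at h7'; omega
    · have := ih (j - D j) (by omega) h10 (by omega)
      omega

/-- A parameter that arises from a swap in `f` is admissible for each sequence `g` with the same
table; `vis_transfer` carries over the condition on the entries. -/
theorem IsParam.valid (h : IsTable m f D) (hi : i + 1 < m)
    (hz : IsParam m f D i z) (hg : IsTable m g D) : Valid m g D i z := by
  unfold IsParam at hz
  by_cases h1 : D (i + 1) = 1
  · rw [if_pos h1] at hz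
    have hlt := h.lt_of_one hi h1
    refine .inl ⟨hi, h1, hz.le, fun h2 => ?_, fun h2 => ?_, fun j hz0 hj hji => ?_⟩
    · subst h2
      rcases hz with ⟨-, h3⟩ | ⟨h3, -⟩
      · rcases h i (by omega) with ⟨h4, -⟩ | ⟨h4, h5, h6, h7, -⟩
        · exact h4
        · have := h3 (i - D i) (by omega) (by omega); omega
      · omega
    · rcases h i (by omega) with ⟨h4, -⟩ | ⟨h4, h5, h6, h7, -⟩
      · omega
      · rcases hz with ⟨h8, -⟩ | ⟨h8, h9, h10, h11, h12⟩
        · omega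
        · by_contra hlt'
          have := h12 (i - D i) (by omega) (by omega)
          omega
    · have hzi := hz.le
      refine vis_transfer (n := i) (fun k hk => h k (by omega)) (fun k hk => hg k (by omega))
        (by omega) (fun j' h2 h3 => ?_) j (by omega) hji
      rcases hz with ⟨h8, -⟩ | ⟨h8, h9, h10, h11, h12⟩
      · omega
      · have := h12 j' h2 h3; omega
  · rw [if_neg h1] at hz
    exact .inr hz.1

theorem Valid.exists (h : IsTable m f D) (hf : Distinct m f) (hv : Valid m f D i z) :
    ∃ f', IsTable m f' D ∧ Distinct m f' ∧ IsTable m (swapFun f' i) (newTable D i z) := by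
  rcases hv with hv | hv
  · obtain ⟨f', h1, h2, h3⟩ := hv.exists h hf
    refine ⟨f', h1, h2, IsParam.isTable h1 h2 hv.1 ?_⟩
    simpa [IsParam, hv.2.1] using h3
  · obtain ⟨f', h1, h2, h3⟩ := hv.exists h hf
    refine ⟨f', h1, h2, IsParam.isTable h1 h2 hv.1 ?_⟩
    simpa [IsParam, hv.2.1] using ⟨hv, h3⟩

theorem newTable_up (h1 : D (i + 1) = 1) : newTable D i z = tableUp D i z := if_pos h1

theorem newTable_down (h1 : D (i + 1) ≠ 1) : newTable D i z = tableDown D i z := if_neg h1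

theorem tableUp_left : tableUp D i z i = z := by simp [tableUp]

theorem tableUp_right : tableUp D i z (i + 1) = if D i = 0 then 0 else D i + 1 := by
  simp [tableUp]

theorem tableDown_left : tableDown D i z i = D (i + 1) - 1 := by simp [tableDown]

theorem tableDown_right : tableDown D i z (i + 1) = 1 := by simp [tableDown]

theorem tableUp_of_lt {k : ℕ} (hk : k < i) : tableUp D i z k = D k := by
  unfold tableUp; split_ifs <;> omega

theorem tableDown_of_lt {k : ℕ} (hk : k < i) : tableDown D i z k = D k := by
  unfold tableDown; split_ifs <;> omega

theorem newTable_of_lt {k : ℕ} (hk : k < i) : newTable D i z k = D k := by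
  unfold newTable; split_ifs
  · exact tableUp_of_lt hk
  · exact tableDown_of_lt hk

theorem tableUp_of_gt {k : ℕ} (hk : i + 1 < k) :
    tableUp D i z k = if D k + i = k then D k - 1 else D k := by
  unfold tableUp; split_ifs <;> omega

theorem tableDown_of_gt {k : ℕ} (hk : i + 1 < k) :
    tableDown D i z k = if z ≤ k ∧ D k + (i + 1) = k then D k + 1 else D k := by
  unfold tableDown; split_ifs <;> omega

/-- Entry `i + 1` equals `1` exactly if the left one of the two sequence entries is smaller, and a
swap reverses this. -/
theorem newTable_ne : newTable D i z (i + 1) ≠ D (i + 1) := by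
  by_cases h1 : D (i + 1) = 1
  · rw [newTable_up h1, tableUp_right]; split_ifs <;> omega
  · rw [newTable_down h1, tableDown_right]; omega

/-- Suppose `i < i'`. The second table agrees with `D` before `i'` and the first one differs from
`D` at `i + 1`, so only `i' = i + 1` is left; the entries at `i`, `i + 1` and `i + 2` exclude it. -/
theorem le_of_newTable_eq {i' z' : ℕ} (hv : Valid m f D i z)
    (hv' : Valid m f D i' z') (he : ∀ k, k < m → newTable D i z k = newTable D i' z' k) :
    i' ≤ i := by
  by_contra hlt
  have hm' := hv'.lt
  have e0 := he i (by omega)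
  have e1 := he (i + 1) (by omega)
  have e2 := he (i + 2) (by omega)
  rw [newTable_of_lt (i := i') (by omega)] at e0
  obtain rfl : i' = i + 1 := by
    by_contra hne
    rw [newTable_of_lt (i := i') (by omega)] at e1
    exact newTable_ne e1
  rcases hv with ⟨-, h1, h2⟩ | ⟨-, h1, h2⟩
  · rw [newTable_up h1] at e0 e1 e2
    rw [tableUp_left] at e0
    rw [tableUp_right] at e1
    rw [tableUp_of_gt (by omega)] at e2
    rcases hv' with ⟨-, h1', h2'⟩ | ⟨-, h1', h2'⟩
    · rw [newTable_up h1', tableUp_left] at e1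
      split_ifs at e1 <;> omega
    · rw [newTable_down h1', tableDown_left] at e1
      rw [newTable_down h1', tableDown_right] at e2
      simp only [show i + 1 + 1 = i + 2 by omega] at *
      split_ifs at e1 e2 <;> omega
  · rw [newTable_down h1] at e0 e1 e2
    rw [tableDown_left] at e0
    rw [tableDown_right] at e1
    rw [tableDown_of_gt (by omega)] at e2
    rcases hv' with ⟨-, h1', h2'⟩ | ⟨-, h1', h2'⟩
    · rw [newTable_up h1', tableUp_left] at e1
      rw [newTable_up h1', tableUp_right] at e2
      simp only [show i + 1 + 1 = i + 2 by omega] at *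
      split_ifs at e2 <;> omega
    · rw [newTable_down h1', tableDown_left] at e1
      rw [newTable_down h1', tableDown_right] at e2
      simp only [show i + 1 + 1 = i + 2 by omega] at *
      split_ifs at e2 <;> omega

/-- A neighbouring tree remembers the swap that produced it. This reduces `CT_τ` matching to a test
at one known position. -/
theorem newTable_unique {i' z' : ℕ} (hv : Valid m f D i z)
    (hv' : Valid m f D i' z') (he : ∀ k, k < m → newTable D i z k = newTable D i' z' k) :
    i = i' ∧ z = z' := by
  obtain rfl : i = i' := le_antisymm (le_of_newTable_eq hv' hv fun k hk => (he k hk).symm)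
    (le_of_newTable_eq hv hv' he)
  refine ⟨rfl, ?_⟩
  have hm := hv.lt
  rcases hv with ⟨-, h1, h2⟩ | ⟨-, h1, h2, h3, h4⟩
  · have := he i (by omega)
    rwa [newTable_up h1, newTable_up h1, tableUp_left, tableUp_left] at this
  · rcases hv' with ⟨-, h1', -⟩ | ⟨-, -, h2', h3', h4'⟩
    · exact absurd h1' h1
    · rw [newTable_down h1, newTable_down h1] at he
      by_contra hne
      -- The smaller of the two cuts is itself a child of `i + 1`, whose entry is increased in one
      -- table and kept in the other.
      rcases Nat.lt_or_gt_of_ne hne with h5 | h5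
      · have := he z (by omega)
        have h6 := h4 (by omega)
        rw [tableDown_of_gt h2, tableDown_of_gt h2, if_pos ⟨le_rfl, h6⟩, if_neg (by omega)] at this
        omega
      · have := he z' (by omega)
        have h6 := h4' (by omega)
        rw [tableDown_of_gt h2', tableDown_of_gt h2', if_neg (by omega), if_pos ⟨le_rfl, h6⟩] at this
        omega

end

theorem parentDistance_swapAt {x : List ℤ} {m : ℕ} (hx : x.length = m) {D : ℕ → ℕ}
    {i : ℕ} (hi : i + 1 < m) :
    parentDistance (swapAt x i) = tableList m D ↔ IsTable m (swapFun (entry x) i) D := by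
  rw [parentDistance_eq_tableList (by simpa using hx)]
  have : ∀ k, entry (swapAt x i) k = swapFun (entry x) i k := fun k => by
    rw [entry_swapAt (by omega)]; rfl
  exact ⟨fun h => h.congr fun k _ => this k, fun h => h.congr fun k _ => (this k).symm⟩

/-- A neighbour comes from some sequence with the tree of `p`, not necessarily from `p`.
`IsParam.valid` transfers its parameter to `p`; conversely `Valid.exists` provides a sequence for
each valid parameter. -/
theorem mem_tables_iff {p : List ℤ} (hp : p.Nodup) {m : ℕ} (hm : p.length = m) {D : ℕ → ℕ}
    (hD : IsTable m (entry p) D) {w : List ℕ} :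
    w ∈ tables p ↔ w = tableList m D ∨
      ∃ i z, Valid m (entry p) D i z ∧ w = tableList m (newTable D i z) := by
  have hpD := (parentDistance_eq_tableList hm).2 hD
  constructor
  · rintro ⟨y, hy, h1 | ⟨x, hx, hxp, i, hi, h1⟩, rfl⟩
    · left
      rw [← hpD]
      exact (cartesianTree_eq_iff hy hp).1 h1
    · right
      have hxl : x.length = m := by
        rw [← hm]; exact length_eq_of_cartesianTree_eq hx hp hxp
      have h2 := (cartesianTree_eq_iff hx hp).1 hxp
      rw [hpD, parentDistance_eq_tableList hxl] at h2
      obtain ⟨z, hz⟩ := IsParam.exists h2 (i := i) (by omega)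
      refine ⟨i, z, hz.valid h2 (by omega) hD, ?_⟩
      rw [(cartesianTree_eq_iff hy (nodup_swapAt hx)).1 h1, parentDistance_swapAt hxl (by omega)]
      exact hz.isTable h2 (distinct_entry hx hxl) (by omega)
  · rintro (rfl | ⟨i, z, hv, rfl⟩)
    · exact ⟨p, hp, .inl rfl, hpD.symm⟩
    · obtain ⟨f, h1, h2, h3⟩ := hv.exists hD (distinct_entry hp hm)
      have hl : ((List.range m).map f).length = m := by simp
      have e : ∀ k, k < m → f k = entry ((List.range m).map f) k := fun k hk =>
        (entry_ofFun hk).symm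
      have hn := nodup_ofFun h2
      have hi := hv.lt
      refine ⟨swapAt ((List.range m).map f) i, nodup_swapAt hn, .inr ⟨_, hn, ?_, i, by omega, rfl⟩, ?_⟩
      · rw [cartesianTree_eq_iff hn hp, hpD, parentDistance_eq_tableList hl]
        exact h1.congr e
      · symm
        rw [parentDistance_swapAt hl hi]
        refine h3.congr fun k hk => ?_
        unfold swapFun
        split_ifs
        · exact e _ hi
        · exact e _ (by omega)
        · exact e _ hk

/-- Matching on the level of trees in terms of tables. -/
theorem neighbourMatch_iff {p y : List ℤ} (hy : y.Nodup) :
    NeighbourMatch p y ↔ parentDistance y ∈ tables p := by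
  constructor
  · exact fun h => ⟨y, hy, h, rfl⟩
  · rintro ⟨y', hy', h, e⟩
    have := (cartesianTree_eq_iff hy hy').2 e
    unfold NeighbourMatch
    rwa [this]

end CTSwap

namespace CTSwap

/-! ### Matching of sequences: a swap in the pattern or a swap back in the text -/

/-- A swap is undone by the same swap, so a swap in `y` makes the trees neighbours as well. Hence
the automaton misses no candidate. -/
theorem SwapMatch.neighbourMatch {x y : List ℤ} (hx : x.Nodup) (hy : y.Nodup)
    (h : SwapMatch x y) : NeighbourMatch x y := by
  obtain ⟨hl, h | ⟨i, hi, h | h⟩⟩ := h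
  · exact .inl h.symm
  · exact .inr ⟨x, hx, rfl, i, hi, h.symm⟩
  · refine .inr ⟨swapAt y i, nodup_swapAt hy, h, i, by simpa [← hl] using hi, ?_⟩
    rw [swapAt_swapAt]

theorem swapFun_swapFun (f : ℕ → ℤ) (i k : ℕ) : swapFun (swapFun f i) i k = f k := by
  by_cases h : k = i
  · subst h; rw [swapFun_left, swapFun_right]
  by_cases h' : k = i + 1
  · subst h'; rw [swapFun_right, swapFun_left]
  · rw [swapFun_of_ne h h', swapFun_of_ne h h']

section
variable {m : ℕ} {f g : ℕ → ℤ} {D D' : ℕ → ℕ} {i z : ℕ}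

theorem Distinct.swapFun (hf : Distinct m f) (hi : i + 1 < m) : Distinct m (swapFun f i) := by
  intro k l hk hl h
  have := hf (if k = i then i + 1 else if k = i + 1 then i else k)
    (if l = i then i + 1 else if l = i + 1 then i else l)
    (by split_ifs <;> omega) (by split_ifs <;> omega) (by
      unfold CTSwap.swapFun at h
      split_ifs at * <;> exact h)
  split_ifs at this <;> omega

/-- In `g` the children of `i` other than `i + 1` and the children of `i + 1` have all become
children of `i + 1`. Swapping back separates them again precisely if the entry at `i` lies between
the two groups. -/
theorem back_up (hg : IsTable m g (newTable D i z)) (dg : Distinct m g) (hD : IsTable m f D)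
    (hi : i + 1 < m) (h1 : D (i + 1) = 1) :
    IsTable m (swapFun g i) D ↔ (∀ k, i + 1 < k → k < m → D k + i = k → g k < g i) ∧
      ∀ k, i + 1 < k → k < m → D k + (i + 1) = k → g i < g k := by
  have hlt := hD.lt_of_one hi h1
  have hDk : ∀ k, k < m → D k ≤ k := fun k hk => (hD k hk).le
  rw [newTable_up h1] at hg
  have hne : tableUp D i z (i + 1) ≠ 1 := by rw [tableUp_right]; split_ifs <;> omega
  constructor
  · intro h
    have hs : ∀ k, i + 1 < k → g k = swapFun g i k := fun k hk =>
      (swapFun_of_ne (by omega) (by omega)).symm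
    have hs' : g i = swapFun g i (i + 1) := swapFun_right.symm
    refine ⟨fun k hk hkm hkd => ?_, fun k hk hkm hkd => ?_⟩
    · rw [hs k hk, hs']
      rcases h.cases (dg.swapFun hi) hkm with ⟨h2, h3⟩ | ⟨q, h2, h3, h4, h5⟩
      · omega
      · exact h5 _ (by omega) hk
    · rw [hs k hk, hs']
      rcases h.cases (dg.swapFun hi) hkm with ⟨h2, h3⟩ | ⟨q, h2, h3, h4, h5⟩
      · omega
      · obtain rfl : q = i + 1 := by omega
        exact h4
  · rintro ⟨h2, h3⟩
    classical
    -- the threshold of `g`: children of `i + 1` that were children of `i`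
    have key : ∀ k, k < m → i + 1 < k → tableUp D i z k + (i + 1) = k →
        (g k < g i ↔ D k + i = k) := by
      intro k hkm hk hc
      rw [tableUp_of_gt hk] at hc
      split_ifs at hc with h4
      · exact ⟨fun _ => h4, fun _ => h2 k hk hkm h4⟩
      · have := h3 k hk hkm hc
        exact ⟨fun _ => by omega, fun _ => by omega⟩
    -- Entry `i` of `g` is the larger one, so the swap back is of the second kind; `key` says that
    -- its cut moves precisely the former children of `i`.
    obtain ⟨z', hz'⟩ := IsParam.exists hg hi
    have ht := hz'.isTable hg dg hi
    unfold IsParam at hz'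
    rw [if_neg hne] at hz'
    rw [newTable_down hne] at ht
    refine ht.congr' fun k hk => ?_
    rcases lt_trichotomy k i with h4 | h4 | h4
    · rw [tableDown_of_lt h4, tableUp_of_lt h4]
    · subst h4
      rw [tableDown_left, tableUp_right]; split_ifs <;> omega
    by_cases h5 : k = i + 1
    · subst h5; rw [tableDown_right, h1]
    · have h6 : i + 1 < k := by omega
      rw [tableDown_of_gt h6]
      have h7 := key k hk h6
      have h8 := hz'.2 k h6 hk
      rw [tableUp_of_gt h6] at h7 h8 ⊢
      split_ifs at * <;> omega

/-- Swapping back puts the entry at `i + 1` of `g` at position `i`. The table of the pattern is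
recovered precisely if this entry then has the old parent of `i`; all other entries come out right
by themselves. -/
theorem back_down (hg : IsTable m g (newTable D i z)) (dg : Distinct m g) (hD : IsTable m f D)
    (df : Distinct m f) (hi : i + 1 < m) (h1 : D (i + 1) ≠ 1) :
    IsTable m (swapFun g i) D ↔ (0 < D i → g (i - D i) < g (i + 1)) ∧
      ∀ j, j < i → (0 < D i → i < j + D i) → g (i + 1) < g j := by
  have hlt := hD.lt_of_ne_one df hi h1
  have hDk : ∀ k, k < m → D k ≤ k := fun k hk => (hD k hk).le
  rw [newTable_down h1] at hg
  have hone : tableDown D i z (i + 1) = 1 := tableDown_right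
  constructor
  · intro h
    have hs : ∀ k, k < i → g k = swapFun g i k := fun k hk =>
      (swapFun_of_ne (by omega) (by omega)).symm
    have hs' : g (i + 1) = swapFun g i i := swapFun_left.symm
    rw [hs']
    rcases h.cases (dg.swapFun hi) (show i < m by omega) with ⟨h2, h3⟩ | ⟨q, h2, h3, h4, h5⟩
    · exact ⟨fun h4 => by omega, fun j hj _ => by rw [hs j hj]; exact h3 j hj⟩
    · refine ⟨fun _ => ?_, fun j hj h6 => ?_⟩
      · rw [show i - D i = q by omega, hs q h2]; exact h4
      · rw [hs j hj]; exact h5 j (by omega) hj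
  · rintro ⟨h2, h3⟩
    have hp : PrevBelow m g i (g (i + 1)) (D i) := by
      have := hDk i (by omega)
      by_cases h0 : D i = 0
      · rw [h0]
        exact .zero fun j hj => (h3 j hj (by omega)).le
      · exact .pos (i - D i) (by omega) (by omega) (by omega) (h2 (by omega)) fun j hj hj' =>
          (h3 j hj' (by omega)).le
    -- Entry `i + 1` of the table of `g` is `1`, so the swap back is of the first kind, and its
    -- parameter has just been shown to be `D i`.
    refine (isTable_tableUp hg dg hi hone hp).congr' fun k hk => ?_
    rcases lt_trichotomy k i with h4 | h4 | h4
    · rw [tableUp_of_lt h4, tableDown_of_lt h4]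
    · subst h4; rw [tableUp_left]
    by_cases h5 : k = i + 1
    · subst h5
      rw [tableUp_right, tableDown_left]; split_ifs <;> omega
    · have h6 : i + 1 < k := by omega
      -- In the pattern, entry `i + 1` is smaller than entry `i` and hides it from the right.
      have h7 : D k + i ≠ k := by
        intro h7
        rcases hD.cases df hk with ⟨h8, h9⟩ | ⟨q, h8, h9, h10, h11⟩
        · omega
        · have := h11 (i + 1) (by omega) h6
          obtain rfl : q = i := by omega
          omega
      rw [tableUp_of_gt h6, tableDown_of_gt h6]
      split_ifs <;> omega

/-- Positions that decide whether a swap back at `i` is possible: `u` is the first child of `i`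
after `i + 1`, `v` is the last child of `i + 1`, and `i - e` is the last position on the chain from
`i - 1` to the parent of `i` (`0` if there is none). -/
structure BackData (m : ℕ) (f : ℕ → ℤ) (D : ℕ → ℕ) (i u v e : ℕ) : Prop where
  u_le : ∀ k, i + 1 < k → k < m → D k + i = k → u ≠ 0 ∧ u ≤ k
  u_mem : u ≠ 0 → i + 1 < u ∧ u < m ∧ D u + i = u
  le_v : ∀ k, i + 1 < k → k < m → D k + (i + 1) = k → k ≤ v
  v_mem : v ≠ 0 → i + 1 < v ∧ v < m ∧ D v + (i + 1) = v
  e_zero : e = 0 → ∀ j, j < i → ¬ (0 < D i → i < j + D i)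
  e_le : e ≤ i
  e_vis : e ≠ 0 → ∀ j, i - e < j → j < i → f (i - e) < f j
  e_next : e ≠ 0 → (D (i - e) = 0 ∧ D i = 0) ∨ (D (i - e) ≠ 0 ∧ D (i - e) + e = D i)

/-- The lower position of the first comparison for the swap back. -/
def lowFst (D : ℕ → ℕ) (i u : ℕ) : ℕ :=
  if D (i + 1) = 1 then (if u = 0 then i + 1 else u) else (if D i = 0 then i else i - D i)

/-- The higher position of the first comparison for the swap back. -/
def highFst (D : ℕ → ℕ) (i : ℕ) : ℕ := if D (i + 1) = 1 then i else i + 1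

/-- The lower position of the second comparison for the swap back. -/
def lowSnd (D : ℕ → ℕ) (i v e : ℕ) : ℕ :=
  if D (i + 1) = 1 then (if v = 0 then i + 1 else i) else (if e = 0 then i else i + 1)

/-- The higher position of the second comparison for the swap back. -/
def highSnd (D : ℕ → ℕ) (i v e : ℕ) : ℕ :=
  if D (i + 1) = 1 then (if v = 0 then i else v) else (if e = 0 then i + 1 else i - e)

/-- Siblings decrease from left to right, so of each group of children only the extreme one has to
be compared with entry `i`. In the other case the smallest position between the parent of `i` and
`i` stands for all of them; that it is still the smallest in `g` is `vis_transfer`. If there is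
nothing to compare, the chosen pair is `i`, `i + 1` in the order that holds in `g`. -/
theorem back_iff (hg : IsTable m g (newTable D i z)) (dg : Distinct m g) (hD : IsTable m f D)
    (df : Distinct m f) (hi : i + 1 < m) {u v e : ℕ} (hb : BackData m f D i u v e) :
    IsTable m (swapFun g i) D ↔ g (lowFst D i u) < g (highFst D i) ∧
      g (lowSnd D i v e) < g (highSnd D i v e) := by
  by_cases h1 : D (i + 1) = 1
  · rw [back_up hg dg hD hi h1]
    unfold lowFst highFst lowSnd highSnd
    simp only [if_pos h1]
    rw [newTable_up h1] at hg
    have hne : tableUp D i z (i + 1) ≠ 1 := by rw [tableUp_right]; split_ifs <;> omega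
    have hlt := hg.lt_of_ne_one dg hi hne
    refine and_congr ⟨fun h => ?_, fun h k hk hkm hkd => ?_⟩ ⟨fun h => ?_, fun h k hk hkm hkd => ?_⟩
    · split_ifs with hu
      · exact hlt
      · obtain ⟨h2, h3, h4⟩ := hb.u_mem hu
        exact h u h2 h3 h4
    · obtain ⟨hu, hle⟩ := hb.u_le k hk hkm hkd
      rw [if_neg hu] at h
      obtain ⟨h2, h3, h4⟩ := hb.u_mem hu
      rcases Nat.eq_or_lt_of_le hle with h5 | h5
      · rwa [← h5]
      · refine (hg.children_anti (q := i + 1) h2 hkm ?_ h5).trans_lt h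
        rw [tableUp_of_gt hk, if_pos hkd]; omega
    · split_ifs with hv
      · exact hlt
      · obtain ⟨h2, h3, h4⟩ := hb.v_mem hv
        exact h v h2 h3 h4
    · have hle := hb.le_v k hk hkm hkd
      have hv : v ≠ 0 := by omega
      rw [if_neg hv, if_neg hv] at h
      obtain ⟨h2, h3, h4⟩ := hb.v_mem hv
      rcases Nat.eq_or_lt_of_le hle with h5 | h5
      · rwa [h5]
      · refine h.trans_le (hg.children_anti (q := i + 1) hk h3 ?_ h5)
        rw [tableUp_of_gt h2, if_neg (by omega)]; omega
  · rw [back_down hg dg hD df hi h1]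
    unfold lowFst highFst lowSnd highSnd
    simp only [if_neg h1]
    have hlow : ∀ k, k < i → PrevBelow m g k (g k) (D k) := fun k hk => by
      have := hg k (by omega)
      rwa [newTable_of_lt hk] at this
    rw [newTable_down h1] at hg
    have hone : tableDown D i z (i + 1) = 1 := tableDown_right
    have hlt := hg.lt_of_one hi hone
    refine and_congr ⟨fun h => ?_, fun h h0 => ?_⟩ ⟨fun h => ?_, fun h j hj hjd => ?_⟩
    · split_ifs with h0
      · exact hlt
      · exact h (by omega)
    · rwa [if_neg (by omega)] at h
    · split_ifs with he
      · exact hlt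
      · have := hb.e_le
        have := (hD (i - e) (by omega)).le
        refine h _ (by omega) fun h0 => ?_
        rcases hb.e_next he with h2 | h2 <;> omega
    · have he : e ≠ 0 := fun he => hb.e_zero he j hj hjd
      have hei := hb.e_le
      rw [if_neg he, if_neg he] at h
      have hvis := vis_transfer (n := i) (q := i - e) (fun k hk => hD k (by omega)) hlow (by omega)
        (hb.e_vis he)
      rcases lt_trichotomy j (i - e) with h3 | h3 | h3
      · refine h.trans_le ?_
        have hn := hb.e_next he
        rcases hlow (i - e) (by omega) with ⟨h4, h5⟩ | ⟨h4, h5, h6, h7, h8⟩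
        · exact h5 j h3 (by omega)
        · exact h8 j (by omega) h3
      · rwa [h3]
      · exact h.trans (hvis j h3 hj)

theorem IsParam.unique_of_table (h : IsTable m f D) (hf : Distinct m f) {i' z' : ℕ}
    (hi : i' + 1 < m) (hz : IsParam m f D i' z') (hp : IsTable m g D) (hv : Valid m g D i z)
    (he : IsTable m (swapFun f i') (newTable D i z)) : i' = i ∧ z' = z :=
  newTable_unique (hz.valid h hi hp) hv fun _ hk => (hz.isTable h hf hi).unique he hk

end

/-- `CT_τ` matching with a sequence whose table belongs to the parameters `i`, `z`. -/
theorem swapMatch_iff {p y : List ℤ} (hp : p.Nodup) (hy : y.Nodup) {m : ℕ} (hm : p.length = m)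
    (hym : y.length = m) {D : ℕ → ℕ} (hD : IsTable m (entry p) D) {i z : ℕ}
    (hv : Valid m (entry p) D i z) (hyt : parentDistance y = tableList m (newTable D i z)) :
    SwapMatch p y ↔ IsParam m (entry p) D i z ∨ IsTable m (swapFun (entry y) i) D := by
  have hpD := (parentDistance_eq_tableList hm).2 hD
  have hyT := (parentDistance_eq_tableList hym).1 hyt
  have dp := distinct_entry hp hm
  have dy := distinct_entry hy hym
  have hi := hv.lt
  constructor
  · rintro ⟨-, h | ⟨i', hi', h | h⟩⟩
    · have := (cartesianTree_eq_iff hp hy).1 h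
      rw [hpD, hyt, tableList_eq_iff] at this
      exact absurd (this (i + 1) hi).symm newTable_ne
    · left
      have h2 := (cartesianTree_eq_iff (nodup_swapAt hp) hy).1 h
      rw [hyt, parentDistance_swapAt hm (by omega)] at h2
      obtain ⟨z', hz'⟩ := IsParam.exists hD (i := i') (by omega)
      obtain ⟨rfl, rfl⟩ := hz'.unique_of_table hD dp (by omega) hD hv h2
      exact hz'
    · right
      have h2 := (cartesianTree_eq_iff (nodup_swapAt hy) hp).1 h
      rw [hpD, parentDistance_swapAt hym (by omega)] at h2
      obtain ⟨z', hz'⟩ := IsParam.exists h2 (i := i') (by omega)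
      -- Here `y` is read as the result of a swap in the swapped sequence, which has the table `D`;
      -- uniqueness then applies as in the case of a swap in the pattern.
      have h3 : IsTable m (swapFun (swapFun (entry y) i') i') (newTable D i z) :=
        hyT.congr fun k _ => (swapFun_swapFun _ _ _).symm
      obtain ⟨rfl, rfl⟩ := hz'.unique_of_table h2 (dy.swapFun (by omega)) (by omega) hD hv h3
      exact h2
  · intro h
    refine ⟨by omega, .inr ⟨i, by omega, ?_⟩⟩
    rcases h with h | h
    · left
      rw [cartesianTree_eq_iff (nodup_swapAt hp) hy, hyt, parentDistance_swapAt hm hi]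
      exact h.isTable hD dp hi
    · right
      rw [cartesianTree_eq_iff (nodup_swapAt hy) hp, hpD, parentDistance_swapAt hym hi]
      exact h

end CTSwap

namespace CTSwap

/-! ### Suffixes of tables -/

theorem tableList_succ (d : ℕ) (g : ℕ → ℕ) : tableList (d + 1) g = tableList d g ++ [g d] := by
  simp [tableList, List.range_succ]

theorem tableList_take {d n : ℕ} (h : d ≤ n) (g : ℕ → ℕ) :
    (tableList n g).take d = tableList d g := by
  simp [tableList, ← List.map_take, List.take_range, h]

theorem length_suffixTable {s : List ℕ} {l : ℕ} (h : l ≤ s.length) :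
    (suffixTable s l).length = l := by
  simp only [suffixTable, List.length_mapIdx, List.length_drop]
  omega

theorem suffixTable_getD {s : List ℕ} {l k : ℕ} (h : l ≤ s.length) (hk : k < l) :
    (suffixTable s l).getD k 0 =
      if s.getD (s.length - l + k) 0 ≤ k then s.getD (s.length - l + k) 0 else 0 := by
  have h1 : s.length - l + k < s.length := by omega
  simp [suffixTable, List.getD_eq_getElem?_getD, List.getElem?_mapIdx, List.getElem?_drop, h1]

/-- The label with which a state continues depends on its depth: a parent outside of the suffix
counts as none. -/
theorem suffixTable_append {s : List ℕ} {l : ℕ} (h : l ≤ s.length) (c : ℕ) :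
    suffixTable (s ++ [c]) (l + 1) = suffixTable s l ++ [if c ≤ l then c else 0] := by
  have e : (s ++ [c]).length - (l + 1) = s.length - l := by simp
  have e2 : s.length - (s.length - l) = l := by omega
  simp only [suffixTable, e]
  rw [List.drop_append_of_le_length (by omega), List.mapIdx_append]
  simp [e2]

theorem suffixTable_zero (s : List ℕ) : suffixTable s 0 = [] := by
  simp [suffixTable]

/-- An entry that points out of the longer suffix also points out of the shorter one, so cutting
twice is cutting once. This is what makes failure links composable. -/
theorem suffixTable_suffixTable {s : List ℕ} {l l' : ℕ} (h : l ≤ s.length) (h' : l' ≤ l) :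
    suffixTable (suffixTable s l) l' = suffixTable s l' := by
  have hl := length_suffixTable h
  refine ext_getD (by rw [length_suffixTable (by omega), length_suffixTable (by omega)]) fun k hk => ?_
  rw [length_suffixTable (by omega)] at hk
  rw [suffixTable_getD (by omega) hk, suffixTable_getD (by omega) hk, hl,
    suffixTable_getD h (by omega), show s.length - l + (l - l' + k) = s.length - l' + k by omega]
  split_ifs <;> omega

/-- `u` is the largest length `≤ b` of a suffix of `X` that belongs to `S`. -/
structure IsLongest (S : Set (List ℕ)) (X : List ℕ) (b u : ℕ) : Prop where
  le : u ≤ b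
  mem : suffixTable X u ∈ S
  max : ∀ l, u < l → l ≤ b → suffixTable X l ∉ S

/-- The state of the search for the longest suffix of `X ++ [c]`: suffixes of length more than
`u + 1` are excluded. -/
structure Searching (S : Set (List ℕ)) (X : List ℕ) (c b u : ℕ) : Prop where
  le : u ≤ b
  mem : suffixTable X u ∈ S
  max : ∀ l, u < l → l ≤ b → suffixTable X l ++ [if c ≤ l then c else 0] ∉ S

section
variable {S : Set (List ℕ)} {X : List ℕ} {b c u v : ℕ}

theorem IsLongest.searching (hS : ∀ s c, s ++ [c] ∈ S → s ∈ S) (h : IsLongest S X b u) :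
    Searching S X c b u :=
  ⟨h.le, h.mem, fun l hl hlb hm => h.max l hl hlb (hS _ _ hm)⟩

theorem Searching.found (hb : b ≤ X.length) (h : Searching S X c b u)
    (hm : suffixTable X u ++ [if c ≤ u then c else 0] ∈ S) :
    IsLongest S (X ++ [c]) (b + 1) (u + 1) := by
  refine ⟨by have := h.le; omega, ?_, fun l hl hlb => ?_⟩
  · rwa [suffixTable_append (by have := h.le; omega)]
  · obtain ⟨l, rfl⟩ : ∃ l', l = l' + 1 := ⟨l - 1, by omega⟩
    rw [suffixTable_append (by omega)]
    exact h.max l (by omega) (by omega)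

/-- No suffix of length strictly between `v` and `u` is in `S`; as `S` is closed under removing the
last label, no extension of such a suffix is in `S` either. -/
theorem Searching.fail (hS : ∀ s c, s ++ [c] ∈ S → s ∈ S) (hb : b ≤ X.length)
    (h : Searching S X c b u) (hm : suffixTable X u ++ [if c ≤ u then c else 0] ∉ S)
    (hv : IsLongest S (suffixTable X u) (u - 1) v) : Searching S X c b v := by
  have hub := h.le
  have hvu := hv.le
  refine ⟨by omega, ?_, fun l hl hlb => ?_⟩
  · have := hv.mem
    rwa [suffixTable_suffixTable (by omega) (by omega)] at this
  · rcases lt_trichotomy l u with h1 | h1 | h1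
    · intro h2
      have := hv.max l hl (by omega)
      rw [suffixTable_suffixTable (by omega) (by omega)] at this
      exact this (hS _ _ h2)
    · rwa [h1]
    · exact h.max l h1 hlb

theorem IsLongest.failure {p : List ℤ} {s : List ℕ}
    (h : IsLongest (states p) s (s.length - 1) u) : failure p s = suffixTable s u := by
  classical
  unfold CTSwap.failure
  have : Nat.findGreatest (fun l => suffixTable s l ∈ states p) (s.length - 1) = u := by
    rw [Nat.findGreatest_eq_iff]
    exact ⟨h.le, fun _ => h.mem, fun l hl hlb => h.max l hl hlb⟩
  convert rfl using 2
  convert this.symm using 2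

end

/-! ### Representatives of prefixes -/

open Classical in
/-- The first table that agrees with table `r` on the first `d` entries. -/
noncomputable def firstRep (W : ℕ → ℕ → ℕ) (d r : ℕ) : ℕ :=
  Nat.find (p := fun r' => ∀ k, k < d → W r' k = W r k) ⟨r, fun _ _ => rfl⟩

section
variable {W : ℕ → ℕ → ℕ} {d r r' : ℕ}

theorem firstRep_spec : ∀ k, k < d → W (firstRep W d r) k = W r k := by
  classical
  exact Nat.find_spec (p := fun r' => ∀ k, k < d → W r' k = W r k) ⟨r, fun _ _ => rfl⟩

theorem firstRep_le_of (h : ∀ k, k < d → W r' k = W r k) : firstRep W d r ≤ r' := by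
  classical
  exact Nat.find_min' _ h

theorem firstRep_le : firstRep W d r ≤ r := firstRep_le_of fun _ _ => rfl

theorem firstRep_eq_iff : firstRep W d r = firstRep W d r' ↔ ∀ k, k < d → W r k = W r' k := by
  constructor
  · intro h k hk
    rw [← firstRep_spec (W := W) (r := r) k hk, h, firstRep_spec (W := W) k hk]
  · intro h
    refine le_antisymm (firstRep_le_of fun k hk => ?_) (firstRep_le_of fun k hk => ?_)
    · rw [firstRep_spec (W := W) k hk, h k hk]
    · rw [firstRep_spec (W := W) k hk, h k hk]

theorem firstRep_firstRep : firstRep W d (firstRep W d r) = firstRep W d r :=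
  firstRep_eq_iff.2 firstRep_spec

theorem firstRep_zero : firstRep W 0 r = 0 :=
  Nat.le_zero.1 (firstRep_le_of fun k hk => by omega)

theorem firstRep_self_succ (h : firstRep W d r = r) : firstRep W (d + 1) r = r := by
  refine le_antisymm firstRep_le ?_
  conv_lhs => rw [← h]
  exact firstRep_le_of fun k hk => firstRep_spec k (by omega)

/-- A longer prefix is shared by fewer tables: once first, a table stays first. The pairs `(d, r)`
with `firstRep W d r = r` serve as the nodes of the trie. -/
theorem firstRep_self_mono {d' : ℕ} (hd : d ≤ d') (h : firstRep W d r = r) :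
    firstRep W d' r = r := by
  induction d', hd using Nat.le_induction with
  | base => exact h
  | succ n _ ih => exact firstRep_self_succ ih

theorem firstRep_succ_eq_iff : firstRep W (d + 1) r = firstRep W (d + 1) r' ↔
    firstRep W d r = firstRep W d r' ∧ W r d = W r' d := by
  rw [firstRep_eq_iff, firstRep_eq_iff]
  constructor
  · exact fun h => ⟨fun k hk => h k (by omega), h d (by omega)⟩
  · rintro ⟨h, h'⟩ k hk
    rcases Nat.lt_succ_iff_lt_or_eq.1 hk with h1 | h1
    · exact h k h1
    · rw [h1]; exact h'

theorem tableList_firstRep : tableList d (W (firstRep W d r)) = tableList d (W r) :=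
  tableList_eq_iff.2 firstRep_spec

end

/-- `W 0`, …, `W (K - 1)` are the tables of the automaton of `p`. -/
structure Lists (p : List ℤ) (K : ℕ) (W : ℕ → ℕ → ℕ) : Prop where
  pos : 0 < K
  tables : ∀ w, w ∈ tables p ↔ ∃ r, r < K ∧ w = tableList p.length (W r)
  le : ∀ r k, r < K → k < p.length → W r k ≤ k

section
variable {p : List ℤ} {K : ℕ} {W : ℕ → ℕ → ℕ}

theorem Lists.states (h : Lists p K W) (s : List ℕ) :
    s ∈ states p ↔ ∃ d r, d ≤ p.length ∧ r < K ∧ s = tableList d (W r) := by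
  constructor
  · rintro ⟨w, hw, hs⟩
    obtain ⟨r, hr, rfl⟩ := (h.tables w).1 hw
    have h1 := hs.length_le
    rw [length_tableList] at h1
    refine ⟨s.length, r, h1, hr, ?_⟩
    rw [← tableList_take h1]
    exact List.prefix_iff_eq_take.1 hs
  · rintro ⟨d, r, hd, hr, rfl⟩
    refine ⟨_, (h.tables _).2 ⟨r, hr, rfl⟩, ?_⟩
    rw [← tableList_take hd]
    exact List.take_prefix _ _

theorem Lists.mem (h : Lists p K W) {d r : ℕ} (hd : d ≤ p.length) (hr : r < K) :
    tableList d (W r) ∈ CTSwap.states p := (h.states _).2 ⟨d, r, hd, hr, rfl⟩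

theorem states_closed (p : List ℤ) : ∀ s c, s ++ [c] ∈ states p → s ∈ states p :=
  fun _ _ ⟨w, hw, hs⟩ => ⟨w, hw, (List.prefix_append _ _).trans hs⟩

/-- A child of a state, in terms of the tables. -/
theorem Lists.child_iff (h : Lists p K W) {d r c : ℕ} (hd : d < p.length) :
    tableList d (W r) ++ [c] ∈ CTSwap.states p ↔
      ∃ r', r' < K ∧ firstRep W d r' = firstRep W d r ∧ W r' d = c := by
  rw [h.states]
  constructor
  · rintro ⟨d', r', hd', hr', e⟩
    have hl := congrArg List.length e
    simp only [List.length_append, length_tableList, List.length_singleton] at hl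
    subst hl
    rw [tableList_succ] at e
    obtain ⟨h1, h2⟩ := List.append_inj' e (by simp)
    refine ⟨r', hr', ?_, by simpa using h2.symm⟩
    rw [firstRep_eq_iff]
    exact fun k hk => (tableList_eq_iff.1 h1 k hk).symm
  · rintro ⟨r', hr', h1, rfl⟩
    refine ⟨d + 1, r', hd, hr', ?_⟩
    rw [tableList_succ, tableList_eq_iff.2 (firstRep_eq_iff.1 h1)]

theorem Lists.not_mem (h : Lists p K W) {s : List ℕ} (hs : p.length < s.length) :
    s ∉ CTSwap.states p := by
  rw [h.states]
  rintro ⟨d, r, hd, -, rfl⟩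
  rw [length_tableList] at hs
  omega

end

/-- A suffix of the table of a text gives the table of a factor of the text. -/
theorem suffixTable_factor {t : List ℤ} {m j : ℕ} {T : ℕ → ℕ} (hmj : m ≤ j) (hj : j ≤ t.length)
    (hT : ∀ q, q < t.length → PrevBelow m (entry t) q (entry t q) (T q)) :
    suffixTable (tableList j T) m = parentDistance ((t.drop (j - m)).take m) := by
  have hl : ((t.drop (j - m)).take m).length = m := by simp; omega
  refine ext_getD (by rw [length_suffixTable (by simpa using hmj)]; simp; omega) fun k hk => ?_
  rw [length_suffixTable (by simpa using hmj)] at hk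
  rw [suffixTable_getD (by simpa using hmj) hk, length_tableList, tableList_getD (by omega)]
  symm
  refine parentDistance_getD (by omega) (Nat.lt_succ_self k) ?_
  have e : ∀ l, l < m → entry ((t.drop (j - m)).take m) l = entry t (j - m + l) := fun l hl => by
    rw [entry_take hl, entry_drop]
  rw [e k hk]
  refine ((hT (j - m + k) (by omega)).drop hk).congr fun l hl => (e l (by omega)).symm

end CTSwap

namespace CTSwap

/-! ### The programs: registers and arrays -/

infixl:65 " +ₑ " => HExpr.op Op.add
infixl:65 " -ₑ " => HExpr.op Op.sub
infixl:70 " *ₑ " => HExpr.op Op.mul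
infixl:70 " /ₑ " => HExpr.op Op.div
infix:50 " <ₑ " => HExpr.op Op.lt
infix:50 " =ₑ " => HExpr.op Op.eq
prefix:max "§" => HExpr.reg
prefix:max "¢" => HExpr.const
infix:40 " ←ₑ " => HCmd.assign
infixr:35 " ;; " => HCmd.seq

notation "ρtables" => (0 : ℕ)
notation "ρstates" => (1 : ℕ)
notation "ρpos" => (2 : ℕ)
notation "ρdist" => (3 : ℕ)
notation "ρtmp" => (4 : ℕ)
notation "ρgo" => (5 : ℕ)
notation "ρswap" => (6 : ℕ)
notation "ρcol" => (7 : ℕ)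
notation "ρcut" => (8 : ℕ)
notation "ρdepth" => (9 : ℕ)
notation "ρrow" => (10 : ℕ)
notation "ρcurDepth" => (11 : ℕ)
notation "ρcurRow" => (12 : ℕ)
notation "ρlabel" => (13 : ℕ)
notation "ρadj" => (14 : ℕ)
notation "ρhit" => (15 : ℕ)
notation "ρfst" => (16 : ℕ)
notation "ρlast" => (17 : ℕ)
notation "ρprev" => (18 : ℕ)

-- `αdist` uses row `0` only. `αparam` holds the swap position (row `0`) and the parameter (row `1`)
-- of each table. `αback` is indexed by swap positions: rows `0` to `3` hold the places to be
-- compared, row `4` the parameter of the swap in the pattern itself. `αrep`, `αfailDepth`,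
-- `αfailRow` and `αnum` are indexed by depth and table. `αbranch` names the row of `αchild` that
-- belongs to a node, and `αchild` is indexed by that row and the label.
notation "αdist" => (0 : ℕ)
notation "αtable" => (1 : ℕ)
notation "αparam" => (2 : ℕ)
notation "αback" => (3 : ℕ)
notation "αrep" => (4 : ℕ)
notation "αbranch" => (5 : ℕ)
notation "αchild" => (6 : ℕ)
notation "αfailDepth" => (7 : ℕ)
notation "αfailRow" => (8 : ℕ)
notation "αnum" => (9 : ℕ)

/-- The length of the pattern. -/
abbrev lenExpr : HExpr := .len .pattern

/-- The remainder modulo the length of the pattern. -/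
def modExpr (e : HExpr) : HExpr := e -ₑ (e /ₑ lenExpr) *ₑ lenExpr

section
variable {I : Input} {S B : ℕ} {h : HState}

@[simp] theorem modExpr_val {e : HExpr} :
    (modExpr e).val I h = e.val I h % I.pattern.length := by
  simp only [modExpr, HExpr.val, Op.apply, Input.get]
  have := Nat.div_add_mod' (e.val I h) I.pattern.length
  omega

@[simp] theorem modExpr_ok {e : HExpr} : (modExpr e).ok I S h ↔ e.ok I S h := by
  simp [modExpr]

end

/-! ### Walking along the chain of previous smaller entries -/

/-- The distance table entry of a position that has been visited at most `m` steps ago. -/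
def distExpr (e : HExpr) : HExpr := .arr αdist ¢0 (modExpr e)

/-- Advance `ρdist` along the chain of previous smaller entries of the position in register `i`, as long as the
distance is below the length of the pattern. -/
def chainStep (i : ℕ) : HCmd :=
  ρtmp ←ₑ distExpr (§i -ₑ §ρdist) ;;
  ρdist ←ₑ .cond (¢0 <ₑ §ρtmp) (.cond (§ρdist +ₑ §ρtmp <ₑ lenExpr) (§ρdist +ₑ §ρtmp) ¢0) ¢0

/-- The first position of the chain. -/
def chainStart (i : ℕ) : HCmd := ρdist ←ₑ .cond (¢0 <ₑ §i) (¢1 <ₑ lenExpr) ¢0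

/-- Find the distance from the position in register `i` to the previous entry below the entry
at `v`. -/
def findBelow (s : Source) (i : ℕ) (v : HExpr) : HCmd :=
  chainStart i ;;
  .loop (.cond (¢0 <ₑ §ρdist) (¢0 =ₑ .less s (§i -ₑ §ρdist) v) ¢0) (chainStep i)

/-- `e` is a point of the chain from `i` such that all positions passed have entries `≥ v`. -/
def OnChain (m : ℕ) (f : ℕ → ℤ) (i : ℕ) (v : ℤ) (e : ℕ) : Prop :=
  (e = 0 ∧ ∀ j, j < i → i < j + m → v ≤ f j) ∨
    (0 < e ∧ e ≤ i ∧ e < m ∧ ∀ j, i - e < j → j < i → v ≤ f j)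

/-- The next distance on the chain. -/
def nextDist (m : ℕ) (T : ℕ → ℕ) (i e : ℕ) : ℕ :=
  if 0 < T (i - e) then (if e + T (i - e) < m then e + T (i - e) else 0) else 0

/-- The first distance on the chain. -/
def startDist (m i : ℕ) : ℕ := if 0 < i then (if 1 < m then 1 else 0) else 0

/-- The number of positions on the chain of previous smaller entries. -/
def chainLength (T : ℕ → ℕ) (q : ℕ) : ℕ :=
  if _h : 0 < T q ∧ T q ≤ q then chainLength T (q - T q) + 1 else 1
termination_by q
decreasing_by omega

/-- The number of positions on the chain from distance `e` before `i`. -/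
def chainRest (T : ℕ → ℕ) (i e : ℕ) : ℕ := if e = 0 then 0 else chainLength T (i - e)

section
variable {m : ℕ} {f : ℕ → ℤ} {T : ℕ → ℕ} {i e : ℕ} {v : ℤ}

theorem OnChain.start : OnChain m f i v (startDist m i) := by
  unfold startDist
  split_ifs with h1 h2
  · exact .inr ⟨by omega, by omega, h2, fun j hj hj' => by omega⟩
  · exact .inl ⟨rfl, fun j hj hj' => by omega⟩
  · exact .inl ⟨rfl, fun j hj hj' => by omega⟩

theorem OnChain.le (h : OnChain m f i v e) : e ≤ i := by
  rcases h with ⟨h, -⟩ | ⟨-, h, -⟩ <;> omega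

/-- Between a chain point and its previous smaller entry nothing is smaller than the point, so
nothing below `v` is skipped. If the next distance reaches `m`, no candidate is left in the window.
-/
theorem OnChain.next (hT : ∀ q, q < i → PrevBelow m f q (f q) (T q)) (h : OnChain m f i v e)
    (he : 0 < e) (hv : v ≤ f (i - e)) : OnChain m f i v (nextDist m T i e) := by
  rcases h with ⟨h1, -⟩ | ⟨h1, h2, h3, h4⟩
  · omega
  unfold nextDist
  rcases hT (i - e) (by omega) with ⟨h5, h6⟩ | ⟨h5, h6, h7, h8, h9⟩
  · rw [if_neg (by omega)]
    refine .inl ⟨rfl, fun j hj hj' => ?_⟩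
    rcases lt_trichotomy j (i - e) with h7 | h7 | h7
    · exact hv.trans (h6 j h7 (by omega))
    · rwa [h7]
    · exact h4 j h7 hj
  · rw [if_pos h5]
    split_ifs with hlt
    · refine .inr ⟨by omega, by omega, hlt, fun j hj hj' => ?_⟩
      rcases lt_trichotomy j (i - e) with h10 | h10 | h10
      · exact hv.trans (h9 j (by omega) h10)
      · rwa [h10]
      · exact h4 j h10 hj'
    · refine .inl ⟨rfl, fun j hj hj' => ?_⟩
      rcases lt_trichotomy j (i - e) with h10 | h10 | h10
      · exact hv.trans (h9 j (by omega) h10)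
      · rwa [h10]
      · exact h4 j h10 hj

theorem OnChain.prevBelow (h : OnChain m f i v e) (hv : 0 < e → f (i - e) < v) :
    PrevBelow m f i v e := by
  rcases h with h | ⟨h1, h2, h3, h4⟩
  · exact .inl h
  · exact .inr ⟨h1, h2, h3, hv h1, h4⟩

theorem chainLength_pos : 0 < chainLength T i := by
  unfold chainLength; split_ifs <;> omega

theorem chainRest_next (he : 0 < e) (hT : T (i - e) ≤ i - e) :
    chainRest T i (nextDist m T i e) < chainRest T i e := by
  have hp := chainLength_pos (T := T) (i := i - e)
  unfold nextDist
  split_ifs with h1 h2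
  · have e1 : chainRest T i e = chainLength T (i - e - T (i - e)) + 1 := by
      rw [chainRest, if_neg (by omega), chainLength, dif_pos ⟨h1, hT⟩]
    rw [e1, chainRest, if_neg (by omega), Nat.sub_sub]
    omega
  · rw [chainRest, chainRest, if_pos rfl, if_neg (by omega)]; exact hp
  · rw [chainRest, chainRest, if_pos rfl, if_neg (by omega)]; exact hp

/-- The chain that starts at `i` consists of `i` and the chain from its parent: the points passed in
the search for the parent disappear for good. This is the source of the amortised bounds. -/
theorem chainLength_eq (h : T i ≤ i) : chainLength T i = chainRest T i (T i) + 1 := by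
  rw [chainLength, chainRest]
  split_ifs <;> omega

theorem chainRest_start_le : chainRest T i (startDist m i) ≤ chainRest T i (if i = 0 then 0 else 1) := by
  unfold startDist chainRest
  split_ifs <;> omega

theorem chainLength_le (q : ℕ) : chainLength T q ≤ q + 1 := by
  induction q using Nat.strong_induction_on with
  | _ q ih =>
    rw [chainLength]
    split_ifs with h
    · have := ih (q - T q) (by omega); omega
    · omega

theorem chainRest_le (he : e ≤ i) : chainRest T i e ≤ i := by
  unfold chainRest
  split_ifs
  · omega
  · have := chainLength_le (T := T) (i - e); omega

end

/-- The array of distances holds the last `m` values of `T` before `j`. -/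
def HoldsDist (m : ℕ) (T : ℕ → ℕ) (j : ℕ) (h : HState) : Prop :=
  ∀ q, q < j → j ≤ q + m → h.arr αdist 0 (q % m) = T q

section
variable {I : Input} {S B : ℕ} {h : HState}

/-- The side conditions under which expressions are evaluated. -/
structure Fits (I : Input) (S B : ℕ) : Prop where
  pos : 0 < I.pattern.length
  side : 8 * I.pattern.length ≤ S
  sq : S * S ≤ B
  text : 2 * I.text.length + 2 * I.pattern.length + 8 ≤ B

theorem Fits.le (H : Fits I S B) : 8 * S ≤ B := by
  have h1 := H.side
  have h2 := H.pos
  have h3 := H.sq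
  have : 8 * S ≤ S * S := Nat.mul_le_mul_right _ (by omega)
  omega

theorem run_chainStep (H : Fits I S B) {T : ℕ → ℕ} {r : ℕ}
    (hD : HoldsDist I.pattern.length T (h.reg r) h) (he : 0 < h.reg ρdist)
    (hej : h.reg ρdist ≤ h.reg r) (hem : h.reg ρdist < I.pattern.length)
    (hT : T (h.reg r - h.reg ρdist) ≤ I.pattern.length) {Q : HState → ℕ → Prop}
    (hQ : ∀ h', Frame (chainStep r) h h' →
      h'.reg ρdist = nextDist I.pattern.length T (h.reg r) (h.reg ρdist) → Q h' 0) :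
    Run I S B (chainStep r) h Q := by
  have hS := H.side
  have hB := H.le
  have hm : (h.reg r - h.reg ρdist) % I.pattern.length < I.pattern.length := Nat.mod_lt _ H.pos
  refine Run.mono (Q' := fun h' t => h'.reg ρdist =
    nextDist I.pattern.length T (h.reg r) (h.reg ρdist) ∧ t = 0) ?_ fun h' t F ⟨q, ht⟩ => ht ▸ hQ h' F q
  have hDv := hD (h.reg r - h.reg ρdist) (by omega) (by omega)
  simp only [chainStep, distExpr, run_seq, run_assign, HExpr.ok_arr, HExpr.ok_const, modExpr_ok,
    HExpr.ok_op, HExpr.ok_reg, HExpr.val_const, modExpr_val, HExpr.val_op, HExpr.val_reg,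
    HExpr.val_arr, HExpr.val_cond, HExpr.ok_cond, HExpr.ok_len, HExpr.val_len, Op.apply_sub, hDv,
    select_lt, Op.apply_add, HState.setReg_reg, Input.get_pattern]
  simp only [nextDist]
  generalize T (h.reg r - h.reg ρdist) = x at *
  norm_num
  split_ifs <;> omega

theorem run_chainStart (H : Fits I S B) {r : ℕ} {Q : HState → ℕ → Prop}
    (hQ : Q (h.setReg ρdist (startDist I.pattern.length (h.reg r))) 0) :
    Run I S B (chainStart r) h Q := by
  have hB := H.le
  have hS := H.side
  have hm := H.pos
  have e : select (Op.lt.apply 0 (h.reg r)) (Op.lt.apply 1 I.pattern.length) 0 =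
      startDist I.pattern.length (h.reg r) := by
    simp only [select_lt, startDist]
    rfl
  have : startDist I.pattern.length (h.reg r) < B := by unfold startDist; split_ifs <;> omega
  simpa [chainStart, e, -select_lt, this] using hQ

theorem regs_chainStep (r : ℕ) : (chainStep r).regs = [ρtmp, ρdist] := rfl

theorem arrs_chainStep (r : ℕ) : (chainStep r).arrs = [] := rfl

/-- Every iteration leaves one chain point behind, so the running time is bounded by the difference
of the chain lengths at the start and at the end. -/
theorem run_findBelow (H : Fits I S B) {T : ℕ → ℕ} {s : Source} {r : ℕ} {v : HExpr} {w : ℕ}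
    (hr : r ≠ ρdist) (hr' : r ≠ ρtmp)
    (hD : HoldsDist I.pattern.length T (h.reg r) h)
    (hT : ∀ q, q < h.reg r → PrevBelow I.pattern.length (entry (I.get s)) q (entry (I.get s) q) (T q))
    (hj : h.reg r < (I.get s).length) (hw : w < (I.get s).length)
    (hv : ∀ h' : HState, (∀ r, r ≠ ρtmp → r ≠ ρdist → h'.reg r = h.reg r) →
      v.ok I S h' ∧ v.val I h' = w) {Q : HState → ℕ → Prop}
    (hQ : ∀ h' t, Frame (findBelow s r v) h h' →
      PrevBelow I.pattern.length (entry (I.get s)) (h.reg r) (entry (I.get s) w) (h'.reg ρdist) →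
      t + chainRest T (h.reg r) (h'.reg ρdist) ≤
        chainRest T (h.reg r) (startDist I.pattern.length (h.reg r)) → Q h' t) :
    Run I S B (findBelow s r v) h Q := by
  set m := I.pattern.length with hm
  set f := entry (I.get s) with hf
  refine Run.mono (Q' := fun h' t => PrevBelow m f (h.reg r) (f w) (h'.reg ρdist) ∧
    t + chainRest T (h.reg r) (h'.reg ρdist) ≤ chainRest T (h.reg r) (startDist m (h.reg r))) ?_
    fun h' t F q => hQ h' t F q.1 q.2
  rw [findBelow, run_seq]
  refine run_chainStart H ?_
  set h0 := h.setReg ρdist (startDist m (h.reg r)) with hh0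
  have hc : ∀ {h'}, Frame (chainStep r) h0 h' → (∀ r, r ≠ ρtmp → r ≠ ρdist → h'.reg r = h.reg r) ∧
      h'.arr αdist = h.arr αdist := by
    intro h' F
    refine ⟨fun r' h1 h2 => ?_, ?_⟩
    · rw [F.reg r' (by simp [regs_chainStep, h1, h2]), hh0, HState.setReg_reg, if_neg h2]
    · rw [F.arr _ (by simp [arrs_chainStep]), hh0, HState.setReg_arr]
  refine run_loop (fun h' t => OnChain m f (h.reg r) (f w) (h'.reg ρdist) ∧
    t + chainRest T (h.reg r) (h'.reg ρdist) ≤ chainRest T (h.reg r) (startDist m (h.reg r)))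
    (fun h' => chainRest T (h.reg r) (h'.reg ρdist)) ?_ ?_ ?_ ?_
  · have e : h0.reg ρdist = startDist m (h.reg r) := by simp [hh0]
    rw [e]
    exact ⟨OnChain.start, by omega⟩
  · rintro h' t F ⟨h1, h2⟩
    obtain ⟨h3, h4⟩ := hc F
    obtain ⟨h5, h6⟩ := hv h' h3
    have := h3 r hr' hr
    simp [h5, h6, this]
    omega
  · rintro h' t F ⟨h1, h2⟩ hb
    obtain ⟨h3, h4⟩ := hc F
    obtain ⟨h5, h6⟩ := hv h' h3
    have h7 := h3 r hr' hr
    have hb' : 0 < h'.reg ρdist ∧ f w ≤ f (h.reg r - h'.reg ρdist) := by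
      by_contra h8
      refine hb ?_
      simp only [HExpr.val_cond, HExpr.val_op, HExpr.val_const, HExpr.val_reg, HExpr.val_less, h6,
        h7, select_lt, Op.apply_sub]
      split_ifs with h9
      · rw [Op.apply_eq_eq_zero, ne_comm, Ne, Input.cmp_eq_zero]
        exact fun h10 => h8 ⟨h9, h10⟩
      · rfl
    have h8 : h'.reg ρdist ≤ h.reg r ∧ h'.reg ρdist < m := by
      rcases h1 with h1 | h1 <;> omega
    have h9 := (hT (h.reg r - h'.reg ρdist) (by omega)).le
    refine run_chainStep H (T := T) ?_ hb'.1 (by omega) h8.2 ?_ ?_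
    · rw [h7]
      intro q hq hq'
      rw [h4]
      exact hD q hq hq'
    · rw [h7]
      exact ((hT (h.reg r - h'.reg ρdist) (by omega)).lt H.pos).le
    · intro h'' F' h10
      rw [h7] at h10
      rw [h10]
      have h11 := chainRest_next (m := m) hb'.1 h9
      exact ⟨⟨h1.next hT hb'.1 hb'.2, by rw [← hm]; omega⟩, h11⟩
  · rintro h' t F ⟨h1, h2⟩ hb
    obtain ⟨h3, h4⟩ := hc F
    obtain ⟨h5, h6⟩ := hv h' h3
    have h7 := h3 r hr' hr
    refine ⟨h1.prevBelow fun h8 => ?_, by omega⟩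
    simp only [HExpr.val_cond, HExpr.val_op, HExpr.val_const, HExpr.val_reg, HExpr.val_less, h6,
      h7, select_lt, Op.apply_sub, if_pos h8, Op.apply_eq_eq_zero] at hb
    rw [ne_comm, Ne, Input.cmp_eq_zero] at hb
    exact not_le.1 hb

end

end CTSwap

namespace CTSwap

/-! ### Computing parent distances in amortised constant time -/

/-- Compute the parent distance of the position in `ρpos` (`0` if it is too large) and store it. -/
def prevDist (s : Source) : HCmd :=
  findBelow s ρpos §ρpos ;; .put αdist ¢0 (modExpr §ρpos) §ρdist

/-- Compute the parent distances of the pattern. -/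
def buildDist : HCmd := ρpos ←ₑ ¢0 ;; .upto ρpos lenExpr (prevDist .pattern)

section
variable {I : Input} {S B : ℕ} {h : HState} {Q : HState → ℕ → Prop}

theorem arrs_prevDist (s : Source) : (prevDist s).arrs = [αdist] := rfl

/-- The length of the chain before position `k`. -/
def chainBefore (T : ℕ → ℕ) (k : ℕ) : ℕ := chainRest T k (if k = 0 then 0 else 1)

theorem chainBefore_zero {T : ℕ → ℕ} : chainBefore T 0 = 0 := by simp [chainBefore, chainRest]

theorem chainBefore_succ {T : ℕ → ℕ} {k : ℕ} : chainBefore T (k + 1) = chainLength T k := by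
  simp [chainBefore, chainRest]

/-- `chainBefore` is the potential: the search removes one point per iteration, and the new position
adds one. The distances are kept in a circular buffer of length `m`, so the space does not depend on
the text. -/
theorem run_prevDist (H : Fits I S B) {T : ℕ → ℕ} {s : Source}
    (hD : HoldsDist I.pattern.length T (h.reg ρpos) h)
    (hT : ∀ q, q < (I.get s).length →
      PrevBelow I.pattern.length (entry (I.get s)) q (entry (I.get s) q) (T q))
    (hj : h.reg ρpos < (I.get s).length)
    (hQ : ∀ h' t, Frame (prevDist s) h h' → h'.reg ρdist = T (h.reg ρpos) →
      HoldsDist I.pattern.length T (h.reg ρpos + 1) h' →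
      t + chainBefore T (h.reg ρpos + 1) ≤ chainBefore T (h.reg ρpos) + 1 → Q h' t) :
    Run I S B (prevDist s) h Q := by
  have hm := H.pos
  have hS := H.side
  have hB := H.le
  refine Run.mono (Q' := fun h' t => h'.reg ρdist = T (h.reg ρpos) ∧
    HoldsDist I.pattern.length T (h.reg ρpos + 1) h' ∧
      t + chainBefore T (h.reg ρpos + 1) ≤ chainBefore T (h.reg ρpos) + 1) ?_
    fun h' t F q => hQ h' t F q.1 q.2.1 q.2.2
  rw [prevDist, run_seq]
  refine run_findBelow (r := ρpos) (v := §ρpos) H (T := T) (w := h.reg ρpos) (by decide) (by decide) hD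
    (fun q hq => hT q (by omega)) hj hj (fun h' hh => ⟨trivial, hh _ (by decide) (by decide)⟩) ?_
  intro h' t F hp ht
  have hd := hp.unique (hT _ hj)
  have hpos : h'.reg ρpos = h.reg ρpos := F.reg _ (by simp [findBelow, chainStart, chainStep, HCmd.regs])
  have harr : h'.arr αdist = h.arr αdist := F.arr _ (by simp [findBelow, chainStart, chainStep, HCmd.arrs])
  have hlt := (hT _ hj).lt hm
  have hle := (hT _ hj).le
  have hmod : h.reg ρpos % I.pattern.length < I.pattern.length := Nat.mod_lt _ hm
  simp only [run_put, HExpr.ok_const, modExpr_ok, HExpr.ok_reg, HExpr.val_const, modExpr_val,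
    HExpr.val_reg, hpos, hd, true_and, HState.setArr_reg, add_zero]
  refine ⟨by omega, by omega, by omega, ?_, ?_⟩
  · intro q hq hq'
    rw [HState.setArr_arr]
    by_cases h1 : q = h.reg ρpos
    · rw [if_pos ⟨rfl, rfl, by rw [h1]⟩, h1]
    · rw [if_neg, harr]
      · exact hD q (by omega) (by omega)
      · rintro ⟨-, -, h2⟩
        -- Two positions of the current window differ by less than `m`, hence have different
        -- residues.
        have h3 : I.pattern.length ∣ h.reg ρpos - q := (Nat.modEq_iff_dvd' (by omega)).1 h2
        have := Nat.le_of_dvd (by omega) h3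
        omega
  · have h1 := chainLength_eq hle
    have h2 := chainRest_start_le (T := T) (m := I.pattern.length) (i := h.reg ρpos)
    rw [chainBefore_succ, chainBefore]
    rw [hd] at ht
    omega

theorem run_buildDist (H : Fits I S B) {T : ℕ → ℕ}
    (hT : IsTable I.pattern.length (entry I.pattern) T)
    (hQ : ∀ h' t, Frame buildDist h h' → HoldsDist I.pattern.length T I.pattern.length h' →
      t ≤ 2 * I.pattern.length → Q h' t) :
    Run I S B buildDist h Q := by
  have hB := H.le
  have hS := H.side
  have hm := H.pos
  refine Run.mono (Q' := fun h' t => HoldsDist I.pattern.length T I.pattern.length h' ∧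
    t ≤ 2 * I.pattern.length) ?_ fun h' t F q => hQ h' t F q.1 q.2
  simp only [buildDist, run_seq, run_assign, HExpr.ok_const, HExpr.val_const, true_and, zero_add]
  refine ⟨by omega, ?_⟩
  refine run_upto I.pattern.length
    (fun k h' t => HoldsDist I.pattern.length T k h' ∧ t + chainBefore T k ≤ 2 * k)
    (by omega) ?_ (by simp) (by decide) (fun h' F => ⟨trivial, rfl⟩) ?_ ?_
  · simp only [HState.setReg_reg, if_true, chainBefore_zero]
    exact ⟨fun q hq => by omega, by omega⟩
  · rintro h' t F - hlt ⟨j1, j2⟩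
    refine run_prevDist H j1 hT hlt fun h'' t' F' e1 e2 e3 => ⟨e2, by omega⟩
  · rintro h' t F - ⟨j1, j2⟩
    exact ⟨j1, by omega⟩

end

end CTSwap

namespace CTSwap

/-! ### Generating the tables of all neighbours -/

/-- Append a table whose entries, increased by one, are given by `ent` with column `ρcol`. -/
def emitTable (ent : HExpr) : HCmd :=
  ρcol ←ₑ ¢0 ;; .upto ρcol lenExpr (.put αtable §ρtables §ρcol (ent +ₑ ¢1)) ;;
  ρtables ←ₑ §ρtables +ₑ ¢1

/-- Append a table and its parameters. -/
def emitNew (z ent : HExpr) : HCmd :=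
  .put αparam ¢0 §ρtables §ρswap ;; .put αparam ¢1 §ρtables z ;; emitTable ent

/-- The entries of `tableUp`. -/
def upExpr : HExpr :=
  .cond (§ρcol =ₑ §ρswap) §ρdist
    (.cond (§ρcol =ₑ §ρswap +ₑ ¢1)
      (.cond (¢0 <ₑ distExpr §ρswap) (distExpr §ρswap +ₑ ¢1) ¢0)
      (.cond (§ρswap +ₑ ¢1 <ₑ §ρcol)
        (.cond (distExpr §ρcol +ₑ §ρswap =ₑ §ρcol) (distExpr §ρcol -ₑ ¢1) (distExpr §ρcol))
        (distExpr §ρcol)))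

/-- The entries of `tableDown`. -/
def downExpr : HExpr :=
  .cond (§ρcol =ₑ §ρswap) (distExpr (§ρswap +ₑ ¢1) -ₑ ¢1)
    (.cond (§ρcol =ₑ §ρswap +ₑ ¢1) ¢1
      (.cond (§ρswap +ₑ ¢1 <ₑ §ρcol)
        (.cond (distExpr §ρcol +ₑ (§ρswap +ₑ ¢1) =ₑ §ρcol)
          (.cond (§ρcut <ₑ §ρcol +ₑ ¢1) (distExpr §ρcol +ₑ ¢1) (distExpr §ρcol))
          (distExpr §ρcol))
        (distExpr §ρcol)))

/-- The tables of the neighbours for a swap at `ρswap` whose left entry is the smaller one. -/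
def genUp : HCmd :=
  chainStart ρswap ;; ρgo ←ₑ ¢1 ;;
  .loop §ρgo (emitNew §ρdist upExpr ;;
    .ite (§ρdist =ₑ distExpr §ρswap) (ρgo ←ₑ ¢0) (chainStep ρswap))

/-- The tables of the neighbours for a swap at `ρswap` whose left entry is the larger one. -/
def genDown : HCmd :=
  ρcut ←ₑ §ρswap +ₑ ¢2 ;;
  .upto ρcut (lenExpr +ₑ ¢1)
    (.ite (.cond (§ρcut <ₑ lenExpr) (distExpr §ρcut +ₑ (§ρswap +ₑ ¢1) =ₑ §ρcut) ¢1)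
      (emitNew §ρcut downExpr) .skip)

/-- All tables. -/
def buildTables : HCmd :=
  ρtables ←ₑ ¢0 ;; emitTable (distExpr §ρcol) ;; ρswap ←ₑ ¢0 ;;
  .upto ρswap (lenExpr -ₑ ¢1) (.ite (distExpr (§ρswap +ₑ ¢1) =ₑ ¢1) genUp genDown)

section
variable {m : ℕ} {f : ℕ → ℤ} {T : ℕ → ℕ} {i e z : ℕ}

/-- A point of the chain from `i - 1` to the parent of `i`. -/
structure ChainPoint (m : ℕ) (f : ℕ → ℤ) (i e : ℕ) : Prop where
  chain : OnChain m f i (f i) e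
  vis : e ≠ 0 → ∀ j, i - e < j → j < i → f (i - e) < f j

theorem ChainPoint.start : ChainPoint m f i (startDist m i) := by
  refine ⟨.start, fun _ j hj hj' => ?_⟩
  unfold startDist at *
  split_ifs at * <;> omega

theorem ChainPoint.high (h : ChainPoint m f i e) (hT : IsTable m f T) (hi : i < m)
    (hne : e ≠ T i) : 0 < e ∧ f i ≤ f (i - e) := by
  by_contra h1
  refine hne ?_
  refine (h.chain.prevBelow fun h2 => ?_).unique (hT i hi)
  by_contra h3
  exact h1 ⟨h2, not_lt.1 h3⟩

theorem ChainPoint.next (h : ChainPoint m f i e) (hT : IsTable m f T) (hi : i < m)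
    (hne : e ≠ T i) : ChainPoint m f i (nextDist m T i e) := by
  obtain ⟨h1, h2⟩ := h.high hT hi hne
  have hei := h.chain.le
  refine ⟨h.chain.next (fun q hq => hT q (by omega)) h1 h2, fun h3 j hj hj' => ?_⟩
  have h4 := h.vis (by omega)
  unfold nextDist at *
  rcases hT (i - e) (by omega) with ⟨h5, h6⟩ | ⟨h5, h6, h7, h8, h9⟩
  · rw [if_neg (by omega)] at h3; omega
  · rw [if_pos h5, if_pos (by omega)] at *
    have e1 : i - (e + T (i - e)) = i - e - T (i - e) := by omega
    rw [e1] at *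
    rcases lt_trichotomy j (i - e) with h10 | h10 | h10
    · exact h8.trans_le (h9 j (by omega) h10)
    · rwa [h10]
    · exact h8.trans (h4 j h10 hj')

/-- Every point visited gives a neighbour. Together with `ValidUp.not_between`, the walk from `i -
1` to the parent of `i` enumerates exactly the admissible parameters. -/
theorem ChainPoint.valid (h : ChainPoint m f i e) (hT : IsTable m f T) (hi : i + 1 < m)
    (h1 : T (i + 1) = 1) : ValidUp m f T i e := by
  have hei := h.chain.le
  refine ⟨hi, h1, hei, fun h2 => ?_, fun h2 => ?_, fun j h0 hj hj' =>
    h.vis (by omega) j (by omega) hj'⟩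
  · rcases h.chain with ⟨-, h3⟩ | ⟨h3, -⟩
    · rcases hT i (by omega) with ⟨h4, -⟩ | ⟨h4, h5, h6, h7, -⟩
      · exact h4
      · have := h3 (i - T i) (by omega) (by omega); omega
    · omega
  · rcases hT i (by omega) with ⟨h4, -⟩ | ⟨h4, h5, h6, h7, -⟩
    · omega
    · rcases h.chain with ⟨h3, -⟩ | ⟨h8, h9, h10, h11⟩
      · omega
      · by_contra h12
        have := h11 (i - T i) (by omega) (by omega)
        omega

/-- No valid parameter is skipped by a step on the chain. -/
theorem ValidUp.not_between (h : ValidUp m f T i z) (hT : IsTable m f T) (he : 0 < e)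
    (hez : e < z) : nextDist m T i e ≠ 0 ∧ nextDist m T i e ≤ z := by
  obtain ⟨hi, -, hzi, -, -, hv⟩ := h
  have h1 := hv (i - e) (by omega) (by omega) (by omega)
  unfold nextDist
  rcases hT (i - e) (by omega) with ⟨h5, h6⟩ | ⟨h5, h6, h7, h8, h9⟩
  · have := h6 (i - z) (by omega) (by omega); omega
  · rw [if_pos h5, if_pos (by omega)]
    refine ⟨by omega, ?_⟩
    by_contra h10
    have := h9 (i - z) (by omega) (by omega)
    omega

/-- The number of children of `i + 1` before `z`. -/
def childCount (T : ℕ → ℕ) (i z : ℕ) : ℕ :=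
  ((Finset.range z).filter fun k => i + 1 < k ∧ T k + (i + 1) = k).card

/-- The number of entries before `m` that have a parent at most `i`. -/
def parentCount (m : ℕ) (T : ℕ → ℕ) (i : ℕ) : ℕ :=
  ((Finset.range m).filter fun k => 0 < T k ∧ k ≤ i + T k).card

theorem childCount_succ : childCount T i (z + 1) =
    childCount T i z + if i + 1 < z ∧ T z + (i + 1) = z then 1 else 0 := by
  unfold childCount
  rw [Finset.range_add_one, Finset.filter_insert]
  split_ifs
  · rw [Finset.card_insert_of_notMem (by simp)]
  · rfl

/-- The children of `i + 1` have not been counted before. As an entry has at most one parent, the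
numbers of children add up to at most `m`. -/
theorem parentCount_succ : parentCount m T i + childCount T i m ≤ parentCount m T (i + 1) := by
  unfold parentCount childCount
  rw [← Finset.card_union_of_disjoint]
  · refine Finset.card_le_card fun k hk => ?_
    simp only [Finset.mem_union, Finset.mem_filter, Finset.mem_range] at hk ⊢
    omega
  · rw [Finset.disjoint_left]
    intro k hk hk'
    simp only [Finset.mem_filter, Finset.mem_range] at hk hk'
    omega

theorem parentCount_le : parentCount m T i ≤ m :=
  (Finset.card_filter_le _ _).trans (by simp)

theorem childCount_mono {z' : ℕ} (h : z ≤ z') : childCount T i z ≤ childCount T i z' :=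
  Finset.card_le_card (Finset.filter_subset_filter _ (Finset.range_mono h))

end

section
variable {I : Input} {S B : ℕ} {h : HState} {Q : HState → ℕ → Prop}

/-- Entries are stored increased by one, so that zero marks a cell outside of every table. In
particular column `m` stays zero and acts as a guard behind the last entry. -/
theorem run_emitTable (H : Fits I S B) {ent : HExpr} {g : ℕ → ℕ}
    (hK : h.reg ρtables < S)
    (hent : ∀ h' : HState, (∀ r, r ≠ ρcol → h'.reg r = h.reg r) →
      (∀ a, a ≠ αtable → h'.arr a = h.arr a) → h'.reg ρcol < I.pattern.length →
      ent.ok I S h' ∧ ent.val I h' = g (h'.reg ρcol) ∧ g (h'.reg ρcol) + 1 < B)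
    (hQ : ∀ h' t, (∀ r, r ≠ ρcol → r ≠ ρtables → h'.reg r = h.reg r) →
      (∀ a, a ≠ αtable → h'.arr a = h.arr a) → h'.reg ρtables = h.reg ρtables + 1 →
      (∀ r k, h'.arr αtable r k = if r = h.reg ρtables ∧ k < I.pattern.length then g k + 1
        else h.arr αtable r k) → t ≤ I.pattern.length → Q h' t) :
    Run I S B (emitTable ent) h Q := by
  have hm := H.pos
  have hS := H.side
  have hB := H.le
  simp only [emitTable, run_seq, run_assign, HExpr.ok_const, HExpr.val_const, true_and, zero_add]
  refine ⟨by omega, ?_⟩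
  refine run_upto I.pattern.length (fun k h' t => t ≤ k ∧
    ∀ r k', h'.arr αtable r k' = if r = h.reg ρtables ∧ k' < k then g k' + 1
        else h.arr αtable r k') (by omega) ?_ (by simp) (by simp [HCmd.regs]) (fun h' F => ⟨trivial, rfl⟩) ?_ ?_
  · simp
  · rintro h' t F - hlt ⟨j1, j2⟩
    have hr : ∀ r, r ≠ ρcol → h'.reg r = h.reg r := fun r hr => by
      rw [F.reg r (by simp [HCmd.regs, hr]), HState.setReg_reg, if_neg hr]
    have ha : ∀ a, a ≠ αtable → h'.arr a = h.arr a := fun a ha => by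
      rw [F.arr a (by simp [HCmd.arrs, ha]), HState.setReg_arr]
    obtain ⟨h1, h2, h3⟩ := hent h' hr ha hlt
    have h4 := hr ρtables (by decide)
    simp only [run_put, HExpr.ok_reg, HExpr.val_reg, HExpr.ok_op, h1, h2, HExpr.ok_const,
      HExpr.val_op, HExpr.val_const, Op.apply_add, true_and, h3, h4, hK]
    refine ⟨by omega, by omega, fun r k' => ?_⟩
    simp only [HState.setReg_arr, HState.setArr_arr, j2, true_and]
    by_cases h5 : r = h.reg ρtables
    · by_cases h6 : k' = h'.reg ρcol
      · simp [h5, h6]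
      · have : k' < h'.reg ρcol + 1 ↔ k' < h'.reg ρcol := by omega
        simp [h5, h6, this]
    · simp [h5]
  · rintro h' t F - ⟨j1, j2⟩
    have hr : ∀ r, r ≠ ρcol → h'.reg r = h.reg r := fun r hr => by
      rw [F.reg r (by simp [HCmd.regs, hr]), HState.setReg_reg, if_neg hr]
    have ha : ∀ a, a ≠ αtable → h'.arr a = h.arr a := fun a ha => by
      rw [F.arr a (by simp [HCmd.arrs, ha]), HState.setReg_arr]
    have h4 := hr ρtables (by decide)
    simp only [HExpr.ok_op, HExpr.ok_reg, HExpr.ok_const, HExpr.val_op, HExpr.val_reg,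
      HExpr.val_const, Op.apply_add, true_and, and_true, h4]
    refine ⟨by omega, hQ _ _ (fun r h5 h6 => ?_) ha (by simp) j2 j1⟩
    rw [HState.setReg_reg, if_neg h6, hr r h5]

/-- The tables that have been built: table `0` is the table `T` of the pattern, the others are
tables of neighbours, and those with parameters in `C` are present. -/
structure HasTables (m : ℕ) (f : ℕ → ℤ) (T : ℕ → ℕ) (C : ℕ → ℕ → Prop) (h : HState) : Prop where
  one : 1 ≤ h.reg ρtables
  guard : ∀ r, h.arr αtable r m = 0
  first : ∀ k, k < m → h.arr αtable 0 k = T k + 1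
  valid : ∀ r, 1 ≤ r → r < h.reg ρtables → Valid m f T (h.arr αparam 0 r) (h.arr αparam 1 r) ∧
    ∀ k, k < m → h.arr αtable r k = newTable T (h.arr αparam 0 r) (h.arr αparam 1 r) k + 1
  complete : ∀ i z, Valid m f T i z → C i z →
    ∃ r, 1 ≤ r ∧ r < h.reg ρtables ∧ h.arr αparam 0 r = i ∧ h.arr αparam 1 r = z

theorem HasTables.mono {m : ℕ} {f : ℕ → ℤ} {T : ℕ → ℕ} {C C' : ℕ → ℕ → Prop} {h h' : HState}
    (H : HasTables m f T C h) (hK : h'.reg ρtables = h.reg ρtables)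
    (ht : h'.arr αtable = h.arr αtable) (hp : h'.arr αparam = h.arr αparam)
    (hC : ∀ i z, Valid m f T i z → C' i z → C i z) : HasTables m f T C' h' := by
  refine ⟨hK ▸ H.one, ht ▸ H.guard, ht ▸ H.first, ?_, ?_⟩
  · rw [hK, ht, hp]; exact H.valid
  · rw [hK, hp]; exact fun i z hv hc => H.complete i z hv (hC i z hv hc)

theorem run_emitNew (H : Fits I S B) {ze ent : HExpr} {f : ℕ → ℤ} {T : ℕ → ℕ}
    {C : ℕ → ℕ → Prop} {z : ℕ}
    (hK : h.reg ρtables < S) (hi : h.reg ρswap < B) (hzB : z < B)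
    (hz : ∀ h' : HState, h'.reg = h.reg → ze.ok I S h' ∧ ze.val I h' = z)
    (hent : ∀ h' : HState, (∀ r, r ≠ ρcol → h'.reg r = h.reg r) →
      h'.arr αdist = h.arr αdist → h'.reg ρcol < I.pattern.length →
      ent.ok I S h' ∧ ent.val I h' = newTable T (h.reg ρswap) z (h'.reg ρcol) ∧
        newTable T (h.reg ρswap) z (h'.reg ρcol) + 1 < B)
    (hT : HasTables I.pattern.length f T C h) (hv : Valid I.pattern.length f T (h.reg ρswap) z)
    (hQ : ∀ h' t, (∀ r, r ≠ ρcol → r ≠ ρtables → h'.reg r = h.reg r) →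
      h'.arr αdist = h.arr αdist → h'.reg ρtables = h.reg ρtables + 1 →
      HasTables I.pattern.length f T (fun i' z' => C i' z' ∨ (i' = h.reg ρswap ∧ z' = z)) h' →
      t ≤ I.pattern.length → Q h' t) :
    Run I S B (emitNew ze ent) h Q := by
  have hm := H.pos
  have hS := H.side
  have hB := H.le
  have hz1 := hz (h.setArr αparam 0 (h.reg ρtables) (h.reg ρswap)) rfl
  simp only [emitNew, run_seq, run_put, HExpr.ok_const, HExpr.val_const, HExpr.ok_reg,
    HExpr.val_reg, true_and, zero_add, HState.setArr_reg, hz1, hK, hi, hzB]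
  refine ⟨by omega, by omega, ?_⟩
  set h1 := (h.setArr αparam 0 (h.reg ρtables) (h.reg ρswap)).setArr αparam 1 (h.reg ρtables) z
    with hh1
  refine run_emitTable H (g := newTable T (h.reg ρswap) z) hK (fun h' hr ha hc => ?_) ?_
  · exact hent h' hr (by rw [ha αdist (by decide)]; funext x y; simp [hh1]) hc
  · intro h' t hr ha hK' ht htm
    have hK1 : h'.reg ρtables = h.reg ρtables + 1 := hK'
    have hp : ∀ x r, h'.arr αparam x r = if r = h.reg ρtables ∧ x = 0 then h.reg ρswap else
        if r = h.reg ρtables ∧ x = 1 then z else h.arr αparam x r := by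
      intro x r
      rw [ha αparam (by decide), hh1]
      simp only [HState.setArr_arr, true_and]
      by_cases h2 : x = 0
      · subst h2; simp
      · simp [h2, and_comm]
    have ht' : ∀ r k, h'.arr αtable r k = if r = h.reg ρtables ∧ k < I.pattern.length then
        newTable T (h.reg ρswap) z k + 1 else h.arr αtable r k := by
      intro r k
      rw [ht]
      simp [hh1]
    have h1K := hT.one
    refine hQ h' t hr (by rw [ha αdist (by decide)]; funext x y; simp [hh1]) hK1 ⟨by omega, ?_, ?_, ?_, ?_⟩ htm
    · intro r
      rw [ht', if_neg (by omega), hT.guard]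
    · intro k hk
      rw [ht', if_neg (by omega), hT.first k hk]
    · intro r hr1 hr2
      by_cases h3 : r = h.reg ρtables
      · have e0 : h'.arr αparam 0 r = h.reg ρswap := by rw [hp, if_pos ⟨h3, rfl⟩]
        have e1 : h'.arr αparam 1 r = z := by rw [hp, if_neg (by omega), if_pos ⟨h3, rfl⟩]
        rw [e0, e1]
        exact ⟨hv, fun k hk => by rw [ht', if_pos ⟨h3, hk⟩]⟩
      · have e0 : ∀ x, h'.arr αparam x r = h.arr αparam x r := fun x => by
          rw [hp, if_neg (by omega), if_neg (by omega)]
        rw [e0, e0]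
        obtain ⟨h4, h5⟩ := hT.valid r hr1 (by omega)
        exact ⟨h4, fun k hk => by rw [ht', if_neg (by omega), h5 k hk]⟩
    · rintro i' z' hv' (hc | ⟨rfl, rfl⟩)
      · obtain ⟨r, hr1, hr2, h4, h5⟩ := hT.complete i' z' hv' hc
        refine ⟨r, hr1, by omega, ?_, ?_⟩
        · rw [hp, if_neg (by omega), if_neg (by omega), h4]
        · rw [hp, if_neg (by omega), if_neg (by omega), h5]
      · refine ⟨h.reg ρtables, h1K, by omega, ?_, ?_⟩
        · rw [hp, if_pos ⟨rfl, rfl⟩]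
        · rw [hp, if_neg (by omega), if_pos ⟨rfl, rfl⟩]

/-- The array of distances holds the table of the pattern. -/
def HoldsTable (m : ℕ) (T : ℕ → ℕ) (h : HState) : Prop := ∀ k, k < m → h.arr αdist 0 k = T k

theorem HoldsDist.table {m : ℕ} {T : ℕ → ℕ} (hD : HoldsDist m T m h) : HoldsTable m T h := by
  intro k hk
  have := hD k hk (by omega)
  rwa [Nat.mod_eq_of_lt hk] at this

theorem HoldsTable.dist {m : ℕ} {T : ℕ → ℕ} (hD : HoldsTable m T h) {j : ℕ} (hj : j ≤ m) :
    HoldsDist m T j h := by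
  intro k hk _
  rw [Nat.mod_eq_of_lt (by omega)]
  exact hD k (by omega)

theorem HoldsTable.congr {m : ℕ} {T : ℕ → ℕ} {h' : HState} (hD : HoldsTable m T h)
    (ha : h'.arr αdist = h.arr αdist) : HoldsTable m T h' := by
  intro k hk
  rw [ha]
  exact hD k hk

theorem distExpr_ok (H : Fits I S B) {e : HExpr} : (distExpr e).ok I S h ↔ e.ok I S h := by
  have hm := H.pos
  have hS := H.side
  have : e.val I h % I.pattern.length < I.pattern.length := Nat.mod_lt _ hm
  have h2 : e.val I h % I.pattern.length < S := by omega
  have h3 : 0 < S := by omega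
  simp [distExpr, h2, h3]

theorem distExpr_val {T : ℕ → ℕ} (hD : HoldsTable I.pattern.length T h) {e : HExpr}
    (he : e.val I h < I.pattern.length) : (distExpr e).val I h = T (e.val I h) := by
  simp [distExpr, Nat.mod_eq_of_lt he, hD _ he]

end

end CTSwap

namespace CTSwap

/-! ### Correctness and number of the generated tables -/

section
variable {I : Input} {S B : ℕ} {h : HState} {Q : HState → ℕ → Prop} {T : ℕ → ℕ}

theorem upExpr_eval (H : Fits I S B) (hD : HoldsTable I.pattern.length T h)
    (hi : h.reg ρswap + 1 < I.pattern.length) (hc : h.reg ρcol < I.pattern.length) :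
    upExpr.ok I S h ∧ upExpr.val I h = tableUp T (h.reg ρswap) (h.reg ρdist) (h.reg ρcol) := by
  have e1 := distExpr_val (I := I) hD (e := §ρswap) (by simpa using by omega)
  have e2 := distExpr_val (I := I) hD (e := §ρcol) hc
  simp only [HExpr.val_reg] at e1 e2
  refine ⟨by simp [upExpr, distExpr_ok H], ?_⟩
  simp only [upExpr, HExpr.val_cond, HExpr.val_op, HExpr.val_reg, HExpr.val_const, Op.apply_add,
    Op.apply_sub, select_eq, select_lt, e1, e2, tableUp]
  split_ifs <;> omega

theorem downExpr_eval (H : Fits I S B) (hD : HoldsTable I.pattern.length T h)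
    (hi : h.reg ρswap + 1 < I.pattern.length) (hc : h.reg ρcol < I.pattern.length) :
    downExpr.ok I S h ∧ downExpr.val I h = tableDown T (h.reg ρswap) (h.reg ρcut) (h.reg ρcol) := by
  have e1 := distExpr_val (I := I) hD (e := §ρswap +ₑ ¢1) (by simpa using hi)
  have e2 := distExpr_val (I := I) hD (e := §ρcol) hc
  simp only [HExpr.val_reg, HExpr.val_op, HExpr.val_const, Op.apply_add] at e1 e2
  refine ⟨by simp [downExpr, distExpr_ok H], ?_⟩
  simp only [downExpr, HExpr.val_cond, HExpr.val_op, HExpr.val_reg, HExpr.val_const, Op.apply_add,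
    Op.apply_sub, select_eq, select_lt, e1, e2, tableDown]
  split_ifs <;> omega

theorem tableUp_le {m i e k : ℕ} (hT : ∀ k, k < m → T k ≤ k) (hi : i + 1 < m) (he : e ≤ i)
    (hk : k < m) : tableUp T i e k ≤ k := by
  have h1 := hT k hk
  have h2 := hT i (by omega)
  unfold tableUp
  split_ifs <;> omega

theorem tableDown_le {m i z k : ℕ} (hT : ∀ k, k < m → T k ≤ k) (hi : i + 1 < m)
    (hk : k < m) : tableDown T i z k ≤ k := by
  have h1 := hT k hk
  have h2 := hT (i + 1) hi
  unfold tableDown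
  split_ifs
  · omega
  · omega
  · omega
  · exact h1

theorem Valid.newTable_le {m i z k : ℕ} {f : ℕ → ℤ} (hv : Valid m f T i z)
    (hT : ∀ k, k < m → T k ≤ k) (hk : k < m) : newTable T i z k ≤ k := by
  rcases hv with hv | hv
  · rw [newTable_up hv.2.1]
    exact tableUp_le hT hv.1 hv.2.2.1 hk
  · rw [newTable_down hv.2.1]
    exact tableDown_le hT hv.1 hk

/-- One table is emitted for each chain point from `i - 1` to the parent of `i`, both included. All
of these but the last leave the chain, so their number is paid for by the decrease of `chainBefore`,
up to a constant. -/
theorem run_genUp (H : Fits I S B) (hT : IsTable I.pattern.length (entry I.pattern) T)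
    (hD : HoldsTable I.pattern.length T h) (hi : h.reg ρswap + 1 < I.pattern.length)
    (h1 : T (h.reg ρswap + 1) = 1)
    (hR : h.reg ρtables + chainBefore T (h.reg ρswap) ≤ 5 * I.pattern.length)
    (hC : HasTables I.pattern.length (entry I.pattern) T (fun i _ => i < h.reg ρswap) h)
    (hQ : ∀ h' t, Frame genUp h h' →
      HasTables I.pattern.length (entry I.pattern) T (fun i _ => i < h.reg ρswap + 1) h' →
      h'.reg ρtables + chainBefore T (h.reg ρswap + 1) ≤
        h.reg ρtables + chainBefore T (h.reg ρswap) + 2 →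
      t + h.reg ρtables * (I.pattern.length + 1) ≤ h'.reg ρtables * (I.pattern.length + 1) →
      Q h' t) :
    Run I S B genUp h Q := by
  have hm := H.pos
  have hS := H.side
  have hB := H.le
  have hTk : ∀ k, k < I.pattern.length → T k ≤ k := fun k hk => (hT k hk).le
  refine Run.mono (Q' := fun h' t =>
      HasTables I.pattern.length (entry I.pattern) T (fun i _ => i < h.reg ρswap + 1) h' ∧
      h'.reg ρtables + chainBefore T (h.reg ρswap + 1) ≤
        h.reg ρtables + chainBefore T (h.reg ρswap) + 2 ∧
      t + h.reg ρtables * (I.pattern.length + 1) ≤ h'.reg ρtables * (I.pattern.length + 1)) ?_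
      fun h' t F q => hQ h' t F q.1 q.2.1 q.2.2
  set m := I.pattern.length with hmdef
  set f := entry I.pattern with hf
  set i := h.reg ρswap with hidef
  rw [genUp, run_seq]
  refine run_chainStart H ?_
  rw [run_seq, run_assign]
  refine ⟨trivial, by simp; omega, ?_⟩
  simp only [HExpr.val_const, zero_add]
  set h0 := (h.setReg ρdist (startDist I.pattern.length (h.reg ρswap))).setReg ρgo 1 with hh0
  have hc0 := chainRest_start_le (T := T) (m := m) (i := i)
  have hcons : ∀ {h'}, Frame (emitNew §ρdist upExpr ;;
      .ite (§ρdist =ₑ distExpr §ρswap) (ρgo ←ₑ ¢0) (chainStep ρswap)) h0 h' →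
      h'.reg ρswap = i ∧ HoldsTable m T h' := by
    intro h' F
    refine ⟨by rw [F.reg ρswap (by decide)]; simp [hh0, hidef], hD.congr ?_⟩
    rw [F.arr αdist (by decide)]; simp [hh0]
  -- While the walk goes on, exactly the parameters nearer than the current point must be present.
  -- Distance `0` stands for the far end of the chain, so it comes after all positive parameters.
  refine run_loop (fun h' t => ChainPoint m f i (h'.reg ρdist) ∧
      t + h.reg ρtables * (m + 1) ≤ h'.reg ρtables * (m + 1) ∧
      ((h'.reg ρgo ≠ 0 ∧ h'.reg ρtables + chainRest T i (h'.reg ρdist) ≤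
          h.reg ρtables + chainBefore T i ∧ HasTables m f T (fun i' z => i' < i ∨
          (i' = i ∧ z ≠ 0 ∧ (h'.reg ρdist = 0 ∨ z < h'.reg ρdist))) h') ∨
        (h'.reg ρgo = 0 ∧ h'.reg ρtables + chainLength T i ≤ h.reg ρtables + chainBefore T i + 2 ∧
          HasTables m f T (fun i' z => i' < i + 1) h')))
    (fun h' => chainRest T i (h'.reg ρdist) + if h'.reg ρgo = 0 then 0 else 1) ?_ ?_ ?_ ?_
  · have e1 : h0.reg ρdist = startDist m i := by simp [hh0, hmdef, hidef]
    have e2 : h0.reg ρgo = 1 := by simp [hh0]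
    have e3 : h0.reg ρtables = h.reg ρtables := by simp [hh0]
    rw [e1, e2, e3]
    refine ⟨.start, by omega, .inl ⟨by omega, by unfold chainBefore; omega, ?_⟩⟩
    refine hC.mono e3 (by simp [hh0]) (by simp [hh0]) fun i' z hv hc => ?_
    rcases hc with hc | ⟨rfl, hz, hc⟩
    · exact hc
    · exfalso
      have hzi : z ≤ i := by
        rcases hv with hv | hv
        · exact hv.2.2.1
        · exact absurd h1 hv.2.1
      have e4 : startDist m i = 1 := by rw [startDist, if_pos (by omega), if_pos (by omega)]
      omega
  · intro h' t F _; trivial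
  · rintro h' t F ⟨j1, j2, j3⟩ hgo
    obtain ⟨e1, hD'⟩ := hcons F
    have hgo' : h'.reg ρgo ≠ 0 := hgo
    obtain ⟨-, j4, j5⟩ : h'.reg ρgo ≠ 0 ∧ _ ∧ _ := by
      rcases j3 with j3 | ⟨j3, -⟩
      · exact j3
      · exact absurd j3 hgo'
    have hdi := j1.chain.le
    have hv : Valid m f T i (h'.reg ρdist) := .inl (j1.valid hT hi h1)
    rw [run_seq]
    refine run_emitNew H (z := h'.reg ρdist) (f := f) (T := T) (by omega) (by omega) (by omega)
      (fun h'' hr => ⟨trivial, by simp [hr]⟩) ?_ j5 (by rwa [e1]) ?_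
    · intro h'' hr ha hc
      have e2 : h''.reg ρswap = i := by rw [hr _ (by decide), e1]
      have e3 : h''.reg ρdist = h'.reg ρdist := hr _ (by decide)
      obtain ⟨h2, h3⟩ := upExpr_eval H (hD'.congr ha) (by rw [e2]; exact hi) hc
      have := tableUp_le hTk hi hdi hc
      rw [e2, e3] at h3
      rw [e1, newTable_up h1]
      exact ⟨h2, h3, by omega⟩
    · intro h'' t' hr ha hK hTab ht'
      have e2 : h''.reg ρswap = i := by rw [hr _ (by decide) (by decide), e1]
      have e3 : h''.reg ρdist = h'.reg ρdist := hr _ (by decide) (by decide)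
      have hD'' : HoldsTable m T h'' := hD'.congr ha
      have e4 := distExpr_val (I := I) hD'' (e := §ρswap) (by simp only [HExpr.val_reg, e2]; omega)
      simp only [HExpr.val_reg, e2] at e4
      have e5 : h''.reg ρgo = h'.reg ρgo := hr _ (by decide) (by decide)
      have hmul : (h'.reg ρtables + 1) * (m + 1) = h'.reg ρtables * (m + 1) + (m + 1) := by ring
      rw [e1] at hTab
      rw [run_ite]
      refine ⟨by simp [distExpr_ok H], fun hne => ?_, fun heq => ?_⟩
      · have hd : h'.reg ρdist = T i := by
          rw [HExpr.val_op, HExpr.val_reg, e4, e3, Ne, Op.apply_eq_eq_zero, not_not] at hne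
          exact hne
        rw [run_assign]
        refine ⟨trivial, by simp; omega, ⟨?_, ?_, .inr ⟨by simp, ?_, ?_⟩⟩, ?_⟩
        · simp only [HState.setReg_reg]; norm_num; rwa [e3]
        · simp only [HState.setReg_reg]; norm_num; rw [hK, hmul]; omega
        · simp only [HState.setReg_reg]; norm_num
          have := chainLength_eq (hTk i (by omega))
          rw [← hd] at this
          omega
        · refine hTab.mono (by simp) (by simp) (by simp) fun i' z hv' hc => ?_
          by_cases h2 : i' < i
          · exact .inl (.inl h2)
          · obtain rfl : i' = i := by omega
            have hvu : ValidUp m f T i z := by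
              rcases hv' with hv' | hv'
              · exact hv'
              · exact absurd h1 hv'.2.1
            obtain ⟨-, -, -, h3, h4, -⟩ := hvu
            by_cases h5 : z = h'.reg ρdist
            · exact .inr ⟨rfl, h5⟩
            · refine .inl (.inr ⟨rfl, ?_, ?_⟩) <;> omega
        · simp only [HState.setReg_reg]; norm_num [e3, hgo']
      · have hd : h'.reg ρdist ≠ T i := by
          rw [HExpr.val_op, HExpr.val_reg, e4, e3, Op.apply_eq_eq_zero] at heq
          exact heq
        obtain ⟨h2, h3⟩ := j1.high hT (by omega) hd
        have hdm : h'.reg ρdist < m := by omega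
        refine run_chainStep H (T := T) (by rw [e2]; exact hD''.dist (by omega)) (by omega)
          (by omega) (by omega) (by rw [e2, e3]; have := hTk (i - h'.reg ρdist) (by omega); omega) ?_
        intro h3' F' hn
        rw [e2, e3] at hn
        rw [← hmdef] at hn
        have e6 : h3'.reg ρtables = h'.reg ρtables + 1 := by rw [F'.reg _ (by decide), hK]
        have e7 : h3'.reg ρgo = h'.reg ρgo := by rw [F'.reg _ (by decide), e5]
        have hlt := chainRest_next (T := T) (m := m) (i := i) h2 (hTk _ (by omega))
        rw [hn, e6, e7, hmul]
        refine ⟨⟨j1.next hT (by omega) hd, by omega, .inl ⟨hgo', by omega, ?_⟩⟩, by omega⟩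
        refine hTab.mono (by rw [e6, hK]) (F'.arr _ (by decide)) (F'.arr _ (by decide)) fun i' z hv' hc => ?_
        rcases hc with hc | ⟨rfl, hz, hc⟩
        · exact .inl (.inl hc)
        · have hvu : ValidUp m f T i z := by
            rcases hv' with hv' | hv'
            · exact hv'
            · exact absurd h1 hv'.2.1
          rcases lt_trichotomy z (h'.reg ρdist) with h4 | h4 | h4
          · exact .inl (.inr ⟨rfl, hz, .inr h4⟩)
          · exact .inr ⟨rfl, h4⟩
          · have := hvu.not_between hT h2 h4
            omega
  · rintro h' t F ⟨j1, j2, j3⟩ hgo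
    have hgo' : h'.reg ρgo = 0 := hgo
    rcases j3 with ⟨j3, -⟩ | ⟨-, j4, j5⟩
    · exact absurd hgo' j3
    · rw [chainBefore_succ]
      exact ⟨j5, j4, j2⟩

/-- The cuts are the children of `i + 1` to its right, and `m` for the case that no child moves;
hence one table more than there are children. -/
theorem run_genDown (H : Fits I S B) (hT : IsTable I.pattern.length (entry I.pattern) T)
    (hD : HoldsTable I.pattern.length T h) (hi : h.reg ρswap + 1 < I.pattern.length)
    (h1 : T (h.reg ρswap + 1) ≠ 1)
    (hR : h.reg ρtables + childCount T (h.reg ρswap) I.pattern.length + 1 ≤ 5 * I.pattern.length)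
    (hC : HasTables I.pattern.length (entry I.pattern) T (fun i _ => i < h.reg ρswap) h)
    (hQ : ∀ h' t, Frame genDown h h' →
      HasTables I.pattern.length (entry I.pattern) T (fun i _ => i < h.reg ρswap + 1) h' →
      h'.reg ρtables ≤ h.reg ρtables + childCount T (h.reg ρswap) I.pattern.length + 1 →
      t + h.reg ρtables * (I.pattern.length + 1) ≤
        h'.reg ρtables * (I.pattern.length + 1) + I.pattern.length →
      Q h' t) :
    Run I S B genDown h Q := by
  have hm := H.pos
  have hS := H.side
  have hB := H.le
  have hTk : ∀ k, k < I.pattern.length → T k ≤ k := fun k hk => (hT k hk).le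
  refine Run.mono (Q' := fun h' t =>
      HasTables I.pattern.length (entry I.pattern) T (fun i _ => i < h.reg ρswap + 1) h' ∧
      h'.reg ρtables ≤ h.reg ρtables + childCount T (h.reg ρswap) I.pattern.length + 1 ∧
      t + h.reg ρtables * (I.pattern.length + 1) ≤
        h'.reg ρtables * (I.pattern.length + 1) + I.pattern.length) ?_
      fun h' t F q => hQ h' t F q.1 q.2.1 q.2.2
  set m := I.pattern.length with hmdef
  set f := entry I.pattern with hf
  set i := h.reg ρswap with hidef
  rw [genDown, run_seq, run_assign]
  refine ⟨by simp, by simp; omega, ?_⟩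
  simp only [HExpr.val_op, HExpr.val_reg, HExpr.val_const, Op.apply_add, zero_add]
  have hzi : ∀ z, Valid m f T i z → ValidDown m T i z := by
    rintro z (hv | hv)
    · exact absurd hv.2.1 h1
    · exact hv
  -- The counter runs up to `m` inclusive; the last summand of the count is the table with cut `m`.
  -- Each table pays for its columns, and the counter for the positions that are skipped.
  refine run_upto (m + 1) (fun z h' t =>
      HasTables m f T (fun i' z' => i' < i ∨ (i' = i ∧ z' < z)) h' ∧
      h'.reg ρtables ≤ h.reg ρtables + childCount T i (min z m) + (if m < z then 1 else 0) ∧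
      t + h.reg ρtables * (m + 1) + i + 2 ≤ h'.reg ρtables * (m + 1) + z)
    (by omega) ?_ ?_ (by decide) (fun h' F => ⟨by simp, by simp [hmdef]⟩) ?_ ?_
  · simp only [HState.setReg_reg, if_true, ← hidef]
    refine ⟨hC.mono (by simp) (by simp) (by simp) fun i' z hv hc => ?_, ?_, ?_⟩
    · rcases hc with hc | ⟨rfl, hc⟩
      · exact hc
      · have := (hzi _ hv).2.2.1; omega
    · norm_num; omega
    · norm_num; omega
  · simp only [HState.setReg_reg, if_true]; omega
  · rintro h' t F hge hlt ⟨j1, j2, j3⟩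
    have hge' : i + 2 ≤ h'.reg ρcut := by
      simpa only [HState.setReg_reg, if_true, ← hidef] using hge
    have e1 : h'.reg ρswap = i := by rw [F.reg ρswap (by decide)]; simp [hidef]
    have hD' : HoldsTable m T h' := hD.congr (by rw [F.arr αdist (by decide)]; simp)
    have hcm := childCount_mono (T := T) (i := i) (show min (h'.reg ρcut) m ≤ m by omega)
    have hmin : min (h'.reg ρcut) m = h'.reg ρcut := by omega
    rw [if_neg (by omega), hmin] at j2
    rw [hmin] at hcm
    have hKS : h'.reg ρtables < S := by omega
    rw [run_ite]
    have hcond : (HExpr.cond (§ρcut <ₑ lenExpr) (distExpr §ρcut +ₑ (§ρswap +ₑ ¢1) =ₑ §ρcut) ¢1).val I h' = 0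
        ↔ ¬ (h'.reg ρcut < m → T (h'.reg ρcut) + (i + 1) = h'.reg ρcut) := by
      simp only [HExpr.val_cond, HExpr.val_op, HExpr.val_len, HExpr.val_reg, select_lt,
        HExpr.val_const, Op.apply_add, e1, Input.get_pattern, ← hmdef]
      split_ifs with h2
      · have e2 := distExpr_val (I := I) hD' (e := §ρcut) h2
        rw [e2, Op.apply_eq_eq_zero]
        simp only [HExpr.val_reg]
        tauto
      · simp [h2]
    refine ⟨by simp [distExpr_ok H], fun hne => ?_, fun heq => ?_⟩
    · rw [Ne, hcond, not_not] at hne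
      have hv : Valid m f T i (h'.reg ρcut) := .inr ⟨hi, h1, by omega, by omega, hne⟩
      refine run_emitNew H (z := h'.reg ρcut) (f := f) (T := T) hKS (by omega) (by omega)
        (fun h'' hr => ⟨trivial, by simp [hr]⟩) ?_ j1 (by rwa [e1]) ?_
      · intro h'' hr ha hc
        have e2 : h''.reg ρswap = i := by rw [hr _ (by decide), e1]
        have e3 : h''.reg ρcut = h'.reg ρcut := hr _ (by decide)
        obtain ⟨h2, h3⟩ := downExpr_eval H (hD'.congr ha) (by rw [e2]; exact hi) hc
        have := tableDown_le (z := h'.reg ρcut) hTk hi hc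
        rw [e2, e3] at h3
        rw [e1, newTable_down h1]
        exact ⟨h2, h3, by omega⟩
      · intro h'' t' hr ha hK hTab ht'
        rw [e1] at hTab
        have hmul : (h'.reg ρtables + 1) * (m + 1) = h'.reg ρtables * (m + 1) + (m + 1) := by ring
        refine ⟨hTab.mono (by simp) (by simp) (by simp) fun i' z hv' hc => ?_, ?_, ?_⟩
        · rcases hc with hc | ⟨rfl, hc⟩
          · exact .inl (.inl hc)
          · rcases Nat.lt_succ_iff_lt_or_eq.1 hc with h2 | h2
            · exact .inl (.inr ⟨rfl, h2⟩)
            · exact .inr ⟨rfl, h2⟩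
        · simp only [HState.setReg_reg]; norm_num
          rw [hK]
          by_cases h2 : h'.reg ρcut < m
          · rw [show min (h'.reg ρcut + 1) m = h'.reg ρcut + 1 by omega, childCount_succ,
              if_pos ⟨by omega, hne h2⟩]
            omega
          · rw [show min (h'.reg ρcut + 1) m = h'.reg ρcut by omega, if_pos (by omega)]
            omega
        · simp only [HState.setReg_reg]; norm_num
          rw [hK, hmul]; omega
    · rw [hcond] at heq
      rw [run_skip]
      refine ⟨j1.mono (by simp) (by simp) (by simp) fun i' z hv' hc => ?_, ?_, ?_⟩
      · rcases hc with hc | ⟨rfl, hc⟩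
        · exact .inl hc
        · refine .inr ⟨rfl, lt_of_le_of_ne (by omega) fun h2 => heq ?_⟩
          have := (hzi _ hv').2.2.2.2
          rwa [h2] at this
      · simp only [HState.setReg_reg]; norm_num
        have := childCount_mono (T := T) (i := i) (show h'.reg ρcut ≤ min (h'.reg ρcut + 1) m by omega)
        omega
      · simp only [HState.setReg_reg]; norm_num; omega
  · rintro h' t F - ⟨j1, j2, j3⟩
    rw [if_pos (by omega), show min (m + 1) m = m by omega] at j2
    refine ⟨j1.mono rfl rfl rfl fun i' z hv hc => ?_, by omega, by omega⟩
    · by_cases h2 : i' < i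
      · exact .inl h2
      · obtain rfl : i' = i := by omega
        exact .inr ⟨rfl, by have := (hzi _ hv).2.2.2.1; omega⟩

/-- The walk reaches the parent of `i`, and the rest of the chain shrinks on the way. Thus
`chainBefore` grows by at most one per position, even where no walk is made. -/
theorem ChainPoint.table_le {m i e : ℕ} {f : ℕ → ℤ} (h : ChainPoint m f i e) (hT : IsTable m f T)
    (hi : i < m) : chainRest T i (T i) ≤ chainRest T i e := by
  induction hn : chainRest T i e using Nat.strong_induction_on generalizing e with
  | _ n ih =>
    by_cases he : e = T i
    · rw [← hn, he]
    · have h1 := (h.high hT hi he).1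
      have h2 := chainRest_next (T := T) (m := m) (i := i) h1 (hT (i - e) (by omega)).le
      have := ih _ (by omega) (h.next hT hi he) rfl
      omega

/-- The number of tables plus `chainBefore` is bounded by `1 + 3 * i` plus the number of entries
with a parent up to `i`: upward swaps are paid for by the chain, downward swaps by the children. So
there are fewer than `5 * m` tables of `m` columns. -/
theorem run_buildTables (H : Fits I S B) (hT : IsTable I.pattern.length (entry I.pattern) T)
    (hD : HoldsTable I.pattern.length T h) (hz : ∀ r k, h.arr αtable r k = 0)
    (hQ : ∀ h' t, Frame buildTables h h' →
      HasTables I.pattern.length (entry I.pattern) T (fun _ _ => True) h' →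
      h'.reg ρtables ≤ 5 * I.pattern.length →
      t ≤ 6 * I.pattern.length * (I.pattern.length + 2) → Q h' t) :
    Run I S B buildTables h Q := by
  have hm := H.pos
  have hS := H.side
  have hB := H.le
  have hTk : ∀ k, k < I.pattern.length → T k ≤ k := fun k hk => (hT k hk).le
  refine Run.mono (Q' := fun h' t =>
      HasTables I.pattern.length (entry I.pattern) T (fun _ _ => True) h' ∧
      h'.reg ρtables ≤ 5 * I.pattern.length ∧
      t ≤ 6 * I.pattern.length * (I.pattern.length + 2)) ?_
      fun h' t F q => hQ h' t F q.1 q.2.1 q.2.2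
  set m := I.pattern.length with hmdef
  rw [buildTables, run_seq, run_assign]
  refine ⟨trivial, by simp; omega, ?_⟩
  simp only [HExpr.val_const, zero_add]
  rw [run_seq]
  refine run_emitTable H (g := T) (by simp; omega) (fun h' hr ha hc => ?_) ?_
  · have hD' : HoldsTable m T h' := hD.congr (by rw [ha _ (by decide)]; rfl)
    have := hTk _ hc
    exact ⟨by simp [distExpr_ok H], distExpr_val (e := §ρcol) hD' hc, by omega⟩
  intro h1 t1 hr1 ha1 hK1 ht1 hle1
  have hD1 : HoldsTable m T h1 := hD.congr (by rw [ha1 _ (by decide)]; rfl)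
  simp only [HState.setReg_reg, if_true, zero_add, HState.setReg_arr, hz] at hK1 ht1
  rw [run_seq, run_assign]
  refine ⟨trivial, by simp; omega, ?_⟩
  simp only [HExpr.val_const]
  refine run_upto (m - 1) (fun i h' t =>
      HasTables m (entry I.pattern) T (fun i' _ => i' < i) h' ∧ HoldsTable m T h' ∧
      h'.reg ρtables + chainBefore T i ≤ 1 + 3 * i + parentCount m T i ∧
      t ≤ h'.reg ρtables * (m + 1) + i * (m + 2)) (by omega) ?_ (by simp) (by decide)
      (fun h' F => ⟨by simp, by simp [hmdef]⟩) ?_ ?_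
  · simp only [HState.setReg_reg, if_true]
    refine ⟨⟨?_, ?_, ?_, ?_, ?_⟩, hD1.congr rfl, ?_, by omega⟩
    · norm_num [hK1]
    · intro r; simp [ht1, hmdef]
    · intro k hk
      rw [hmdef] at hk
      simp [ht1, hk]
    · intro r h2 h3
      norm_num [hK1] at h3
      omega
    · intro i z _ hc; omega
    · norm_num [hK1, chainBefore_zero]
  · rintro h' t F - hlt ⟨j1, j2, j3, j4⟩
    have hpc := parentCount_le (m := m) (T := T) (i := h'.reg ρswap)
    have hpc' := parentCount_succ (m := m) (T := T) (i := h'.reg ρswap)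
    have hpc2 := parentCount_le (m := m) (T := T) (i := h'.reg ρswap + 1)
    have e1 := distExpr_val (I := I) j2 (e := §ρswap +ₑ ¢1) (by simp; omega)
    simp only [HExpr.val_reg, HExpr.val_op, HExpr.val_const, Op.apply_add] at e1
    have hv1 : HExpr.val I h' ¢1 = 1 := rfl
    have hmul : (h'.reg ρswap + 1) * (m + 2) = h'.reg ρswap * (m + 2) + (m + 2) := by ring
    rw [run_ite]
    refine ⟨by simp [distExpr_ok H], fun hne => ?_, fun heq => ?_⟩
    · rw [HExpr.val_op, e1, Ne, Op.apply_eq_eq_zero, not_not] at hne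
      refine run_genUp H hT j2 (by omega) hne (by omega) j1 fun h'' t' F' k1 k2 k3 => ?_
      rw [← hmdef] at k3
      refine ⟨k1.mono (by simp) (by simp) (by simp) fun _ _ _ h => h,
        (j2.congr (F'.arr _ (by decide))).congr rfl, ?_, ?_⟩
      · simp only [HState.setReg_reg]; norm_num; omega
      · simp only [HState.setReg_reg]; norm_num; omega
    · rw [HExpr.val_op, e1, Op.apply_eq_eq_zero] at heq
      refine run_genDown H hT j2 (by omega) heq (by rw [← hmdef]; omega) j1 fun h'' t' F' k1 k2 k3 => ?_
      rw [← hmdef] at k2 k3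
      refine ⟨k1.mono (by simp) (by simp) (by simp) fun _ _ _ h => h,
        (j2.congr (F'.arr _ (by decide))).congr rfl, ?_, ?_⟩
      · have : chainBefore T (h'.reg ρswap + 1) ≤ chainBefore T (h'.reg ρswap) + 1 := by
          have h1 := chainLength_eq (hTk (h'.reg ρswap) (by omega))
          have h2 := chainBefore_succ (T := T) (k := h'.reg ρswap)
          have h3 := ChainPoint.start.table_le hT (i := h'.reg ρswap) (by omega)
          have h4 := chainRest_start_le (T := T) (m := m) (i := h'.reg ρswap)
          rw [h2, chainBefore]
          omega
        simp only [HState.setReg_reg]; norm_num; omega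
      · simp only [HState.setReg_reg]; norm_num; omega
  · rintro h' t F - ⟨j1, j2, j3, j4⟩
    have hpc := parentCount_le (m := m) (T := T) (i := m - 1)
    have hK : h'.reg ρtables ≤ 5 * m := by omega
    refine ⟨j1.mono rfl rfl rfl fun i z hv _ => ?_, hK, ?_⟩
    · rcases hv with hv | hv
      · have := hv.1; omega
      · have := hv.1; omega
    · have h2 : h'.reg ρtables * (m + 1) ≤ 5 * m * (m + 1) := Nat.mul_le_mul_right _ hK
      have h3 : (m - 1) * (m + 2) ≤ (m - 1) * (m + 2) := le_rfl
      have h4 : (m - 1) * (m + 2) + (m + 2) = m * (m + 2) := by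
        rw [← Nat.succ_mul, Nat.succ_eq_add_one, Nat.sub_add_cancel hm]
      have h5 : 6 * m * (m + 2) = 5 * m * (m + 1) + 5 * m + m * (m + 2) := by ring
      omega

end

end CTSwap

namespace CTSwap

/-! ### The trie of the tables -/

/-- A trie whose nodes are the first tables with a given prefix: `BR d x` is the row in which the
children of the node `(d, x)` other than `(d + 1, x)` are listed. The pairs in `D` have been
inserted. -/
structure Trie (W : ℕ → ℕ → ℕ) (D : ℕ → ℕ → Prop) (BR CH : ℕ → ℕ → ℕ) : Prop where
  branch : ∀ d x, BR d x ≠ 0 → D d (BR d x) ∧ firstRep W d (BR d x) = x ∧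
    firstRep W (d + 1) (BR d x) = BR d x ∧ W (BR d x) d ≠ W x d
  used : ∀ y c, CH y c ≠ 0 → y ≠ 0 ∧ ∃ d x, BR d x = y
  child : ∀ d x c, CH (BR d x) c ≠ 0 → D d (CH (BR d x) c) ∧
    firstRep W d (CH (BR d x) c) = x ∧ W (CH (BR d x) c) d = c ∧
    firstRep W (d + 1) (CH (BR d x) c) = CH (BR d x) c
  complete : ∀ d x c r, c ≠ W x d → CH (BR d x) c = 0 → D d r → firstRep W d r = x → W r d ≠ c

section
variable {W : ℕ → ℕ → ℕ} {D D' : ℕ → ℕ → Prop} {BR CH : ℕ → ℕ → ℕ} {d r x : ℕ}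

theorem Trie.empty : Trie W (fun _ _ => False) (fun _ _ => 0) (fun _ _ => 0) :=
  ⟨by simp, by simp, by simp, by simp⟩

theorem Trie.congr (h : Trie W D BR CH) (hD : ∀ d r, D d r ↔ D' d r) : Trie W D' BR CH := by
  obtain rfl : D = D' := by funext d r; exact propext (hD d r)
  exact h

/-- A branch row `y` of `(d, x)` is first among the tables with its prefix of length `d + 1`, but
not with that of length `d`. So `d` is the depth at which `y` leaves the earlier tables, and `x` is
its representative there. Each row of the child array therefore serves at most one node. -/
theorem Trie.inj (h : Trie W D BR CH) {d' x' : ℕ} (h0 : BR d x ≠ 0) (he : BR d' x' = BR d x) :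
    d' = d ∧ x' = x := by
  obtain ⟨-, h1, h2, h3⟩ := h.branch d x h0
  obtain ⟨-, h4, h5, h6⟩ := h.branch d' x' (he ▸ h0)
  rw [he] at h4 h5 h6
  have n1 : BR d x ≠ x := fun e => h3 (by rw [e])
  have n2 : BR d x ≠ x' := fun e => h6 (by rw [e])
  rcases lt_trichotomy d' d with h7 | h7 | h7
  · exact absurd ((firstRep_self_mono h7 h5).symm.trans h1) n1
  · subst h7
    exact ⟨rfl, h4.symm.trans h1⟩
  · exact absurd ((firstRep_self_mono h7 h2).symm.trans h4) n2

/-- The label agrees with that of the representative. -/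
theorem Trie.insert_same (h : Trie W D BR CH) (hW : W (firstRep W d r) d = W r d) :
    Trie W (fun d' r' => D d' r' ∨ (d' = d ∧ r' = r)) BR CH ∧
      firstRep W (d + 1) r = firstRep W d r := by
  constructor
  · refine ⟨fun d x h0 => ?_, h.used, fun d x c h0 => ?_, ?_⟩
    · obtain ⟨h1, h2⟩ := h.branch d x h0; exact ⟨.inl h1, h2⟩
    · obtain ⟨h1, h2⟩ := h.child d x c h0; exact ⟨.inl h1, h2⟩
    · rintro d' x' c r' hc h0 (hD | ⟨rfl, rfl⟩) hr
      · exact h.complete d' x' c r' hc h0 hD hr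
      · rw [hr] at hW
        rw [← hW]
        exact hc.symm
  · have h1 : firstRep W (d + 1) (firstRep W d r) = firstRep W d r :=
      firstRep_self_succ firstRep_firstRep
    conv_rhs => rw [← h1]
    exact firstRep_succ_eq_iff.2 ⟨firstRep_firstRep.symm, hW.symm⟩

/-- The child exists. -/
theorem Trie.insert_old (h : Trie W D BR CH) (h0 : CH (BR d (firstRep W d r)) (W r d) ≠ 0) :
    Trie W (fun d' r' => D d' r' ∨ (d' = d ∧ r' = r)) BR CH ∧
      firstRep W (d + 1) r = CH (BR d (firstRep W d r)) (W r d) := by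
  obtain ⟨-, h1, h2, h3⟩ := h.child d _ _ h0
  constructor
  · refine ⟨fun d x h0 => ?_, h.used, fun d x c h0 => ?_, ?_⟩
    · obtain ⟨h1, h2⟩ := h.branch d x h0; exact ⟨.inl h1, h2⟩
    · obtain ⟨h1, h2⟩ := h.child d x c h0; exact ⟨.inl h1, h2⟩
    · rintro d' x' c r' hc h4 (hD | ⟨rfl, rfl⟩) hr
      · exact h.complete d' x' c r' hc h4 hD hr
      · rintro rfl
        rw [hr] at h0
        exact h0 h4
  · conv_rhs => rw [← h3]
    exact firstRep_succ_eq_iff.2 ⟨h1.symm, h2.symm⟩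

/-- A new child is created. -/
theorem Trie.insert_new (h : Trie W D BR CH) (hr : r ≠ 0) (hlt : ∀ r', r' < r → D d r')
    (hn : ∀ d', D d' r → d' < d) (hW : W (firstRep W d r) d ≠ W r d)
    (h0 : CH (BR d (firstRep W d r)) (W r d) = 0) {y : ℕ}
    (hy : y = if BR d (firstRep W d r) = 0 then r else BR d (firstRep W d r)) :
    Trie W (fun d' r' => D d' r' ∨ (d' = d ∧ r' = r))
      (fun d' x' => if d' = d ∧ x' = firstRep W d r then y else BR d' x')
      (fun y' c' => if y' = y ∧ c' = W r d then r else CH y' c') ∧ firstRep W (d + 1) r = r := by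
  set x := firstRep W d r with hx
  -- An earlier table with the same prefix and label would have been inserted already, and its child
  -- would be found.
  have hself : firstRep W (d + 1) r = r := by
    by_contra h1
    have h2 : firstRep W (d + 1) r < r := lt_of_le_of_ne firstRep_le h1
    refine h.complete d x _ _ hW.symm h0 (hlt _ h2) ?_ (firstRep_spec d (by omega))
    rw [hx, firstRep_eq_iff]
    exact fun k hk => firstRep_spec k (by omega)
  -- If `r` were a branch row at a smaller depth, it would be its own representative at `d`, and the
  -- labels could not differ.
  have hfresh : ∀ d' x', BR d' x' ≠ r := by
    intro d' x' h1
    obtain ⟨h2, h3, h4, -⟩ := h.branch d' x' (h1 ▸ hr)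
    rw [h1] at h2 h3 h4
    have h5 := firstRep_self_mono (hn d' h2) h4
    rw [hx, h5] at hW
    exact hW rfl
  -- Row `0` never holds children, so a node without a branch row reads as a node without further
  -- children.
  have hCH0 : ∀ c, CH 0 c = 0 := fun c => by
    by_contra h1
    exact (h.used 0 c h1).1 rfl
  have hCHr : ∀ c, CH r c = 0 := fun c => by
    by_contra h1
    obtain ⟨-, d', x', h2⟩ := h.used r c h1
    exact hfresh d' x' h2
  have hCHy : ∀ c, CH y c = CH (BR d x) c := by
    intro c
    rw [hy]
    split_ifs with h1
    · rw [h1, hCH0, hCHr]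
    · rfl
  have hy0 : y ≠ 0 := by rw [hy]; split_ifs <;> assumption
  have hne : ∀ d' x', ¬ (d' = d ∧ x' = x) → BR d' x' ≠ y := by
    intro d' x' h1 h2
    rw [hy] at h2
    split_ifs at h2 with h3
    · exact hfresh _ _ h2
    · exact h1 (h.inj h3 h2)
  refine ⟨⟨?_, ?_, ?_, ?_⟩, hself⟩
  · intro d' x' h1
    split_ifs at h1 ⊢ with h2
    · obtain ⟨rfl, rfl⟩ := h2
      by_cases h3 : BR d' x = 0
      · rw [if_pos h3] at hy
        rw [hy]
        exact ⟨.inr ⟨rfl, rfl⟩, hx.symm, hself, hW.symm⟩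
      · rw [if_neg h3] at hy
        rw [hy]
        obtain ⟨h4, h5⟩ := h.branch d' x h3
        exact ⟨.inl h4, h5⟩
    · obtain ⟨h4, h5⟩ := h.branch d' x' h1
      exact ⟨.inl h4, h5⟩
  · intro y' c h1
    by_cases h2 : y' = y
    · exact ⟨h2 ▸ hy0, d, x, by rw [if_pos ⟨rfl, rfl⟩, h2]⟩
    · rw [if_neg (fun h3 => h2 h3.1)] at h1
      obtain ⟨h3, d', x', h4⟩ := h.used y' c h1
      refine ⟨h3, d', x', ?_⟩
      rw [if_neg, h4]
      rintro ⟨rfl, rfl⟩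
      rw [if_neg (by rw [h4]; exact h3)] at hy
      exact h2 (h4.symm.trans hy.symm)
  · intro d' x' c h1
    by_cases h2 : d' = d ∧ x' = x
    · rw [if_pos h2] at h1 ⊢
      obtain ⟨rfl, rfl⟩ := h2
      by_cases h3 : c = W r d'
      · rw [if_pos ⟨rfl, h3⟩]
        exact ⟨.inr ⟨rfl, rfl⟩, hx.symm, h3.symm, hself⟩
      · rw [if_neg (fun h4 => h3 h4.2), hCHy] at h1 ⊢
        obtain ⟨h4, h5⟩ := h.child d' x c h1
        exact ⟨.inl h4, h5⟩
    · rw [if_neg h2] at h1 ⊢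
      rw [if_neg (fun h4 => hne d' x' h2 h4.1)] at h1 ⊢
      obtain ⟨h4, h5⟩ := h.child d' x' c h1
      exact ⟨.inl h4, h5⟩
  · intro d' x' c r' hc h1 hD hr'
    by_cases h2 : d' = d ∧ x' = x
    · rw [if_pos h2] at h1
      obtain ⟨rfl, rfl⟩ := h2
      by_cases h3 : c = W r d'
      · rw [if_pos ⟨rfl, h3⟩] at h1
        exact absurd h1 hr
      · rw [if_neg (fun h4 => h3 h4.2), hCHy] at h1
        rcases hD with hD | ⟨-, rfl⟩
        · exact h.complete d' x c r' hc h1 hD hr'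
        · exact fun h4 => h3 h4.symm
    · rw [if_neg h2, if_neg (fun h4 => hne d' x' h2 h4.1)] at h1
      rcases hD with hD | ⟨rfl, rfl⟩
      · exact h.complete d' x' c r' hc h1 hD hr'
      · exact absurd ⟨rfl, hr'.symm⟩ h2

end

/-- Insert the next label of table `ρrow`, at depth `ρdepth`, into the trie. -/
def trieStep : HCmd :=
  ρfst ←ₑ .arr αrep §ρdepth §ρrow ;;
  ρlabel ←ₑ .arr αtable §ρrow §ρdepth -ₑ ¢1 ;;
  .ite (.arr αtable §ρfst §ρdepth =ₑ §ρlabel +ₑ ¢1)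
    (.put αrep (§ρdepth +ₑ ¢1) §ρrow §ρfst)
    (ρhit ←ₑ .arr αchild (.arr αbranch §ρdepth §ρfst) §ρlabel ;;
      .ite §ρhit (.put αrep (§ρdepth +ₑ ¢1) §ρrow §ρhit)
        (ρlast ←ₑ .cond (.arr αbranch §ρdepth §ρfst) (.arr αbranch §ρdepth §ρfst) §ρrow ;;
          .put αbranch §ρdepth §ρfst §ρlast ;;
          .put αchild §ρlast §ρlabel §ρrow ;;
          .put αrep (§ρdepth +ₑ ¢1) §ρrow §ρrow))

/-- Build the trie. -/
def buildTrie : HCmd :=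
  ρdepth ←ₑ ¢0 ;; .upto ρdepth lenExpr (ρrow ←ₑ ¢0 ;; .upto ρrow §ρtables trieStep)

/-- The tables are held in memory. -/
structure HoldsLists (m K : ℕ) (W : ℕ → ℕ → ℕ) (h : HState) : Prop where
  num : h.reg ρtables = K
  guard : ∀ r, h.arr αtable r m = 0
  row : ∀ r k, r < K → k < m → h.arr αtable r k = W r k + 1

theorem HoldsLists.congr {m K : ℕ} {W : ℕ → ℕ → ℕ} {h h' : HState} (H : HoldsLists m K W h)
    (h1 : h'.reg ρtables = h.reg ρtables) (h2 : h'.arr αtable = h.arr αtable) :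
    HoldsLists m K W h' := by
  obtain ⟨a, b, c⟩ := H
  exact ⟨h1 ▸ a, h2 ▸ b, h2 ▸ c⟩

/-- The trie up to row `r` of level `d` is held in memory. -/
structure PartTrie (K : ℕ) (W : ℕ → ℕ → ℕ) (d r : ℕ) (h : HState) : Prop where
  rep : ∀ d' r', (d' ≤ d ∨ (d' = d + 1 ∧ r' < r)) → r' < K → h.arr αrep d' r' = firstRep W d' r'
  trie : Trie W (fun d' r' => (d' < d ∨ (d' = d ∧ r' < r)) ∧ r' < K) (h.arr αbranch) (h.arr αchild)

section
variable {I : Input} {S B : ℕ} {h : HState} {Q : HState → ℕ → Prop} {W : ℕ → ℕ → ℕ} {K : ℕ}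

theorem PartTrie.congr {d r : ℕ} {h' : HState} (H : PartTrie K W d r h)
    (h1 : h'.arr αrep = h.arr αrep) (h2 : h'.arr αbranch = h.arr αbranch)
    (h3 : h'.arr αchild = h.arr αchild) : PartTrie K W d r h' := by
  obtain ⟨a, b⟩ := H
  exact ⟨h1 ▸ a, by rw [h2, h3]; exact b⟩

theorem PartTrie.level {d : ℕ} (H : PartTrie K W d K h) : PartTrie K W (d + 1) 0 h := by
  refine ⟨fun d' r' hd hr => H.rep d' r' (by omega) hr, H.trie.congr fun d' r' => ?_⟩
  omega

theorem run_assign_of {r v : ℕ} {e : HExpr} (hok : e.ok I S h) (hv : e.val I h = v) (hlt : v < B)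
    (hQ : Q (h.setReg r v) 0) : Run I S B (.assign r e) h Q := by
  subst hv
  exact run_assign.2 ⟨hok, hlt, hQ⟩

theorem run_put_of {a x' y' v : ℕ} {x y e : HExpr} (hx : x.val I h = x') (hy : y.val I h = y')
    (hv : e.val I h = v) (okx : x.ok I S h) (oky : y.ok I S h) (oke : e.ok I S h) (lx : x' < S)
    (ly : y' < S) (lv : v < B) (hQ : Q (h.setArr a x' y' v) 0) : Run I S B (.put a x y e) h Q := by
  subst hx hy hv
  exact run_put.2 ⟨okx, oky, lx, ly, oke, lv, hQ⟩

theorem run_ite_of {b : HExpr} {c d : HCmd} (hok : b.ok I S h) (h1 : b.val I h ≠ 0 → Run I S B c h Q)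
    (h2 : b.val I h = 0 → Run I S B d h Q) : Run I S B (.ite b c d) h Q := run_ite.2 ⟨hok, h1, h2⟩

/-- No search is needed: the memory starts at zero and table `0` is never an explicit child, so a
single cell tells whether a child exists. -/
theorem run_trieStep (H : Fits I S B) (hK : K ≤ S)
    (hL : HoldsLists I.pattern.length K W h) (hW : ∀ r k, r < K → k < I.pattern.length → W r k ≤ k)
    (hd : h.reg ρdepth < I.pattern.length) (hr : h.reg ρrow < K)
    (hP : PartTrie K W (h.reg ρdepth) (h.reg ρrow) h)
    (hQ : ∀ h', Frame trieStep h h' → PartTrie K W (h.reg ρdepth) (h.reg ρrow + 1) h' → Q h' 0) :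
    Run I S B trieStep h Q := by
  have hm := H.pos
  have hS := H.side
  have hB := H.le
  refine Run.mono (Q' := fun h' t => PartTrie K W (h.reg ρdepth) (h.reg ρrow + 1) h' ∧ t = 0) ?_
    fun h' t F ⟨q, e⟩ => e ▸ hQ h' F q
  obtain ⟨d, hdd⟩ : ∃ d, h.reg ρdepth = d := ⟨_, rfl⟩
  obtain ⟨r, hrr⟩ : ∃ r, h.reg ρrow = r := ⟨_, rfl⟩
  rw [hdd] at hd
  rw [hrr] at hr
  rw [hdd, hrr] at hP ⊢
  obtain ⟨hrep, htrie⟩ := hP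
  have e1 : h.arr αrep d r = firstRep W d r := hrep d r (by omega) hr
  have e2 : h.arr αtable r d = W r d + 1 := hL.row r d hr hd
  have hx : firstRep W d r ≤ r := firstRep_le
  have e3 : h.arr αtable (firstRep W d r) d = W (firstRep W d r) d + 1 := hL.row _ d (by omega) hd
  have hc := hW r d hr hd
  have hbr : h.arr αbranch d (firstRep W d r) < K := by
    by_cases h0 : h.arr αbranch d (firstRep W d r) = 0
    · omega
    · exact (htrie.branch _ _ h0).1.2
  have hch : h.arr αchild (h.arr αbranch d (firstRep W d r)) (W r d) < K := by
    by_cases h0 : h.arr αchild (h.arr αbranch d (firstRep W d r)) (W r d) = 0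
    · omega
    · exact (htrie.child _ _ _ h0).1.2
  have hdone : ∀ d' r', ((d' < d ∨ (d' = d ∧ r' < r)) ∧ r' < K) ∨ (d' = d ∧ r' = r) ↔
      (d' < d ∨ (d' = d ∧ r' < r + 1)) ∧ r' < K := by omega
  have hrep' : ∀ {A : ℕ → ℕ → ℕ} {v : ℕ}, firstRep W (d + 1) r = v →
      (∀ d' r', A d' r' = if d' = d + 1 ∧ r' = r then v else h.arr αrep d' r') →
      ∀ d' r', (d' ≤ d ∨ (d' = d + 1 ∧ r' < r + 1)) → r' < K → A d' r' = firstRep W d' r' := by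
    intro A v hv hA d' r' h1 h2
    rw [hA]
    split_ifs with h3
    · rw [h3.1, h3.2, hv]
    · exact hrep d' r' (by omega) h2
  rw [trieStep, run_seq]
  refine run_assign_of (v := firstRep W d r) (by simp [hdd, hrr] <;> omega) (by simp [hdd, hrr, e1])
    (by omega) ?_
  rw [run_seq]
  refine run_assign_of (v := W r d) (by simp [hdd, hrr] <;> omega) (by simp [hdd, hrr, e2])
    (by omega) ?_
  refine run_ite_of (by simp [hdd] <;> omega) (fun hne => ?_) (fun heq => ?_)
  · simp [hdd, e3] at hne
    obtain ⟨h1, h2⟩ := htrie.insert_same (d := d) (r := r) (by omega)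
    refine run_put_of (x' := d + 1) (y' := r) (v := firstRep W d r) (by simp [hdd]) (by simp [hrr])
      (by simp) (by simp) (by simp) (by simp) (by omega) (by omega) (by omega) ⟨⟨hrep' h2 ?_, ?_⟩, rfl⟩
    · intro d' r'; simp
    · exact h1.congr hdone
  · simp [hdd, e3] at heq
    rw [run_seq]
    refine run_assign_of (v := h.arr αchild (h.arr αbranch d (firstRep W d r)) (W r d))
      (by simp [hdd] <;> omega) (by simp [hdd]) (by omega) ?_
    refine run_ite_of (by simp) (fun hne0 => ?_) (fun heq0 => ?_)
    · simp at hne0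
      obtain ⟨h1, h2⟩ := htrie.insert_old (d := d) (r := r) hne0
      refine run_put_of (x' := d + 1) (y' := r)
        (v := h.arr αchild (h.arr αbranch d (firstRep W d r)) (W r d)) (by simp [hdd]) (by simp [hrr])
        (by simp) (by simp) (by simp) (by simp) (by omega) (by omega) (by omega)
        ⟨⟨hrep' h2 ?_, ?_⟩, rfl⟩
      · intro d' r'; simp
      · exact h1.congr hdone
    · simp at heq0
      -- Table `0` represents all its own prefixes, hence never creates a child; this is why `0` can
      -- stand for absence.
      have hr0 : r ≠ 0 := by
        intro h0
        rw [h0] at heq hx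
        rw [Nat.le_zero.1 hx] at heq
        exact heq rfl
      obtain ⟨y, hy⟩ : ∃ y, y =
          if h.arr αbranch d (firstRep W d r) = 0 then r else h.arr αbranch d (firstRep W d r) := ⟨_, rfl⟩
      obtain ⟨h1, h2⟩ := htrie.insert_new (d := d) (r := r) hr0 (fun r' h3 => ⟨by omega, by omega⟩)
        (fun d' h3 => by omega) (by omega) heq0 hy
      have hyK : y < K := by rw [hy]; split_ifs <;> omega
      rw [run_seq]
      refine run_assign_of (v := y) (by simp [hdd] <;> omega) ?_ (by omega) ?_
      · rw [hy]
        simp only [HExpr.val_cond, HExpr.val_arr, HExpr.val_reg, HState.setReg_reg, select,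
          HState.setReg_arr, Nat.reduceEqDiff, if_false, if_true, hdd, hrr]
        split_ifs <;> first | rfl | contradiction
      rw [run_seq]
      refine run_put_of (x' := d) (y' := firstRep W d r) (v := y) (by simp [hdd]) (by simp)
        (by simp) (by simp) (by simp) (by simp) (by omega) (by omega) (by omega) ?_
      rw [run_seq]
      refine run_put_of (x' := y) (y' := W r d) (v := r) (by simp) (by simp)
        (by simp [hrr]) (by simp) (by simp) (by simp) (by omega) (by omega) (by omega) ?_
      refine run_put_of (x' := d + 1) (y' := r) (v := r) (by simp [hdd]) (by simp [hrr])
        (by simp [hrr]) (by simp) (by simp) (by simp) (by omega) (by omega) (by omega)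
        ⟨⟨hrep' h2 ?_, ?_⟩, rfl⟩
      · intro d' r'; simp
      · refine Trie.congr ?_ hdone
        convert h1 using 1
        · funext d' x'; simp
        · funext y' c'; simp

theorem run_buildTrie (H : Fits I S B) (hK : K ≤ S)
    (hL : HoldsLists I.pattern.length K W h) (hW : ∀ r k, r < K → k < I.pattern.length → W r k ≤ k)
    (h1 : ∀ x y, h.arr αrep x y = 0) (h2 : ∀ x y, h.arr αbranch x y = 0)
    (h3 : ∀ x y, h.arr αchild x y = 0)
    (hQ : ∀ h' t, Frame buildTrie h h' → PartTrie K W I.pattern.length 0 h' →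
      t ≤ I.pattern.length * (K + 1) → Q h' t) :
    Run I S B buildTrie h Q := by
  have hm := H.pos
  have hS := H.side
  have hB := H.le
  refine Run.mono (Q' := fun h' t => PartTrie K W I.pattern.length 0 h' ∧
    t ≤ I.pattern.length * (K + 1)) ?_ fun h' t F q => hQ h' t F q.1 q.2
  rw [buildTrie, run_seq, run_assign]
  refine ⟨trivial, by simp; omega, ?_⟩
  simp only [HExpr.val_const]
  refine run_upto I.pattern.length (fun d h' t => PartTrie K W d 0 h' ∧ t ≤ d * (K + 1))
    (by omega) ?_ (by simp) (by decide) (fun h' F => ⟨by simp, by simp⟩) ?_ ?_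
  · simp only [HState.setReg_reg, if_true]
    refine ⟨⟨fun d' r' hd hr => ?_, ?_⟩, by omega⟩
    · obtain rfl : d' = 0 := by omega
      rw [firstRep_zero]
      simp [h1]
    · convert Trie.empty using 1
      · funext d' r'; simp
      · funext x y; simp [h2]
      · funext x y; simp [h3]
  · rintro h' t F - hlt ⟨j1, j2⟩
    have hL' : HoldsLists I.pattern.length K W h' := hL.congr
      (by rw [F.reg _ (by decide)]; rfl) (by rw [F.arr _ (by decide)]; rfl)
    have hK' := hL'.num
    rw [run_seq, run_assign]
    refine ⟨trivial, by simp; omega, ?_⟩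
    simp only [HExpr.val_const]
    refine run_upto K (fun r h'' t' => PartTrie K W (h'.reg ρdepth) r h'' ∧ t' ≤ r)
      (by omega) ?_ (by simp) (by decide) (fun h'' F' => ⟨by simp, ?_⟩) ?_ ?_
    · simp only [HState.setReg_reg, if_true]
      exact ⟨j1.congr rfl rfl rfl, by omega⟩
    · rw [HExpr.val_reg, F'.reg _ (by decide), ← hK']; rfl
    · rintro h'' t' F' - hlt' ⟨k1, k2⟩
      have e1 : h''.reg ρdepth = h'.reg ρdepth := by rw [F'.reg _ (by decide)]; rfl
      refine run_trieStep H hK (hL'.congr (by rw [F'.reg _ (by decide)]; rfl)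
        (by rw [F'.arr _ (by decide)]; rfl)) hW (by omega) hlt' (by rwa [e1]) fun h3 F3 q => ?_
      rw [e1] at q
      exact ⟨q.congr rfl rfl rfl, by omega⟩
    · rintro h'' t' F' hr ⟨k1, k2⟩
      have e1 : h''.reg ρdepth = h'.reg ρdepth := by rw [F'.reg _ (by decide)]; rfl
      refine ⟨k1.level.congr rfl rfl rfl, ?_⟩
      have : (h'.reg ρdepth + 1) * (K + 1) = h'.reg ρdepth * (K + 1) + (K + 1) := by ring
      omega
  · rintro h' t F - ⟨j1, j2⟩
    exact ⟨j1, by omega⟩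

end

end CTSwap

namespace CTSwap

/-! ### Transitions and the failure function -/

/-- The transition with label `ρlabel` from the state at depth `ρcurDepth` in row `ρcurRow`. -/
def advance : HCmd :=
  ρgo ←ₑ ¢1 ;;
  .loop §ρgo
    (ρadj ←ₑ .cond (§ρcurDepth <ₑ §ρlabel) ¢0 §ρlabel ;;
    .ite (.arr αtable §ρcurRow §ρcurDepth =ₑ §ρadj +ₑ ¢1)
      (ρcurDepth ←ₑ §ρcurDepth +ₑ ¢1 ;; ρgo ←ₑ ¢0)
      (ρhit ←ₑ .arr αchild (.arr αbranch §ρcurDepth §ρcurRow) §ρadj ;;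
        .ite §ρhit (ρcurRow ←ₑ §ρhit ;; ρcurDepth ←ₑ §ρcurDepth +ₑ ¢1 ;; ρgo ←ₑ ¢0)
          (ρtmp ←ₑ .arr αfailDepth §ρcurDepth §ρcurRow ;;
            ρcurRow ←ₑ .arr αfailRow §ρcurDepth §ρcurRow ;; ρcurDepth ←ₑ §ρtmp)))

/-- The suffix of length `u` of `X` is the node of the trie at depth `u` in row `r`. -/
structure Node (K : ℕ) (W : ℕ → ℕ → ℕ) (X : List ℕ) (u r : ℕ) : Prop where
  lt : r < K
  self : firstRep W u r = r
  table : suffixTable X u = tableList u (W r)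

/-- The failure link at depth `d` in row `r` is correct. -/
structure HasLink (p : List ℤ) (K : ℕ) (W : ℕ → ℕ → ℕ) (h : HState) (d r : ℕ) : Prop where
  longest : IsLongest (states p) (tableList d (W r)) (d - 1) (h.arr αfailDepth d r)
  node : Node K W (tableList d (W r)) (h.arr αfailDepth d r) (h.arr αfailRow d r)

/-- Compute the failure links level by level. -/
def buildFail : HCmd :=
  ρdepth ←ₑ ¢1 ;; .upto ρdepth lenExpr (ρrow ←ₑ ¢0 ;; .upto ρrow §ρtables
    (ρcurDepth ←ₑ .arr αfailDepth §ρdepth §ρrow ;; ρcurRow ←ₑ .arr αfailRow §ρdepth §ρrow ;;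
      ρlabel ←ₑ .arr αtable §ρrow §ρdepth -ₑ ¢1 ;; advance ;;
      .put αfailDepth (§ρdepth +ₑ ¢1) §ρrow §ρcurDepth ;;
      .put αfailRow (§ρdepth +ₑ ¢1) §ρrow §ρcurRow))

section
variable {K : ℕ} {W : ℕ → ℕ → ℕ} {X : List ℕ} {u r r' c : ℕ} {p : List ℤ}

theorem Node.step (h : Node K W X u r) (hu : u ≤ X.length) (hr' : r' < K)
    (h1 : firstRep W u r' = r) (h2 : W r' u = if c ≤ u then c else 0)
    (h3 : firstRep W (u + 1) r' = r') : Node K W (X ++ [c]) (u + 1) r' := by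
  refine ⟨hr', h3, ?_⟩
  rw [suffixTable_append hu, h.table, tableList_succ, h2, ← h1, tableList_firstRep]

theorem Node.suffix {u' : ℕ} (h : Node K W (tableList u (W r)) u' r') (hX : Node K W X u r)
    (hu : u ≤ X.length) (hu' : u' ≤ u) : Node K W X u' r' := by
  refine ⟨h.lt, h.self, ?_⟩
  rw [← h.table, ← hX.table, suffixTable_suffixTable hu hu']

theorem HasLink.congr {h h' : HState} (H : HasLink p K W h u r)
    (h1 : h'.arr αfailDepth u r = h.arr αfailDepth u r)
    (h2 : h'.arr αfailRow u r = h.arr αfailRow u r) : HasLink p K W h' u r := by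
  obtain ⟨a, b⟩ := H
  exact ⟨h1 ▸ a, by rw [h1, h2]; exact b⟩

end

section
variable {I : Input} {S B : ℕ} {h : HState} {Q : HState → ℕ → Prop} {W : ℕ → ℕ → ℕ} {K : ℕ}

/-- The depth is the potential: every failed attempt lowers it by at least one, and the successful
one raises it by one. The label is adjusted to the depth anew in each round. -/
theorem run_advance (H : Fits I S B) (hl : Lists I.pattern K W) (hK : K ≤ S)
    (hL : HoldsLists I.pattern.length K W h) (hP : PartTrie K W I.pattern.length 0 h)
    {X : List ℕ} {b c : ℕ} (hb : b ≤ X.length) (hc : h.reg ρlabel = c) (hcS : c < S)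
    (hu : IsLongest (states I.pattern) X b (h.reg ρcurDepth))
    (hn : Node K W X (h.reg ρcurDepth) (h.reg ρcurRow))
    (hF : ∀ d r, 1 ≤ d → d ≤ h.reg ρcurDepth → r < K → HasLink I.pattern K W h d r)
    (hQ : ∀ h' t, Frame advance h h' →
      IsLongest (states I.pattern) (X ++ [c]) (b + 1) (h'.reg ρcurDepth) →
      Node K W (X ++ [c]) (h'.reg ρcurDepth) (h'.reg ρcurRow) →
      t + h'.reg ρcurDepth ≤ h.reg ρcurDepth + 2 → Q h' t) :
    Run I S B advance h Q := by
  have hm := H.pos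
  have hS := H.side
  have hB := H.le
  refine Run.mono (Q' := fun h' t =>
      IsLongest (states I.pattern) (X ++ [c]) (b + 1) (h'.reg ρcurDepth) ∧
      Node K W (X ++ [c]) (h'.reg ρcurDepth) (h'.reg ρcurRow) ∧
      t + h'.reg ρcurDepth ≤ h.reg ρcurDepth + 2) ?_ fun h' t F q => hQ h' t F q.1 q.2.1 q.2.2
  set m := I.pattern.length with hmdef
  have hmem : ∀ {X u r}, suffixTable X u ∈ states I.pattern → Node K W X u r → u ≤ m := by
    intro X u r h1 h2
    by_contra h3
    rw [h2.table] at h1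
    exact hl.not_mem (by rw [length_tableList]; omega) h1
  have hum := hmem hu.mem hn
  rw [advance, run_seq]
  refine run_assign_of (v := 1) (by simp) rfl (by omega) ?_
  refine run_loop (fun h' t => (h'.reg ρgo ≠ 0 ∧ Searching (states I.pattern) X c b (h'.reg ρcurDepth) ∧
      Node K W X (h'.reg ρcurDepth) (h'.reg ρcurRow) ∧
      t + h'.reg ρcurDepth ≤ h.reg ρcurDepth) ∨
      (h'.reg ρgo = 0 ∧ IsLongest (states I.pattern) (X ++ [c]) (b + 1) (h'.reg ρcurDepth) ∧
      Node K W (X ++ [c]) (h'.reg ρcurDepth) (h'.reg ρcurRow) ∧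
      t + h'.reg ρcurDepth ≤ h.reg ρcurDepth + 2))
    (fun h' => if h'.reg ρgo = 0 then 0 else h'.reg ρcurDepth + 1) ?_ ?_ ?_ ?_
  · left
    simp only [HState.setReg_reg]
    norm_num
    exact ⟨hu.searching (states_closed _), hn⟩
  · intro h' t F _; trivial
  · rintro h' t F j hgo
    replace hgo : h'.reg ρgo ≠ 0 := hgo
    obtain ⟨-, j1, j2, j3⟩ := j.resolve_right fun j => hgo j.1
    rw [if_neg hgo]
    have e1 : h'.reg ρlabel = c := by rw [F.reg _ (by decide)]; exact hc
    have f1 : h'.arr αtable = h.arr αtable := by rw [F.arr _ (by decide)]; rfl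
    have f2 : h'.arr αchild = h.arr αchild := by rw [F.arr _ (by decide)]; rfl
    have f3 : h'.arr αbranch = h.arr αbranch := by rw [F.arr _ (by decide)]; rfl
    have f4 : h'.arr αfailDepth = h.arr αfailDepth := by rw [F.arr _ (by decide)]; rfl
    have f5 : h'.arr αfailRow = h.arr αfailRow := by rw [F.arr _ (by decide)]; rfl
    clear j F
    obtain ⟨u, eu⟩ : ∃ u, h'.reg ρcurDepth = u := ⟨_, rfl⟩
    obtain ⟨r, er⟩ : ∃ r, h'.reg ρcurRow = r := ⟨_, rfl⟩
    rw [eu] at j1 j2 j3 ⊢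
    rw [er] at j2
    have hr := j2.lt
    have hum' : u ≤ m := hmem j1.mem j2
    have hub := j1.le
    have huX : u ≤ X.length := by omega
    obtain ⟨a, ha⟩ : ∃ a, a = if c ≤ u then c else 0 := ⟨_, rfl⟩
    have haS : a < S := by rw [ha]; split_ifs <;> omega
    have hau : a ≤ u := by rw [ha]; split_ifs <;> omega
    have hbr : h.arr αbranch u r < K := by
      by_cases h0 : h.arr αbranch u r = 0
      · have := hl.pos; omega
      · exact (hP.trie.branch _ _ h0).1.2
    have hch : h.arr αchild (h.arr αbranch u r) a < K := by
      by_cases h0 : h.arr αchild (h.arr αbranch u r) a = 0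
      · have := hl.pos; omega
      · exact (hP.trie.child _ _ _ h0).1.2
    rw [run_seq]
    refine run_assign_of (v := a) (by simp) ?_ (by omega) ?_
    · simp [eu, e1, ha]
      split_ifs <;> omega
    refine run_ite_of (by simp [eu, er] <;> omega) (fun hne => ?_) (fun heq => ?_)
    · simp [eu, er, f1] at hne
      -- At depth `m` the guard is read, and zero is not a label increased by one.
      have hlt : u < m := by
        rcases Nat.lt_or_ge u m with h1 | h1
        · exact h1
        · obtain rfl : u = m := by omega
          rw [hL.guard] at hne; omega
      rw [hL.row r u hr hlt] at hne
      have hn' : Node K W (X ++ [c]) (u + 1) r :=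
        j2.step huX hr j2.self (by omega) (firstRep_self_succ j2.self)
      rw [run_seq]
      refine run_assign_of (v := u + 1) (by simp) (by simp [eu]) (by omega) ?_
      refine run_assign_of (v := 0) (by simp) (by simp) (by omega) ?_
      refine ⟨.inr ⟨by simp, ?_⟩, by simp⟩
      simp only [HState.setReg_reg, Nat.reduceEqDiff, if_false, if_true, er]
      refine ⟨j1.found hb ?_, hn', by omega⟩
      rw [← suffixTable_append huX, hn'.table]
      exact hl.mem (by omega) hr
    · simp [eu, er, f1] at heq
      rw [run_seq]
      refine run_assign_of (v := h.arr αchild (h.arr αbranch u r) a) ?_ ?_ (by omega) ?_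
      · simp [eu, er, f3] <;> omega
      · simp [eu, er, f2, f3]
      refine run_ite_of (by simp) (fun hne => ?_) (fun heq0 => ?_)
      · simp at hne
        obtain ⟨⟨h1, h2⟩, h3, h4, h5⟩ := hP.trie.child _ _ _ hne
        have hlt : u < m := by omega
        have hn' := j2.step huX h2 h3 (by rw [h4, ha]) h5
        rw [run_seq]
        refine run_assign_of (v := h.arr αchild (h.arr αbranch u r) a) (by simp) (by simp) (by omega) ?_
        rw [run_seq]
        refine run_assign_of (v := u + 1) (by simp) (by simp [eu]) (by omega) ?_
        refine run_assign_of (v := 0) (by simp) (by simp) (by omega) ?_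
        refine ⟨.inr ⟨by simp, ?_⟩, by simp⟩
        simp only [HState.setReg_reg, Nat.reduceEqDiff, if_false, if_true]
        refine ⟨j1.found hb ?_, hn', by omega⟩
        rw [← suffixTable_append huX, hn'.table]
        exact hl.mem (by omega) h2
      · simp at heq0
        have hnot : suffixTable X u ++ [if c ≤ u then c else 0] ∉ states I.pattern := by
          rw [← ha, j2.table]
          rcases Nat.lt_or_ge u m with h1 | h1
          · rw [hl.child_iff h1]
            rintro ⟨r', h2, h3, h4⟩
            rw [j2.self] at h3
            refine hP.trie.complete u r a r' ?_ heq0 ⟨by omega, h2⟩ h3 h4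
            rw [hL.row r u hr h1] at heq
            omega
          · exact hl.not_mem (by simp; omega)
        -- The root never fails: at depth `0` the adjusted label is `0`, which is the first entry of
        -- every table. So the root needs no link.
        have hu1 : 1 ≤ u := by
          by_contra h1
          obtain rfl : u = 0 := by omega
          obtain rfl : a = 0 := by omega
          apply hnot
          rw [← ha, j2.table, hl.child_iff hm]
          refine ⟨r, hr, rfl, ?_⟩
          have := hl.le r 0 hr hm
          omega
        have hlink := hF u r hu1 (by omega) hr
        have hlo := hlink.longest
        have hle := hlo.le
        have hnr := hlink.node.lt
        rw [run_seq]
        refine run_assign_of (v := h.arr αfailDepth u r) (by simp [eu, er] <;> omega)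
          (by simp [eu, er, f4]) (by omega) ?_
        rw [run_seq]
        refine run_assign_of (v := h.arr αfailRow u r) (by simp [eu, er] <;> omega)
          (by simp [eu, er, f5]) (by omega) ?_
        refine run_assign_of (v := h.arr αfailDepth u r) (by simp) (by simp) (by omega) ?_
        simp only [HState.setReg_reg, Nat.reduceEqDiff, if_false, if_true]
        refine ⟨.inl ⟨hgo, ?_, hlink.node.suffix j2 huX (by omega), by omega⟩, by
          rw [if_neg hgo]; omega⟩
        refine j1.fail (states_closed _) hb hnot ?_
        rw [j2.table]
        exact hlo
  · rintro h' t F j hgo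
    replace hgo : h'.reg ρgo = 0 := hgo
    obtain ⟨-, j1, j2, j3⟩ := j.resolve_left fun j => j.1 hgo
    exact ⟨j1, j2, by omega⟩

/-- The depth of the failure state. -/
noncomputable def linkDepth (p : List ℤ) (W : ℕ → ℕ → ℕ) (d r : ℕ) : ℕ :=
  (failure p (tableList d (W r))).length

theorem HasLink.depth {p : List ℤ} {d r : ℕ} (hl : HasLink p K W h d r) :
    h.arr αfailDepth d r = linkDepth p W d r := by
  have h1 := hl.longest
  have h2 := h1.le
  have h3 : IsLongest (states p) (tableList d (W r)) ((tableList d (W r)).length - 1)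
    (h.arr αfailDepth d r) := by rwa [length_tableList]
  rw [linkDepth, h3.failure, length_suffixTable (by rw [length_tableList]; omega)]

/-- Links are computed for each table at each depth, also where several tables share a node. Along a
single table the depth of the link rises by at most one per label, so the sum of these depths over
all tables is a potential, and a level costs `O(K)` amortised although the tables advance in
parallel. -/
theorem run_buildFail (H : Fits I S B) (hl : Lists I.pattern K W) (hK : K ≤ S)
    (hL : HoldsLists I.pattern.length K W h) (hP : PartTrie K W I.pattern.length 0 h)
    (h1 : ∀ x y, h.arr αfailDepth x y = 0) (h2 : ∀ x y, h.arr αfailRow x y = 0)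
    (hQ : ∀ h' t, Frame buildFail h h' →
      (∀ d r, 1 ≤ d → d ≤ I.pattern.length → r < K → HasLink I.pattern K W h' d r) →
      t ≤ I.pattern.length * (3 * K + 1) → Q h' t) :
    Run I S B buildFail h Q := by
  have hm := H.pos
  have hS := H.side
  have hB := H.le
  refine Run.mono (Q' := fun h' t =>
      (∀ d r, 1 ≤ d → d ≤ I.pattern.length → r < K → HasLink I.pattern K W h' d r) ∧
      t ≤ I.pattern.length * (3 * K + 1)) ?_ fun h' t F q => hQ h' t F q.1 q.2
  set m := I.pattern.length with hmdef
  rw [buildFail, run_seq]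
  refine run_assign_of (v := 1) (by simp) rfl (by omega) ?_
  refine run_upto m (fun d h' t => (∀ d' r, 1 ≤ d' → d' ≤ d → r < K → HasLink I.pattern K W h' d' r) ∧
    t + ∑ r ∈ Finset.range K, linkDepth I.pattern W d r ≤ d * (3 * K + 1))
    (by omega) ?_ (by simp; omega) (by decide) (fun h' F => ⟨by simp, by simp [hmdef]⟩) ?_ ?_
  · simp only [HState.setReg_reg, if_true]
    -- At depth one the only proper suffix is empty, which is what the zeroed arrays already say.
    have hlink : ∀ r, r < K → HasLink I.pattern K W (h.setReg ρdepth 1) 1 r := by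
      intro r hr
      have e1 : (h.setReg ρdepth 1).arr αfailDepth 1 r = 0 := h1 1 r
      have e2 : (h.setReg ρdepth 1).arr αfailRow 1 r = 0 := h2 1 r
      refine ⟨?_, ?_⟩
      · rw [e1]
        refine ⟨by omega, ?_, fun l hl hlb => by omega⟩
        rw [suffixTable_zero]
        simpa [tableList] using hl.mem (Nat.zero_le _) hl.pos
      · rw [e1, e2]
        exact ⟨hl.pos, firstRep_zero, by simp [suffixTable_zero, tableList]⟩
    refine ⟨fun d' r hd hd' hr => ?_, ?_⟩
    · obtain rfl : d' = 1 := by omega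
      exact hlink r hr
    · rw [Finset.sum_eq_zero]
      · omega
      · intro r hr
        rw [← (hlink r (by simpa using hr)).depth]
        exact h1 1 r
  · rintro h' t F hge hlt ⟨j1, j2⟩
    replace hge : 1 ≤ h'.reg ρdepth := hge
    have hL' : HoldsLists m K W h' := hL.congr
      (by rw [F.reg _ (by decide)]; rfl) (by rw [F.arr _ (by decide)]; rfl)
    have hP' : PartTrie K W m 0 h' := hP.congr (by rw [F.arr _ (by decide)]; rfl)
      (by rw [F.arr _ (by decide)]; rfl) (by rw [F.arr _ (by decide)]; rfl)
    have hK' := hL'.num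
    clear F
    rw [run_seq]
    refine run_assign_of (v := 0) (by simp) rfl (by omega) ?_
    obtain ⟨d, hd⟩ : ∃ d, h'.reg ρdepth = d := ⟨_, rfl⟩
    rw [hd] at hge hlt j1 j2 ⊢
    refine run_upto K (fun r h'' t' => (∀ d' r, 1 ≤ d' → d' ≤ d → r < K →
        HasLink I.pattern K W h'' d' r) ∧ (∀ r', r' < r → HasLink I.pattern K W h'' (d + 1) r') ∧
      t' + ∑ r' ∈ Finset.range r, linkDepth I.pattern W (d + 1) r' ≤
        ∑ r' ∈ Finset.range r, linkDepth I.pattern W d r' + 3 * r)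
      (by omega) ?_ (by simp) (by decide) (fun h'' F' => ⟨by simp, ?_⟩) ?_ ?_
    · simp only [HState.setReg_reg, if_true]
      refine ⟨fun d' r h3 h4 h5 => (j1 d' r h3 h4 h5).congr rfl rfl, fun _ h3 => by omega, by simp⟩
    · rw [HExpr.val_reg, F'.reg _ (by decide), ← hK']; rfl
    · rintro h'' t' F' - hlt' ⟨k1, k2, k3⟩
      have e1 : h''.reg ρdepth = d := by rw [F'.reg _ (by decide), ← hd]; rfl
      have hL'' : HoldsLists m K W h'' := hL'.congr
        (by rw [F'.reg _ (by decide)]; rfl) (by rw [F'.arr _ (by decide)]; rfl)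
      have hP'' : PartTrie K W m 0 h'' := hP'.congr (by rw [F'.arr _ (by decide)]; rfl)
        (by rw [F'.arr _ (by decide)]; rfl) (by rw [F'.arr _ (by decide)]; rfl)
      clear F'
      obtain ⟨r, hr⟩ : ∃ r, h''.reg ρrow = r := ⟨_, rfl⟩
      rw [hr] at hlt' k2 k3 ⊢
      have hlink := k1 d r hge le_rfl hlt'
      have hlo := hlink.longest.le
      have hnr := hlink.node.lt
      have hWd := hl.le r d hlt' hlt
      have hrow := hL''.row r d hlt' hlt
      rw [run_seq]
      refine run_assign_of (v := h''.arr αfailDepth d r) (by simp [e1, hr] <;> omega)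
        (by simp [e1, hr]) (by omega) ?_
      rw [run_seq]
      refine run_assign_of (v := h''.arr αfailRow d r) (by simp [e1, hr] <;> omega)
        (by simp [e1, hr]) (by omega) ?_
      rw [run_seq]
      refine run_assign_of (v := W r d) (by simp [e1, hr] <;> omega)
        (by simp [e1, hr, hrow]) (by omega) ?_
      rw [run_seq]
      refine run_advance H hl hK (hL''.congr (by simp) (by simp))
        (hP''.congr (by simp) (by simp) (by simp)) (X := tableList d (W r)) (b := d - 1) (c := W r d)
        (by rw [length_tableList]; omega) (by simp) (by omega) (by simpa using hlink.longest)
        (by simpa using hlink.node) (fun d' r' h3 h4 h5 => ?_) ?_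
      · simp only [HState.setReg_reg, Nat.reduceEqDiff, if_false, if_true] at h4
        exact (k1 d' r' h3 (by omega) h5).congr rfl rfl
      · intro g t1 G g1 g2 g3
        rw [← tableList_succ, show d - 1 + 1 = d by omega] at g1
        rw [← tableList_succ] at g2
        simp only [HState.setReg_reg, Nat.reduceEqDiff, if_false, if_true] at g3
        have e2 : g.reg ρdepth = d := by rw [G.reg _ (by decide), ← e1]; rfl
        have e3 : g.reg ρrow = r := by rw [G.reg _ (by decide), ← hr]; rfl
        have e4 : g.arr αfailDepth = h''.arr αfailDepth := by rw [G.arr _ (by decide)]; rfl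
        have e5 : g.arr αfailRow = h''.arr αfailRow := by rw [G.arr _ (by decide)]; rfl
        have g4 := g1.le
        have g5 := g2.lt
        rw [run_seq]
        refine run_put_of (x' := d + 1) (y' := r) (v := g.reg ρcurDepth) (by simp [e2]) (by simp [e3])
          (by simp) (by simp) (by simp) (by simp) (by omega) (by omega) (by omega) ?_
        refine run_put_of (x' := d + 1) (y' := r) (v := g.reg ρcurRow) (by simp [e2]) (by simp [e3])
          (by simp) (by simp) (by simp) (by simp) (by omega) (by omega) (by omega) ?_
        have hnew : HasLink I.pattern K W
            (((g.setArr αfailDepth (d + 1) r (g.reg ρcurDepth)).setArr αfailRow (d + 1) r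
              (g.reg ρcurRow)).setReg ρrow (r + 1)) (d + 1) r := by
          refine ⟨?_, ?_⟩
          · simpa using g1
          · simpa using g2
        refine ⟨fun d' r' h3 h4 h5 => (k1 d' r' h3 h4 h5).congr ?_ ?_, fun r' h3 => ?_, ?_⟩
        · simp [e4]; omega
        · simp [e5]; omega
        · rcases Nat.lt_succ_iff_lt_or_eq.1 h3 with h4 | rfl
          · refine (k2 r' h4).congr ?_ ?_
            · simp [e4]; omega
            · simp [e5]; omega
          · exact hnew
        · have h6 := hnew.depth
          simp at h6
          rw [Finset.sum_range_succ, Finset.sum_range_succ, ← h6, ← hlink.depth]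
          omega
    · rintro h'' t' F' hr ⟨k1, k2, k3⟩
      refine ⟨fun d' r h3 h4 h5 => ?_, ?_⟩
      · by_cases h6 : d' = d + 1
        · subst h6
          exact (k2 r h5).congr rfl rfl
        · exact (k1 d' r h3 (by omega) h5).congr rfl rfl
      · have : (d + 1) * (3 * K + 1) = d * (3 * K + 1) + (3 * K + 1) := by ring
        omega
  · rintro h' t F - ⟨j1, j2⟩
    exact ⟨j1, by omega⟩

end

end CTSwap

namespace CTSwap

/-! ### Numbering the states -/

/-- Give the next number to the node at depth `ρdepth` in row `ρrow` and write its record. -/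
def numStep : HCmd :=
  .ite (.arr αrep §ρdepth §ρrow =ₑ §ρrow)
    (.put αnum §ρdepth §ρrow §ρstates ;;
      .ite §ρdepth
        (.field 0 §ρstates (.arr αnum (§ρdepth -ₑ ¢1) (.arr αrep (§ρdepth -ₑ ¢1) §ρrow)) ;;
          .field 1 §ρstates (.arr αtable §ρrow (§ρdepth -ₑ ¢1) -ₑ ¢1) ;;
          .field 2 §ρstates
            (.arr αnum (.arr αfailDepth §ρdepth §ρrow) (.arr αfailRow §ρdepth §ρrow)))
        .skip ;;
      .field 3 §ρstates (§ρdepth =ₑ lenExpr) ;;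
      ρstates ←ₑ §ρstates +ₑ ¢1)
    .skip

/-- Number the states and write their records. -/
def buildNum : HCmd :=
  ρstates ←ₑ ¢0 ;; ρdepth ←ₑ ¢0 ;;
  .upto ρdepth (lenExpr +ₑ ¢1) (ρrow ←ₑ ¢0 ;; .upto ρrow §ρtables numStep)

/-- The nodes in `D` have been numbered, and their records have been written. -/
structure Numbered (m : ℕ) (W : ℕ → ℕ → ℕ) (D : ℕ → ℕ → Prop) (h : HState) : Prop where
  lt : ∀ d r, D d r → h.arr αnum d r < h.reg ρstates
  inj : ∀ d r d' r', D d r → D d' r' → h.arr αnum d r = h.arr αnum d' r' → d = d' ∧ r = r'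
  surj : ∀ n, n < h.reg ρstates → ∃ d r, D d r ∧ h.arr αnum d r = n
  root : D 0 0 → h.arr αnum 0 0 = 0
  final : ∀ d r, D d r → h.fld 3 (h.arr αnum d r) = if d = m then 1 else 0
  parent : ∀ d r, D (d + 1) r →
    h.fld 0 (h.arr αnum (d + 1) r) = h.arr αnum d (firstRep W d r)
  label : ∀ d r, D (d + 1) r → h.fld 1 (h.arr αnum (d + 1) r) = W r d
  link : ∀ d r, D (d + 1) r → h.fld 2 (h.arr αnum (d + 1) r) =
    h.arr αnum (h.arr αfailDepth (d + 1) r) (h.arr αfailRow (d + 1) r)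

/-- The nodes up to row `r` of level `d`. -/
def NodesBefore (K : ℕ) (W : ℕ → ℕ → ℕ) (d r d' r' : ℕ) : Prop :=
  (d' < d ∨ (d' = d ∧ r' < r)) ∧ r' < K ∧ firstRep W d' r' = r'

section
variable {I : Input} {S B : ℕ} {h : HState} {Q : HState → ℕ → Prop} {W : ℕ → ℕ → ℕ} {K m : ℕ}

theorem Numbered.congr {D D' : ℕ → ℕ → Prop} {h' : HState} (H : Numbered m W D h)
    (hD : ∀ d r, D' d r ↔ D d r) (h1 : h'.reg ρstates = h.reg ρstates)
    (h2 : h'.arr = h.arr) (h3 : h'.fld = h.fld) : Numbered m W D' h' := by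
  obtain rfl : D' = D := by funext d r; exact propext (hD d r)
  obtain ⟨a1, a2, a3, a4, a5, a6, a7, a8⟩ := H
  constructor <;> simp only [h1, h2, h3] <;> assumption

/-- Number one more node. -/
theorem Numbered.insert {D : ℕ → ℕ → Prop} {h' : HState} {d r : ℕ} (H : Numbered m W D h)
    (hn : ¬ D d r) (hroot : (∃ d' r', D d' r') → ¬ (d = 0 ∧ r = 0))
    (hN : h'.reg ρstates = h.reg ρstates + 1)
    (hnum : ∀ d' r', h'.arr αnum d' r' = if d' = d ∧ r' = r then h.reg ρstates else h.arr αnum d' r')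
    (hfd : h'.arr αfailDepth = h.arr αfailDepth) (hfr : h'.arr αfailRow = h.arr αfailRow)
    (hfld : ∀ f i, i < h.reg ρstates → h'.fld f i = h.fld f i)
    (hpar : ∀ d' r', D (d' + 1) r' → D d' (firstRep W d' r'))
    (hlink : ∀ d' r', D (d' + 1) r' → D (h.arr αfailDepth (d' + 1) r') (h.arr αfailRow (d' + 1) r'))
    (f3 : h'.fld 3 (h.reg ρstates) = if d = m then 1 else 0)
    (f0 : ∀ d', d = d' + 1 → h'.fld 0 (h.reg ρstates) = h'.arr αnum d' (firstRep W d' r))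
    (f1 : ∀ d', d = d' + 1 → h'.fld 1 (h.reg ρstates) = W r d')
    (f2 : ∀ d', d = d' + 1 → h'.fld 2 (h.reg ρstates) =
      h'.arr αnum (h.arr αfailDepth (d' + 1) r) (h.arr αfailRow (d' + 1) r)) :
    Numbered m W (fun d' r' => D d' r' ∨ (d' = d ∧ r' = r)) h' := by
  have hold : ∀ d' r', D d' r' → h'.arr αnum d' r' = h.arr αnum d' r' := by
    intro d' r' h1
    rw [hnum, if_neg]
    rintro ⟨rfl, rfl⟩
    exact hn h1
  have hnew : h'.arr αnum d r = h.reg ρstates := by rw [hnum, if_pos ⟨rfl, rfl⟩]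
  constructor
  · rintro d' r' (h1 | ⟨rfl, rfl⟩)
    · have := H.lt _ _ h1
      rw [hold _ _ h1]; omega
    · omega
  · rintro d1 r1 d2 r2 (h1 | ⟨rfl, rfl⟩) (h2 | ⟨rfl, rfl⟩) h3
    · rw [hold _ _ h1, hold _ _ h2] at h3
      exact H.inj _ _ _ _ h1 h2 h3
    · have := H.lt _ _ h1
      rw [hold _ _ h1, hnew] at h3
      omega
    · have := H.lt _ _ h2
      rw [hold _ _ h2, hnew] at h3
      omega
    · exact ⟨rfl, rfl⟩
  · intro n hlt
    by_cases h1 : n = h.reg ρstates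
    · exact ⟨d, r, .inr ⟨rfl, rfl⟩, by rw [hnew, h1]⟩
    · obtain ⟨d', r', h2, h3⟩ := H.surj n (by omega)
      exact ⟨d', r', .inl h2, by rw [hold _ _ h2, h3]⟩
  · rintro (h1 | ⟨h1, h2⟩)
    · rw [hold _ _ h1]; exact H.root h1
    · rw [hnum, if_pos ⟨h1, h2⟩]
      by_contra h3
      obtain ⟨d', r', h4, -⟩ := H.surj 0 (by omega)
      exact hroot ⟨d', r', h4⟩ ⟨h1.symm, h2.symm⟩
  · rintro d' r' (h1 | ⟨rfl, rfl⟩)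
    · rw [hold _ _ h1, hfld _ _ (H.lt _ _ h1), H.final _ _ h1]
    · rw [hnew, f3]
  · rintro d' r' (h1 | ⟨h1, rfl⟩)
    · rw [hold _ _ h1, hfld _ _ (H.lt _ _ h1), H.parent _ _ h1, hold _ _ (hpar _ _ h1)]
    · rw [h1, hnew, f0 d' h1.symm]
  · rintro d' r' (h1 | ⟨h1, rfl⟩)
    · rw [hold _ _ h1, hfld _ _ (H.lt _ _ h1), H.label _ _ h1]
    · rw [h1, hnew, f1 d' h1.symm]
  · rintro d' r' (h1 | ⟨h1, rfl⟩)
    · rw [hold _ _ h1, hfld _ _ (H.lt _ _ h1), H.link _ _ h1, hfd, hfr, hold _ _ (hlink _ _ h1)]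
    · rw [h1, hnew, f2 d' h1.symm, hfd, hfr, h1]

theorem run_field_of {f x v : ℕ} {i e : HExpr} (hi : i.val I h = x) (hv : e.val I h = v)
    (oki : i.ok I S h) (oke : e.ok I S h) (hx : x < S * S) (hf : f < 4) (hQ : Q (h.setFld f x v) 0) :
    Run I S B (.field f i e) h Q := by
  subst hi hv
  exact run_field.2 ⟨oki, hx, hf, oke, hQ⟩

/-- Nodes are numbered by increasing depth. The parent and the failure state lie at smaller depths,
so their numbers are final when the record is written. -/
theorem run_numStep (H : Fits I S B) (hl : Lists I.pattern K W) (hK : K ≤ 5 * I.pattern.length)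
    (hL : HoldsLists I.pattern.length K W h) (hP : PartTrie K W I.pattern.length 0 h)
    (hF : ∀ d r, 1 ≤ d → d ≤ I.pattern.length → r < K → HasLink I.pattern K W h d r)
    {d r : ℕ} (hd : h.reg ρdepth = d) (hr : h.reg ρrow = r) (hdm : d ≤ I.pattern.length) (hrK : r < K)
    (hN : Numbered I.pattern.length W (NodesBefore K W d r) h) (hlt : h.reg ρstates ≤ d * K + r)
    (hQ : ∀ h', Frame numStep h h' → Numbered I.pattern.length W (NodesBefore K W d (r + 1)) h' →
      h'.reg ρstates ≤ d * K + r + 1 → Q h' 0) :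
    Run I S B numStep h Q := by
  have hm := H.pos
  have hS := H.side
  have hB := H.le
  have hsq := H.sq
  refine Run.mono (Q' := fun h' t => (Numbered I.pattern.length W (NodesBefore K W d (r + 1)) h' ∧
    h'.reg ρstates ≤ d * K + r + 1) ∧ t = 0) ?_ fun h' t F q => q.2 ▸ hQ h' F q.1.1 q.1.2
  have hrep : h.arr αrep d r = firstRep W d r := hP.rep d r (by omega) hrK
  -- There are at most `(m + 1) * K ≤ 10 * m ^ 2` nodes, and room for `S * S ≥ 64 * m ^ 2` records.
  have hNS : h.reg ρstates + 1 < S * S := by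
    have h1 : d * K + r < (I.pattern.length + 1) * K := by nlinarith
    have h2 : (I.pattern.length + 1) * K ≤ (2 * I.pattern.length) * (5 * I.pattern.length) :=
      Nat.mul_le_mul (by omega) hK
    have h3 : (8 * I.pattern.length) * (8 * I.pattern.length) ≤ S * S := Nat.mul_le_mul hS hS
    nlinarith
  have hfr : firstRep W d r ≤ r := firstRep_le
  refine run_ite_of (by simp [hd, hr] <;> omega) (fun hne => ?_) (fun heq => ?_)
  · simp [hd, hr, hrep] at hne
    have hdone : ∀ d' r', (NodesBefore K W d r d' r' ∨ (d' = d ∧ r' = r)) ↔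
        NodesBefore K W d (r + 1) d' r' := by
      intro d' r'
      unfold NodesBefore
      constructor
      · rintro (⟨h1, h2⟩ | ⟨rfl, rfl⟩)
        · exact ⟨by omega, h2⟩
        · exact ⟨by omega, hrK, hne⟩
      · rintro ⟨h1, h2⟩
        by_cases h3 : d' = d ∧ r' = r
        · exact .inr h3
        · exact .inl ⟨by omega, h2⟩
    have hfinish : ∀ h' : HState, h'.reg = h.reg →
        (∀ d' r', h'.arr αnum d' r' = if d' = d ∧ r' = r then h.reg ρstates else h.arr αnum d' r') →
        h'.arr αfailDepth = h.arr αfailDepth → h'.arr αfailRow = h.arr αfailRow →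
        (∀ f i, i < h.reg ρstates → h'.fld f i = h.fld f i) →
        (∀ d', d = d' + 1 → h'.fld 0 (h.reg ρstates) = h'.arr αnum d' (firstRep W d' r)) →
        (∀ d', d = d' + 1 → h'.fld 1 (h.reg ρstates) = W r d') →
        (∀ d', d = d' + 1 → h'.fld 2 (h.reg ρstates) =
          h'.arr αnum (h.arr αfailDepth (d' + 1) r) (h.arr αfailRow (d' + 1) r)) →
        Run I S B (.field 3 §ρstates (§ρdepth =ₑ lenExpr) ;; ρstates ←ₑ §ρstates +ₑ ¢1) h'
          fun h' t => (Numbered I.pattern.length W (NodesBefore K W d (r + 1)) h' ∧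
            h'.reg ρstates ≤ d * K + r + 1) ∧ t = 0 := by
      intro h' a1 a2 a3 a4 a5 a6 a7 a8
      rw [run_seq]
      refine run_field_of (x := h.reg ρstates) (v := if d = I.pattern.length then 1 else 0)
        (by simp [a1]) (by simp [a1, hd, Op.apply]) (by simp) (by simp) (by omega) (by omega) ?_
      refine run_assign_of (v := h.reg ρstates + 1) (by simp) (by simp [a1]) (by omega) ?_
      refine ⟨⟨?_, by simp; omega⟩, rfl⟩
      refine Numbered.congr ?_ (fun d' r' => (hdone d' r').symm) rfl rfl rfl
      refine hN.insert ?_ ?_ (by simp) (by simpa using a2) (by simpa using a3) (by simpa using a4)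
        ?_ ?_ ?_ (by simp) (by simpa using a6) (by simpa using a7) (by simpa using a8)
      · rintro ⟨h1, -⟩; omega
      · rintro ⟨d', r', h1, -⟩; omega
      · intro f i hi
        have : i ≠ h.reg ρstates := by omega
        simp [this, a5 f i hi]
      · rintro d' r' ⟨h1, h2, h3⟩
        have : firstRep W d' r' ≤ r' := firstRep_le
        exact ⟨by omega, by omega, firstRep_firstRep⟩
      · rintro d' r' ⟨h1, h2, h3⟩
        have hlk := hF (d' + 1) r' (by omega) (by omega) h2
        have := hlk.longest.le
        exact ⟨by omega, hlk.node.lt, hlk.node.self⟩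
    rw [run_seq]
    refine run_put_of (x' := d) (y' := r) (v := h.reg ρstates) (by simp [hd]) (by simp [hr])
      (by simp) (by simp) (by simp) (by simp) (by omega) (by omega) (by omega) ?_
    rw [run_seq]
    refine run_ite_of (by simp) (fun hne0 => ?_) (fun heq0 => ?_)
    · simp [hd] at hne0
      obtain ⟨d, rfl⟩ : ∃ d', d = d' + 1 := ⟨d - 1, by omega⟩
      have hrep' : h.arr αrep d r = firstRep W d r := hP.rep d r (by omega) hrK
      have hfr' : firstRep W d r ≤ r := firstRep_le
      have hrow := hL.row r d hrK (by omega)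
      have hlk := hF (d + 1) r (by omega) hdm hrK
      have h1 := hlk.longest.le
      have h2 := hlk.node.lt
      simp only [Nat.add_sub_cancel] at h1
      -- The link leads to a smaller depth, so its number is not the cell that has just been
      -- written.
      have n1 : ¬ (h.arr αfailDepth (d + 1) r = d + 1 ∧ h.arr αfailRow (d + 1) r = r) := by omega
      rw [run_seq]
      refine run_field_of (x := h.reg ρstates) (v := h.arr αnum d (firstRep W d r)) (by simp)
        (by simp [hd, hr, hrep']) (by simp) (by simp [hd, hr, hrep'] <;> omega) (by omega) (by omega) ?_
      rw [run_seq]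
      refine run_field_of (x := h.reg ρstates) (v := W r d) (by simp)
        (by simp [hd, hr, hrow]) (by simp) (by simp [hd, hr] <;> omega) (by omega) (by omega) ?_
      refine run_field_of (x := h.reg ρstates)
        (v := h.arr αnum (h.arr αfailDepth (d + 1) r) (h.arr αfailRow (d + 1) r)) (by simp)
        (by simp [hd, hr, n1]) (by simp) (by simp [hd, hr] <;> omega) (by omega) (by omega) ?_
      simp only [add_zero, zero_add]
      refine hfinish _ rfl (by simp) (by funext x y; simp) (by funext x y; simp) ?_ ?_ ?_ ?_
      · intro f i hi
        have : i ≠ h.reg ρstates := by omega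
        simp [this]
      · rintro d' hd'
        obtain rfl : d = d' := by omega
        simp
      · rintro d' hd'
        obtain rfl : d = d' := by omega
        simp
      · rintro d' hd'
        obtain rfl : d = d' := by omega
        simp [n1]
    · simp [hd] at heq0
      rw [run_skip]
      simp only [zero_add]
      refine hfinish _ rfl (by simp) (by funext x y; simp) (by funext x y; simp) (by simp) ?_ ?_ ?_ <;>
      · intro d' hd'; omega
  · simp [hd, hr, hrep] at heq
    rw [run_skip]
    refine ⟨⟨hN.congr (fun d' r' => ?_) rfl rfl rfl, by omega⟩, rfl⟩
    unfold NodesBefore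
    constructor
    · rintro ⟨h1, h2, h3⟩
      refine ⟨?_, h2, h3⟩
      by_contra h4
      obtain ⟨rfl, rfl⟩ : d' = d ∧ r' = r := by omega
      exact heq h3
    · rintro ⟨h1, h2, h3⟩
      exact ⟨by omega, h2, h3⟩

theorem run_buildNum (H : Fits I S B) (hl : Lists I.pattern K W) (hK : K ≤ 5 * I.pattern.length)
    (hL : HoldsLists I.pattern.length K W h) (hP : PartTrie K W I.pattern.length 0 h)
    (hF : ∀ d r, 1 ≤ d → d ≤ I.pattern.length → r < K → HasLink I.pattern K W h d r)
    (hQ : ∀ h' t, Frame buildNum h h' →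
      Numbered I.pattern.length W (NodesBefore K W (I.pattern.length + 1) 0) h' →
      h'.reg ρstates ≤ (I.pattern.length + 1) * K →
      t ≤ (I.pattern.length + 1) * (K + 1) → Q h' t) :
    Run I S B buildNum h Q := by
  have hm := H.pos
  have hS := H.side
  have hB := H.le
  refine Run.mono (Q' := fun h' t =>
      Numbered I.pattern.length W (NodesBefore K W (I.pattern.length + 1) 0) h' ∧
      h'.reg ρstates ≤ (I.pattern.length + 1) * K ∧
      t ≤ (I.pattern.length + 1) * (K + 1)) ?_ fun h' t F q => hQ h' t F q.1 q.2.1 q.2.2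
  rw [buildNum, run_seq]
  refine run_assign_of (v := 0) (by simp) rfl (by omega) ?_
  rw [run_seq]
  refine run_assign_of (v := 0) (by simp) rfl (by omega) ?_
  simp only [zero_add]
  have fr : ∀ {a b : HState}, (∀ d r, 1 ≤ d → d ≤ I.pattern.length → r < K →
      HasLink I.pattern K W a d r) → b.arr αfailDepth = a.arr αfailDepth →
      b.arr αfailRow = a.arr αfailRow → (∀ d r, 1 ≤ d → d ≤ I.pattern.length → r < K →
      HasLink I.pattern K W b d r) := fun h1 h2 h3 d r a b c => (h1 d r a b c).congr (by rw [h2]) (by rw [h3])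
  refine run_upto (I.pattern.length + 1) (fun d h' t => Numbered I.pattern.length W (NodesBefore K W d 0) h' ∧
      h'.reg ρstates ≤ d * K ∧ t ≤ d * (K + 1)) (by omega) ?_ (by simp) (by decide)
      (fun h' F => ⟨by simp, by simp⟩) ?_ ?_
  · refine ⟨⟨?_, ?_, ?_, ?_, ?_, ?_, ?_, ?_⟩, ?_, ?_⟩ <;> simp [NodesBefore]
  · rintro h' t F - hlt ⟨j1, j2, j3⟩
    have hL' : HoldsLists I.pattern.length K W h' := hL.congr
      (by rw [F.reg _ (by decide)]; rfl) (by rw [F.arr _ (by decide)]; rfl)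
    have hP' : PartTrie K W I.pattern.length 0 h' := hP.congr (by rw [F.arr _ (by decide)]; rfl)
      (by rw [F.arr _ (by decide)]; rfl) (by rw [F.arr _ (by decide)]; rfl)
    have hF' := fr hF (b := h') (by rw [F.arr _ (by decide)]; rfl) (by rw [F.arr _ (by decide)]; rfl)
    have hK' := hL'.num
    clear F
    obtain ⟨d, hd⟩ : ∃ d, h'.reg ρdepth = d := ⟨_, rfl⟩
    rw [hd] at hlt j1 j2 j3 ⊢
    have e0 : (d + 1) * (K + 1) = d * (K + 1) + (K + 1) := by ring
    have e1 : (d + 1) * K = d * K + K := by ring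
    rw [run_seq]
    refine run_assign_of (v := 0) (by simp) rfl (by omega) ?_
    refine run_upto K (fun r h'' t' => Numbered I.pattern.length W (NodesBefore K W d r) h'' ∧
      h''.reg ρstates ≤ d * K + r ∧ t' ≤ r)
      (by omega) ?_ (by simp) (by decide) (fun h'' F' => ⟨by simp, ?_⟩) ?_ ?_
    · refine ⟨j1.congr (fun _ _ => Iff.rfl) rfl rfl rfl, ?_, by omega⟩
      simpa using j2
    · rw [HExpr.val_reg, F'.reg _ (by decide), ← hK']; rfl
    · rintro h'' t' F' - hlt' ⟨k1, k2, k3⟩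
      refine run_numStep H hl hK (hL'.congr
        (by rw [F'.reg _ (by decide)]; rfl) (by rw [F'.arr _ (by decide)]; rfl))
        (hP'.congr (by rw [F'.arr _ (by decide)]; rfl)
        (by rw [F'.arr _ (by decide)]; rfl) (by rw [F'.arr _ (by decide)]; rfl))
        (fr hF' (by rw [F'.arr _ (by decide)]; rfl) (by rw [F'.arr _ (by decide)]; rfl))
        (by rw [F'.reg _ (by decide), ← hd]; rfl) rfl (by omega) hlt' k1 k2 fun g G g1 g2 => ?_
      exact ⟨g1.congr (fun _ _ => Iff.rfl) rfl rfl rfl, g2, by omega⟩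
    · rintro h'' t' F' hr ⟨k1, k2, k3⟩
      refine ⟨k1.congr (fun d' r' => ?_) rfl rfl rfl, ?_, by omega⟩
      · unfold NodesBefore
        constructor
        · rintro ⟨h1, h2, h3⟩; exact ⟨by omega, h2, h3⟩
        · rintro ⟨h1, h2, h3⟩; exact ⟨by omega, h2, h3⟩
      · simp; omega
  · rintro h' t F - ⟨j1, j2, j3⟩
    exact ⟨j1, j2, by omega⟩

/-- The row of a node of the trie. -/
noncomputable def nodeRow (W : ℕ → ℕ → ℕ) (s : List ℕ) : ℕ := sInf {r | s = tableList s.length (W r)}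

theorem nodeRow_tableList {d r : ℕ} : nodeRow W (tableList d (W r)) = firstRep W d r := by
  refine IsLeast.csInf_eq ⟨?_, fun r' hr' => ?_⟩
  · rw [Set.mem_ofPred_eq, length_tableList, tableList_firstRep]
  · rw [Set.mem_ofPred_eq, length_tableList, tableList_eq_iff] at hr'
    exact firstRep_le_of fun k hk => (hr' k hk).symm

/-- States as words correspond to nodes as pairs of a depth and a representative. A state is a
complete table exactly if its depth is `m`, since all tables have length `m`. -/
theorem Numbered.automaton {p : List ℤ} (hp : 0 < p.length) (hl : Lists p K W)
    (hF : ∀ d r, 1 ≤ d → d ≤ p.length → r < K → HasLink p K W h d r)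
    (hN : Numbered p.length W (NodesBefore K W (p.length + 1) 0) h) {σ : Store} {L : Limits}
    (h0 : σ.reg 0 = 0) (h1 : σ.reg 1 = h.reg ρstates) (hsp : 4 * h.reg ρstates ≤ L.space)
    (hmem : ∀ f i, f < 4 → i < h.reg ρstates → σ.mem (4 * i + f) = h.fld f i) :
    HoldsAutomaton p L σ := by
  have hnode : ∀ {d r}, d ≤ p.length → r < K →
      NodesBefore K W (p.length + 1) 0 d (firstRep W d r) := by
    intro d r hd hr
    have : firstRep W d r ≤ r := firstRep_le
    exact ⟨by omega, by omega, firstRep_firstRep⟩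
  have hnum : ∀ d r, h.arr αnum (tableList d (W r)).length (nodeRow W (tableList d (W r))) =
      h.arr αnum d (firstRep W d r) := by
    intro d r
    rw [length_tableList, nodeRow_tableList]
  refine ⟨by omega, fun s => h.arr αnum s.length (nodeRow W s), ⟨?_, ?_, ?_⟩, ?_, ?_, ?_⟩
  · intro s hs
    obtain ⟨d, r, hd, hr, rfl⟩ := (hl.states s).1 hs
    simp only [Set.mem_Iio, hnum, h1]
    exact hN.lt _ _ (hnode hd hr)
  · intro s hs s' hs' he
    obtain ⟨d, r, hd, hr, rfl⟩ := (hl.states s).1 hs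
    obtain ⟨d', r', hd', hr', rfl⟩ := (hl.states s').1 hs'
    simp only [hnum] at he
    obtain ⟨rfl, h2⟩ := hN.inj _ _ _ _ (hnode hd hr) (hnode hd' hr') he
    rw [← tableList_firstRep (r := r), h2, tableList_firstRep]
  · intro n hn
    rw [Set.mem_Iio, h1] at hn
    obtain ⟨d, r, ⟨h2, h3, h4⟩, h5⟩ := hN.surj n hn
    refine ⟨tableList d (W r), hl.mem (by omega) h3, ?_⟩
    simp only [hnum]
    rw [h4, h5]
  · have := hN.root ⟨by omega, hl.pos, firstRep_zero⟩
    have h2 := hnum 0 0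
    rw [firstRep_zero, this] at h2
    simpa [tableList] using h2
  · intro s c hs
    obtain ⟨d, r, hd, hr, he⟩ := (hl.states _).1 hs
    have hlen := congrArg List.length he
    rw [List.length_append, List.length_singleton, length_tableList] at hlen
    subst hlen
    rw [he]
    rw [tableList_succ] at he
    obtain ⟨e1, e2⟩ := List.append_inj' he (by simp)
    have e3 : c = W r s.length := by simpa using e2
    have hnd := hnode hd hr
    have hlt := hN.lt _ _ hnd
    have hlk := hF (s.length + 1) (firstRep W (s.length + 1) r) (by omega) hd hnd.2.1
    have hlo : IsLongest (states p) (tableList (s.length + 1) (W (firstRep W (s.length + 1) r)))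
        ((tableList (s.length + 1) (W (firstRep W (s.length + 1) r))).length - 1)
        (h.arr αfailDepth (s.length + 1) (firstRep W (s.length + 1) r)) := by
      rw [length_tableList]; exact hlk.longest
    have e4 := hlo.failure
    rw [hlk.node.table, tableList_firstRep] at e4
    have e5 : firstRep W s.length (firstRep W (s.length + 1) r) = firstRep W s.length r :=
      firstRep_eq_iff.2 fun k hk => firstRep_spec k (by omega)
    simp only [h0, zero_add, hnum, e4]
    refine ⟨?_, ?_, ?_⟩
    · have := hmem 0 _ (by omega) hlt
      rw [add_zero] at this
      rw [this, hN.parent _ _ hnd, e5]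
      conv_rhs => rw [e1]
      rw [length_tableList, nodeRow_tableList]
    · rw [hmem 1 _ (by omega) hlt, hN.label _ _ hnd, e3]
      exact firstRep_spec _ (by omega)
    · rw [hmem 2 _ (by omega) hlt, hN.link _ _ hnd, hlk.node.self]
  · intro s hs
    obtain ⟨d, r, hd, hr, rfl⟩ := (hl.states s).1 hs
    have hnd := hnode hd hr
    simp only [h0, zero_add, hnum]
    rw [hmem 3 _ (by omega) (hN.lt _ _ hnd), hN.final _ _ hnd, hl.tables]
    constructor
    · rintro ⟨r', hr', he⟩
      have := congrArg List.length he
      rw [length_tableList, length_tableList] at this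
      rw [if_pos this]
    · intro h2
      rw [if_neg]
      rintro rfl
      exact h2 ⟨r, hr, rfl⟩

end

end CTSwap

namespace CTSwap

/-! ### Data for the test of a swap in the text -/

/-- The first child of `ρswap` after `ρswap + 1`, the last child of `ρswap + 1`, and the first
child of `ρswap + 1` below the entry at `ρswap`. -/
def findChildren : HCmd :=
  ρfst ←ₑ ¢0 ;; ρlast ←ₑ ¢0 ;; ρcut ←ₑ lenExpr ;; ρcol ←ₑ §ρswap +ₑ ¢2 ;;
  .upto ρcol lenExpr
    (ρfst ←ₑ .cond (distExpr §ρcol +ₑ §ρswap =ₑ §ρcol) (.cond §ρfst §ρfst §ρcol) §ρfst ;;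
      ρlast ←ₑ .cond (distExpr §ρcol +ₑ (§ρswap +ₑ ¢1) =ₑ §ρcol) §ρcol §ρlast ;;
      ρcut ←ₑ .cond (distExpr §ρcol +ₑ (§ρswap +ₑ ¢1) =ₑ §ρcol)
        (.cond (§ρcut <ₑ lenExpr) §ρcut (.cond (.less .pattern §ρcol §ρswap) §ρcol §ρcut)) §ρcut)

/-- The last point before the parent of `ρswap` on the chain. -/
def findSibling : HCmd :=
  chainStart ρswap ;; ρprev ←ₑ ¢0 ;;
  .loop (.cond (§ρdist =ₑ distExpr §ρswap) ¢0 ¢1) (ρprev ←ₑ §ρdist ;; chainStep ρswap)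

/-- Write the data for the swap at `ρswap`. -/
def writeBack : HCmd :=
  .put αback ¢0 §ρswap (.cond (distExpr (§ρswap +ₑ ¢1) =ₑ ¢1) (.cond §ρfst §ρfst (§ρswap +ₑ ¢1))
    (§ρswap -ₑ distExpr §ρswap)) ;;
  .put αback ¢1 §ρswap (.cond (distExpr (§ρswap +ₑ ¢1) =ₑ ¢1) §ρswap (§ρswap +ₑ ¢1)) ;;
  .put αback ¢2 §ρswap (.cond (distExpr (§ρswap +ₑ ¢1) =ₑ ¢1)
    (.cond §ρlast §ρswap (§ρswap +ₑ ¢1)) (.cond §ρprev (§ρswap +ₑ ¢1) §ρswap)) ;;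
  .put αback ¢3 §ρswap (.cond (distExpr (§ρswap +ₑ ¢1) =ₑ ¢1)
    (.cond §ρlast §ρlast §ρswap) (.cond §ρprev (§ρswap -ₑ §ρprev) (§ρswap +ₑ ¢1))) ;;
  .put αback ¢4 §ρswap (.cond (distExpr (§ρswap +ₑ ¢1) =ₑ ¢1) §ρdist §ρcut)

/-- The data for all swaps. -/
def buildBack : HCmd :=
  ρswap ←ₑ ¢0 ;; .upto ρswap (lenExpr -ₑ ¢1)
    (findChildren ;; findSibling ;; findBelow .pattern ρswap (§ρswap +ₑ ¢1) ;; writeBack)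

/-- What the search for children has found among the positions before `k`. -/
structure ChildData (m : ℕ) (f : ℕ → ℤ) (D : ℕ → ℕ) (i k u v z : ℕ) : Prop where
  u_le : ∀ l, i + 1 < l → l < k → D l + i = l → u ≠ 0 ∧ u ≤ l
  u_mem : u ≠ 0 → i + 1 < u ∧ u < k ∧ D u + i = u
  le_v : ∀ l, i + 1 < l → l < k → D l + (i + 1) = l → l ≤ v
  v_mem : v ≠ 0 → i + 1 < v ∧ v < k ∧ D v + (i + 1) = v
  z_le : z ≤ m
  z_mem : z < m → i + 1 < z ∧ z < k ∧ D z + (i + 1) = z ∧ f z < f i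
  z_min : ∀ l, i + 1 < l → l < k → l < z → D l + (i + 1) = l → f i ≤ f l

section
variable {m : ℕ} {f : ℕ → ℤ} {D : ℕ → ℕ} {i k u v z : ℕ}

/-- The first child is kept once found, the last one is overwritten each time, and the cut is kept
once it is below `m`, the value that stands for none. -/
theorem ChildData.succ (h : ChildData m f D i k u v z) (hk : i + 1 < k) (hkm : k < m) :
    ChildData m f D i (k + 1) (if D k + i = k then (if u ≠ 0 then u else k) else u)
      (if D k + (i + 1) = k then k else v)
      (if D k + (i + 1) = k then (if z < m then z else if f k < f i then k else z) else z) := by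
  obtain ⟨h1, h2, h3, h4, h5, h6, h7⟩ := h
  constructor
  · intro l hl hlk hd
    rcases Nat.lt_succ_iff_lt_or_eq.1 hlk with h8 | rfl
    · have := h1 l hl h8 hd
      split_ifs <;> omega
    · rw [if_pos hd]
      split_ifs with h8
      · have := h2 h8; omega
      · omega
  · intro hu
    split_ifs at hu ⊢ with h8 h9
    · have := h2 h9; omega
    · omega
    · have := h2 hu; omega
  · intro l hl hlk hd
    rcases Nat.lt_succ_iff_lt_or_eq.1 hlk with h8 | rfl
    · have := h3 l hl h8 hd
      split_ifs <;> omega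
    · rw [if_pos hd]
  · intro hv
    split_ifs at hv ⊢ with h8
    · omega
    · have := h4 hv; omega
  · split_ifs <;> omega
  · intro hz
    split_ifs at hz ⊢ with h8 h9 h10
    · have := h6 h9; omega
    · exact ⟨hk, by omega, h8, h10⟩
    · omega
    · have := h6 hz; omega
  · intro l hl hlk hlz hd
    rcases Nat.lt_succ_iff_lt_or_eq.1 hlk with h8 | rfl
    · refine h7 l hl h8 ?_ hd
      split_ifs at hlz <;> omega
    · rw [if_pos hd] at hlz
      split_ifs at hlz with h9 h10
      · have := h6 h9; omega
      · omega
      · exact not_lt.1 h10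

theorem IsParam.unique' {z' : ℕ} (h : IsParam m f D i z) (h' : IsParam m f D i z') : z = z' := by
  unfold IsParam at h h'
  split_ifs at h h'
  · exact h.unique h'
  · obtain ⟨⟨-, -, h1, h2, h3⟩, h4⟩ := h
    obtain ⟨⟨-, -, h1', h2', h3'⟩, h4'⟩ := h'
    rcases lt_trichotomy z z' with h5 | h5 | h5
    · have e1 := h4 z h1 (by omega) (h3 (by omega))
      have e2 := h4' z h1 (by omega) (h3 (by omega))
      omega
    · exact h5
    · have e1 := h4 z' h1' (by omega) (h3' (by omega))
      have e2 := h4' z' h1' (by omega) (h3' (by omega))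
      omega

/-- Once a child lies below entry `i`, all its later siblings do, so the first such child is the
cut. -/
theorem ChildData.param (h : ChildData m f D i m u v z) (hD : IsTable m f D) (hi : i + 1 < m)
    (h1 : D (i + 1) ≠ 1) : IsParam m f D i z := by
  unfold IsParam
  rw [if_neg h1]
  obtain ⟨-, -, -, -, h5, h6, h7⟩ := h
  refine ⟨⟨hi, h1, ?_, h5, fun hz => (h6 hz).2.2.1⟩, fun k hk hkm hd => ⟨fun hf => ?_, fun hz => ?_⟩⟩
  · rcases Nat.lt_or_ge z m with h8 | h8
    · exact (h6 h8).1
    · omega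
  · by_contra h8
    have := h7 k hk hkm (by omega) hd
    omega
  · obtain ⟨h8, h9, h10, h11⟩ := h6 (by omega)
    rcases Nat.lt_or_ge z k with h12 | h12
    · rcases hD k hkm with ⟨h13, -⟩ | ⟨h13, h14, h15, h16, h17⟩
      · omega
      · exact (h17 z (by omega) h12).trans_lt h11
    · rwa [show k = z by omega]

end

/-- The data for the test of a swap in the text are held in memory. -/
def HoldsBack (m : ℕ) (f : ℕ → ℤ) (D : ℕ → ℕ) (i : ℕ) (h : HState) : Prop :=
  (∃ u v e, BackData m f D i u v e ∧ h.arr αback 0 i = lowFst D i u ∧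
    h.arr αback 1 i = highFst D i ∧ h.arr αback 2 i = lowSnd D i v e ∧
    h.arr αback 3 i = highSnd D i v e) ∧ IsParam m f D i (h.arr αback 4 i)

section
variable {I : Input} {S B : ℕ} {h : HState} {Q : HState → ℕ → Prop} {T : ℕ → ℕ}

theorem run_findChildren (H : Fits I S B) (hD : HoldsTable I.pattern.length T h)
    (hi : h.reg ρswap + 1 < I.pattern.length)
    (hQ : ∀ h' t, Frame findChildren h h' → ChildData I.pattern.length (entry I.pattern) T
      (h.reg ρswap) I.pattern.length (h'.reg ρfst) (h'.reg ρlast) (h'.reg ρcut) →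
      t ≤ I.pattern.length → Q h' t) :
    Run I S B findChildren h Q := by
  have hm := H.pos
  have hS := H.side
  have hB := H.le
  refine Run.mono (Q' := fun h' t => ChildData I.pattern.length (entry I.pattern) T
      (h.reg ρswap) I.pattern.length (h'.reg ρfst) (h'.reg ρlast) (h'.reg ρcut) ∧
      t ≤ I.pattern.length) ?_ fun h' t F q => hQ h' t F q.1 q.2
  obtain ⟨i, ei⟩ : ∃ i, h.reg ρswap = i := ⟨_, rfl⟩
  rw [ei] at hi ⊢
  rw [findChildren, run_seq]
  refine run_assign_of (v := 0) (by simp) (by simp) (by omega) ?_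
  rw [run_seq]
  refine run_assign_of (v := 0) (by simp) (by simp) (by omega) ?_
  rw [run_seq]
  refine run_assign_of (v := I.pattern.length) (by simp) (by simp) (by omega) ?_
  rw [run_seq]
  refine run_assign_of (v := i + 2) (by simp) (by simp [ei]) (by omega) ?_
  simp only [zero_add]
  refine run_upto I.pattern.length (fun k h' t => ChildData I.pattern.length (entry I.pattern) T
      i k (h'.reg ρfst) (h'.reg ρlast) (h'.reg ρcut) ∧ t ≤ k)
      (by omega) ?_ (by simp; omega) (by decide) (fun h' F => ⟨by simp, by simp⟩) ?_ ?_
  · simp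
    constructor <;> intros <;> omega
  · rintro h' t F hge hlt ⟨j1, j2⟩
    have e1 : h'.reg ρswap = i := by rw [F.reg _ (by decide), ← ei]; rfl
    have hD' : HoldsTable I.pattern.length T h' := hD.congr (by rw [F.arr _ (by decide)]; rfl)
    replace hge : i + 2 ≤ h'.reg ρcol := hge
    clear F
    obtain ⟨k, ek⟩ : ∃ k, h'.reg ρcol = k := ⟨_, rfl⟩
    rw [ek] at hge hlt j1 j2 ⊢
    have hd := hD' k hlt
    have hk := Nat.mod_eq_of_lt hlt
    have hs := j1.succ (by omega) hlt
    have hz := j1.z_le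
    have b1 : h'.reg ρfst < B := by
      by_cases h0 : h'.reg ρfst = 0
      · omega
      · have := j1.u_mem h0; omega
    have b2 : h'.reg ρlast < B := by
      by_cases h0 : h'.reg ρlast = 0
      · omega
      · have := j1.v_mem h0; omega
    rw [run_seq]
    refine run_assign_of (v := if T k + i = k then (if h'.reg ρfst ≠ 0 then h'.reg ρfst else k)
      else h'.reg ρfst) (by simp [distExpr_ok H]) (by simp [distExpr, hd, hk, ek, e1, select])
      (by split_ifs <;> omega) ?_
    rw [run_seq]
    refine run_assign_of (v := if T k + (i + 1) = k then k else h'.reg ρlast)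
      (by simp [distExpr_ok H]) (by simp [distExpr, hd, hk, ek, e1])
      (by split_ifs <;> omega) ?_
    refine run_assign_of (v := if T k + (i + 1) = k then (if h'.reg ρcut < I.pattern.length then
      h'.reg ρcut else if entry I.pattern k < entry I.pattern i then k else h'.reg ρcut) else h'.reg ρcut)
      (by simp [distExpr_ok H, ek, e1] <;> omega) (by simp [distExpr, hd, hk, ek, e1, select, entry])
      (by split_ifs <;> omega) ?_
    refine ⟨?_, by omega⟩
    simpa using hs
  · rintro h' t F - ⟨j1, j2⟩
    exact ⟨j1, j2⟩

/-- Entries decrease along the chain, so the last point before the parent of `i` is the smallest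
entry between the two. The walk recognises it only one step too late, hence the register for the
previous point. -/
theorem run_findSibling (H : Fits I S B) (hT : IsTable I.pattern.length (entry I.pattern) T)
    (hD : HoldsTable I.pattern.length T h) (hi : h.reg ρswap + 1 < I.pattern.length)
    (hQ : ∀ h' t, Frame findSibling h h' → h'.reg ρprev ≤ h.reg ρswap →
      (h'.reg ρprev = 0 → ∀ j, j < h.reg ρswap → ¬ (0 < T (h.reg ρswap) →
        h.reg ρswap < j + T (h.reg ρswap))) →
      (h'.reg ρprev ≠ 0 → ∀ j, h.reg ρswap - h'.reg ρprev < j → j < h.reg ρswap →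
        entry I.pattern (h.reg ρswap - h'.reg ρprev) < entry I.pattern j) →
      (h'.reg ρprev ≠ 0 → (T (h.reg ρswap - h'.reg ρprev) = 0 ∧ T (h.reg ρswap) = 0) ∨
        (T (h.reg ρswap - h'.reg ρprev) ≠ 0 ∧
          T (h.reg ρswap - h'.reg ρprev) + h'.reg ρprev = T (h.reg ρswap))) →
      t ≤ I.pattern.length → Q h' t) :
    Run I S B findSibling h Q := by
  have hm := H.pos
  have hS := H.side
  have hB := H.le
  obtain ⟨i, ei⟩ : ∃ i, h.reg ρswap = i := ⟨_, rfl⟩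
  rw [ei] at hi hQ
  refine Run.mono (Q' := fun h' t => h'.reg ρprev ≤ i ∧
      (h'.reg ρprev = 0 → ∀ j, j < i → ¬ (0 < T i → i < j + T i)) ∧
      (h'.reg ρprev ≠ 0 → ∀ j, i - h'.reg ρprev < j → j < i →
        entry I.pattern (i - h'.reg ρprev) < entry I.pattern j) ∧
      (h'.reg ρprev ≠ 0 → (T (i - h'.reg ρprev) = 0 ∧ T i = 0) ∨
        (T (i - h'.reg ρprev) ≠ 0 ∧ T (i - h'.reg ρprev) + h'.reg ρprev = T i)) ∧
      t ≤ I.pattern.length) ?_ fun h' t F q => hQ h' t F q.1 q.2.1 q.2.2.1 q.2.2.2.1 q.2.2.2.2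
  rw [findSibling, run_seq]
  refine run_chainStart H ?_
  rw [ei, run_seq]
  refine run_assign_of (v := 0) (by simp) (by simp) (by omega) ?_
  simp only [zero_add]
  obtain ⟨m, em⟩ : ∃ m, I.pattern.length = m := ⟨_, rfl⟩
  rw [em] at hT hD hi hm ⊢
  have hstart : chainRest T i (startDist m i) ≤ i := chainRest_le (by unfold startDist; split_ifs <;> omega)
  have hcons : ∀ {h' : HState}, Frame (ρprev ←ₑ §ρdist ;; chainStep ρswap)
      ((h.setReg ρdist (startDist m i)).setReg ρprev 0) h' →
      h'.reg ρswap = i ∧ HoldsTable m T h' := by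
    intro h' F
    refine ⟨by rw [F.reg ρswap (by decide), ← ei]; rfl, hD.congr ?_⟩
    rw [F.arr αdist (by decide)]; rfl
  have hval : ∀ {h' : HState}, h'.reg ρswap = i → HoldsTable m T h' →
      ((HExpr.cond (§ρdist =ₑ distExpr §ρswap) ¢0 ¢1).val I h' = 0 ↔ h'.reg ρdist = T i) := by
    intro h' h1 h2
    rw [← em] at h2
    have := distExpr_val (I := I) h2 (e := §ρswap) (by rw [HExpr.val_reg, h1]; omega)
    rw [HExpr.val_reg, h1] at this
    simp only [HExpr.val_cond, HExpr.val_op, this, select_eq, HExpr.val_reg, HExpr.val_const]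
    simp
  refine run_loop (fun h' t => ChainPoint m (entry I.pattern) i (h'.reg ρdist) ∧
      t + chainRest T i (h'.reg ρdist) ≤ i ∧ ((h'.reg ρprev = 0 ∧ h'.reg ρdist = startDist m i) ∨
      (h'.reg ρprev ≠ 0 ∧ ChainPoint m (entry I.pattern) i (h'.reg ρprev) ∧
        h'.reg ρdist = nextDist m T i (h'.reg ρprev))))
    (fun h' => chainRest T i (h'.reg ρdist)) ?_ ?_ ?_ ?_
  · simp only [HState.setReg_reg, Nat.reduceEqDiff, if_false, if_true]
    exact ⟨.start, by omega, .inl ⟨trivial, trivial⟩⟩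
  · intro h' t F _
    simp [distExpr_ok H]
  · rintro h' t F ⟨j1, j2, -⟩ hb
    obtain ⟨e1, hD'⟩ := hcons F
    rw [Ne, hval e1 hD'] at hb
    obtain ⟨h2, h3⟩ := j1.high hT (by omega) hb
    have hdi := j1.chain.le
    have hTk := (hT (i - h'.reg ρdist) (by omega)).le
    rw [run_seq]
    refine run_assign_of (v := h'.reg ρdist) (by simp) (by simp) (by omega) ?_
    have hD'' : HoldsTable m T (h'.setReg ρprev (h'.reg ρdist)) := hD'.congr rfl
    refine run_chainStep H (T := T) ?_ ?_ ?_ ?_ ?_ ?_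
    · rw [em]
      refine hD''.dist ?_
      simp [e1]; omega
    · simpa using h2
    · simpa [e1] using hdi
    · simp; omega
    · simp [e1]; omega
    · intro h3' F' hn
      simp [e1, em] at hn
      have e2 : h3'.reg ρprev = h'.reg ρdist := by rw [F'.reg _ (by decide)]; rfl
      have hlt := chainRest_next (T := T) (m := m) (i := i) h2 hTk
      rw [hn, e2]
      exact ⟨⟨j1.next hT (by omega) hb, by omega, .inr ⟨by omega, j1, rfl⟩⟩, hlt⟩
  · rintro h' t F ⟨j1, j2, j3⟩ hb
    obtain ⟨e1, hD'⟩ := hcons F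
    rw [hval e1 hD'] at hb
    rcases j3 with ⟨h1, h2⟩ | ⟨h1, h2, h3⟩
    · refine ⟨by omega, fun _ j hj hj' => ?_, fun h => absurd h1 h, fun h => absurd h1 h, by omega⟩
      -- The walk stopped at once, so the parent of `i` is `i - 1` and nothing lies between.
      rw [← hb, h2, startDist, if_pos (by omega), if_pos (by omega)] at hj'
      omega
    · have hle := h2.chain.le
      refine ⟨hle, fun h => absurd h h1, fun _ => h2.vis h1, fun _ => ?_, by omega⟩
      have hTk := (hT (i - h'.reg ρprev) (by omega)).le
      rw [← hb, h3]
      unfold nextDist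
      by_cases h4 : 0 < T (i - h'.reg ρprev)
      · rw [if_pos h4, if_pos (by omega)]
        right; omega
      · rw [if_neg h4]
        left; omega

/-- Each of the three searches takes at most `m` iterations per swap position, so the quadratic
bound needs no amortisation. -/
theorem run_buildBack (H : Fits I S B) (hT : IsTable I.pattern.length (entry I.pattern) T)
    (hD : HoldsTable I.pattern.length T h)
    (hQ : ∀ h' t, Frame buildBack h h' →
      (∀ i, i + 1 < I.pattern.length → HoldsBack I.pattern.length (entry I.pattern) T i h') →
      t ≤ I.pattern.length * (3 * I.pattern.length + 1) → Q h' t) :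
    Run I S B buildBack h Q := by
  have hm := H.pos
  have hS := H.side
  have hB := H.le
  refine Run.mono (Q' := fun h' t =>
      (∀ i, i + 1 < I.pattern.length → HoldsBack I.pattern.length (entry I.pattern) T i h') ∧
      t ≤ I.pattern.length * (3 * I.pattern.length + 1)) ?_ fun h' t F q => hQ h' t F q.1 q.2
  rw [buildBack, run_seq]
  refine run_assign_of (v := 0) (by simp) (by simp) (by omega) ?_
  refine run_upto (I.pattern.length - 1) (fun i h' t =>
      (∀ i', i' < i → HoldsBack I.pattern.length (entry I.pattern) T i' h') ∧
      t ≤ i * (3 * I.pattern.length + 1)) (by omega) ?_ (by simp) (by decide)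
      (fun h' F => ⟨by simp, by simp⟩) ?_ ?_
  · simp
  · rintro h' t F - hlt ⟨j1, j2⟩
    have hD' : HoldsTable I.pattern.length T h' := hD.congr (by rw [F.arr _ (by decide)]; rfl)
    clear F
    obtain ⟨i, ei⟩ : ∃ i, h'.reg ρswap = i := ⟨_, rfl⟩
    rw [ei] at hlt j1 j2 ⊢
    rw [run_seq]
    refine run_findChildren H hD' (by omega) fun h1 t1 F1 c1 c2 => ?_
    rw [ei] at c1
    have hD1 := hD'.congr (F1.arr αdist (by decide))
    have e1 : h1.reg ρswap = i := by rw [F1.reg _ (by decide), ei]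
    rw [run_seq]
    refine run_findSibling H hT hD1 (by omega) fun h2 t2 F2 s1 s2 s3 s4 s5 => ?_
    rw [e1] at s1 s2 s3 s4
    have hD2 := hD1.congr (F2.arr αdist (by decide))
    have e2 : h2.reg ρswap = i := by rw [F2.reg _ (by decide), e1]
    rw [run_seq]
    refine run_findBelow (s := .pattern) (r := ρswap) (v := §ρswap +ₑ ¢1) H (T := T) (w := i + 1)
      (by decide) (by decide) (by rw [e2]; exact hD2.dist (by omega)) (fun q hq => hT q (by omega))
      (by rw [e2, Input.get_pattern]; omega) (by rw [Input.get_pattern]; omega) (fun g hg => ⟨by simp, by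
        simp [hg ρswap (by decide) (by decide), e2]⟩) fun h3 t3 F3 p1 p2 => ?_
    rw [e2, Input.get_pattern] at p1
    rw [e2] at p2
    have hstart : chainRest T i (startDist I.pattern.length i) ≤ i :=
      chainRest_le (by unfold startDist; split_ifs <;> omega)
    have hD3 : HoldsTable I.pattern.length T h3 := hD2.congr (F3.arr αdist (by decide))
    have e3 : h3.reg ρswap = i := by rw [F3.reg _ (by decide), e2]
    have eu : h3.reg ρfst = h1.reg ρfst := by rw [F3.reg _ (by decide), F2.reg _ (by decide)]
    have ev : h3.reg ρlast = h1.reg ρlast := by rw [F3.reg _ (by decide), F2.reg _ (by decide)]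
    have ez : h3.reg ρcut = h1.reg ρcut := by rw [F3.reg _ (by decide), F2.reg _ (by decide)]
    have ee : h3.reg ρprev = h2.reg ρprev := by rw [F3.reg _ (by decide)]
    have eb : h3.arr αback = h'.arr αback := by
      rw [F3.arr _ (by decide), F2.arr _ (by decide), F1.arr _ (by decide)]
    rw [← eu, ← ev, ← ez] at c1
    rw [← ee] at s1 s2 s3 s4
    clear F1 F2 F3 hD1 hD2 hD'
    have hback : BackData I.pattern.length (entry I.pattern) T i (h3.reg ρfst) (h3.reg ρlast)
        (h3.reg ρprev) := ⟨c1.u_le, c1.u_mem, c1.le_v, c1.v_mem, s2, s1, s3, s4⟩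
    have hi : i < I.pattern.length := by omega
    have hi1 : i + 1 < I.pattern.length := by omega
    have d0 := hD3 i hi
    have d1 := hD3 (i + 1) hi1
    have k0 := Nat.mod_eq_of_lt hi
    have k1 := Nat.mod_eq_of_lt hi1
    have b1 : h3.reg ρfst < I.pattern.length := by
      by_cases h0 : h3.reg ρfst = 0
      · omega
      · have := c1.u_mem h0; omega
    have b2 : h3.reg ρlast < I.pattern.length := by
      by_cases h0 : h3.reg ρlast = 0
      · omega
      · have := c1.v_mem h0; omega
    have b3 := c1.z_le
    have b4 := p1.lt hm
    rw [writeBack, run_seq]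
    refine run_put_of (x' := 0) (y' := i) (v := lowFst T i (h3.reg ρfst)) (by simp) (by simp [e3]) ?_
      (by simp) (by simp) (by simp [distExpr_ok H]) (by omega) (by omega)
      (by unfold lowFst; split_ifs <;> omega) ?_
    · simp [distExpr, d0, d1, k0, k1, e3, lowFst, select]
      split_ifs <;> omega
    rw [run_seq]
    refine run_put_of (x' := 1) (y' := i) (v := highFst T i) (by simp) (by simp [e3]) ?_
      (by simp) (by simp) (by simp [distExpr_ok H]) (by omega) (by omega)
      (by unfold highFst; split_ifs <;> omega) ?_
    · simp [distExpr, d1, k1, e3, highFst]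
    rw [run_seq]
    refine run_put_of (x' := 2) (y' := i) (v := lowSnd T i (h3.reg ρlast) (h3.reg ρprev)) (by simp)
      (by simp [e3]) ?_ (by simp) (by simp) (by simp [distExpr_ok H]) (by omega) (by omega)
      (by unfold lowSnd; split_ifs <;> omega) ?_
    · simp [distExpr, d1, k1, e3, lowSnd, select]
    rw [run_seq]
    refine run_put_of (x' := 3) (y' := i) (v := highSnd T i (h3.reg ρlast) (h3.reg ρprev)) (by simp)
      (by simp [e3]) ?_ (by simp) (by simp) (by simp [distExpr_ok H]) (by omega) (by omega)
      (by unfold highSnd; split_ifs <;> omega) ?_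
    · simp [distExpr, d1, k1, e3, highSnd, select]
    refine run_put_of (x' := 4) (y' := i) (v := if T (i + 1) = 1 then h3.reg ρdist else h3.reg ρcut)
      (by simp) (by simp [e3]) ?_ (by simp) (by simp) (by simp [distExpr_ok H]) (by omega) (by omega)
      (by split_ifs <;> omega) ?_
    · simp [distExpr, d1, k1, e3]
    refine ⟨fun i' hi' => ?_, ?_⟩
    · by_cases h4 : i' = i
      · subst h4
        refine ⟨⟨_, _, _, hback, by simp, by simp, by simp, by simp⟩, ?_⟩
        simp only [HState.setReg_arr, HState.setArr_arr, and_true, if_true]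
        split_ifs with h5
        · unfold IsParam
          rwa [if_pos h5]
        · exact c1.param hT (by omega) h5
      · have := j1 i' (by omega)
        unfold HoldsBack at this ⊢
        simpa [h4, eb] using this
    · have : (i + 1) * (3 * I.pattern.length + 1) = i * (3 * I.pattern.length + 1) +
        (3 * I.pattern.length + 1) := by ring
      omega
  · rintro h' t F - ⟨j1, j2⟩
    refine ⟨fun i hi => j1 i (by omega), ?_⟩
    rw [zero_add]
    exact j2.trans (Nat.mul_le_mul_right _ (by omega))

end

end CTSwap

namespace CTSwap

/-! ### The construction of the automaton -/

/-- Build the automaton, together with the data for the test of a swap in the text. -/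
def buildAutomaton : HCmd :=
  buildDist ;; buildTables ;; buildBack ;; buildTrie ;; buildFail ;; buildNum

/-- The automaton of `p`, whose distances are `T`, is held in memory. -/
structure Ready (p : List ℤ) (T : ℕ → ℕ) (K : ℕ) (W : ℕ → ℕ → ℕ) (h : HState) : Prop where
  lists : Lists p K W
  bound : K ≤ 5 * p.length
  held : HoldsLists p.length K W h
  trie : PartTrie K W p.length 0 h
  link : ∀ d r, 1 ≤ d → d ≤ p.length → r < K → HasLink p K W h d r
  back : ∀ i, i + 1 < p.length → HoldsBack p.length (entry p) T i h
  first : ∀ k, k < p.length → W 0 k = T k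
  param : ∀ r, 1 ≤ r → r < K → Valid p.length (entry p) T (h.arr αparam 0 r) (h.arr αparam 1 r) ∧
    ∀ k, k < p.length → W r k = newTable T (h.arr αparam 0 r) (h.arr αparam 1 r) k

section
variable {I : Input} {S B : ℕ} {h : HState} {Q : HState → ℕ → Prop} {T : ℕ → ℕ}

/-- The array of distances is exempt: the scan overwrites the pattern's distances with those of the
text, and everything derived from the former is stored elsewhere. -/
theorem Ready.congr {p : List ℤ} {K : ℕ} {W : ℕ → ℕ → ℕ} {h' : HState} (H : Ready p T K W h)
    (h1 : h'.reg ρtables = h.reg ρtables) (h2 : ∀ a, a ≠ αdist → h'.arr a = h.arr a) :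
    Ready p T K W h' := by
  obtain ⟨a1, a2, a3, a4, a5, a6, a7, a8⟩ := H
  refine ⟨a1, a2, a3.congr h1 (h2 _ (by decide)),
    a4.congr (h2 _ (by decide)) (h2 _ (by decide)) (h2 _ (by decide)),
    fun d r b1 b2 b3 => (a5 d r b1 b2 b3).congr (by rw [h2 _ (by decide)]) (by rw [h2 _ (by decide)]),
    fun i hi => ?_, a7, ?_⟩
  · have := a6 i hi
    unfold HoldsBack at this ⊢
    rwa [h2 αback (by decide)]
  · rwa [h2 αparam (by decide)]

theorem HasTables.lists {p : List ℤ} (hp : p.Nodup) (hT : IsTable p.length (entry p) T)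
    (H : HasTables p.length (entry p) T (fun _ _ => True) h) :
    Lists p (h.reg ρtables) (fun r k => h.arr αtable r k - 1) := by
  have hone := H.one
  have e0 : tableList p.length (fun k => h.arr αtable 0 k - 1) = tableList p.length T :=
    tableList_eq_iff.2 fun k hk => by simp [H.first k hk]
  have e1 : ∀ r, 1 ≤ r → r < h.reg ρtables → tableList p.length (fun k => h.arr αtable r k - 1) =
      tableList p.length (newTable T (h.arr αparam 0 r) (h.arr αparam 1 r)) := fun r h1 h2 =>
    tableList_eq_iff.2 fun k hk => by simp [(H.valid r h1 h2).2 k hk]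
  refine ⟨by omega, fun w => ?_, fun r k hr hk => ?_⟩
  · rw [mem_tables_iff hp rfl hT]
    constructor
    · rintro (rfl | ⟨i, z, hv, rfl⟩)
      · exact ⟨0, by omega, e0.symm⟩
      · obtain ⟨r, h1, h2, h3, h4⟩ := H.complete i z hv trivial
        exact ⟨r, h2, by rw [e1 r h1 h2, h3, h4]⟩
    · rintro ⟨r, hr, rfl⟩
      rcases Nat.eq_zero_or_pos r with rfl | h1
      · exact .inl e0
      · exact .inr ⟨_, _, (H.valid r h1 hr).1, e1 r h1 hr⟩
  · rcases Nat.eq_zero_or_pos r with rfl | h1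
    · have := H.first k hk
      have := (hT k hk).le
      omega
    · obtain ⟨h2, h3⟩ := H.valid r h1 hr
      have := h3 k hk
      have := h2.newTable_le (fun k hk => (hT k hk).le) hk
      omega

theorem run_buildAutomaton (H : Fits I S B) (hp : I.pattern.Nodup)
    (hT : IsTable I.pattern.length (entry I.pattern) T) (h0 : ∀ a x y, h.arr a x y = 0)
    (hQ : ∀ h' t K W, Frame buildAutomaton h h' → Ready I.pattern T K W h' →
      Numbered I.pattern.length W (NodesBefore K W (I.pattern.length + 1) 0) h' →
      h'.reg ρstates ≤ (I.pattern.length + 1) * K →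
      t ≤ 100 * I.pattern.length ^ 2 → Q h' t) :
    Run I S B buildAutomaton h Q := by
  have hm := H.pos
  have hS := H.side
  obtain ⟨m, em⟩ : ∃ m, I.pattern.length = m := ⟨_, rfl⟩
  refine Run.mono (Q' := fun h' t => ∃ K W, Ready I.pattern T K W h' ∧
      Numbered I.pattern.length W (NodesBefore K W (I.pattern.length + 1) 0) h' ∧
      h'.reg ρstates ≤ (I.pattern.length + 1) * K ∧
      t ≤ 100 * I.pattern.length ^ 2) ?_
      fun h' t F ⟨K, W, q1, q2, q3, q4⟩ => hQ h' t K W F q1 q2 q3 q4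
  rw [buildAutomaton, run_seq]
  refine run_buildDist H hT fun h1 t1 F1 d1 l1 => ?_
  rw [run_seq]
  refine run_buildTables H hT d1.table (fun r k => by rw [F1.arr _ (by decide), h0]) fun h2 t2 F2 d2 b2 l2 => ?_
  have hl := d2.lists hp hT
  have hD2 : HoldsTable I.pattern.length T h2 := d1.table.congr (F2.arr _ (by decide))
  obtain ⟨K, eK⟩ : ∃ K, h2.reg ρtables = K := ⟨_, rfl⟩
  obtain ⟨W, eW⟩ : ∃ W : ℕ → ℕ → ℕ, W = fun r k => h2.arr αtable r k - 1 := ⟨_, rfl⟩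
  rw [← eW, eK] at hl
  rw [eK] at b2
  have hfirst : ∀ k, k < I.pattern.length → W 0 k = T k := fun k hk => by
    rw [eW]; simp [d2.first k hk]
  have hparam : ∀ r, 1 ≤ r → r < K → Valid I.pattern.length (entry I.pattern) T
      (h2.arr αparam 0 r) (h2.arr αparam 1 r) ∧
      ∀ k, k < I.pattern.length → W r k = newTable T (h2.arr αparam 0 r) (h2.arr αparam 1 r) k := by
    intro r hr hr'
    obtain ⟨a1, a2⟩ := d2.valid r hr (by omega)
    exact ⟨a1, fun k hk => by rw [eW]; simp [a2 k hk]⟩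
  have hheld : HoldsLists I.pattern.length K W h2 := by
    refine ⟨eK, d2.guard, fun r k hr hk => ?_⟩
    rcases Nat.eq_zero_or_pos r with rfl | h3
    · rw [hfirst k hk, d2.first k hk]
    · rw [(hparam r h3 hr).2 k hk, (d2.valid r h3 (by omega)).2 k hk]
  have hz : ∀ a, a ∈ [αrep, αbranch, αchild, αfailDepth, αfailRow] → ∀ x y, h2.arr a x y = 0 := by
    intro a ha x y
    simp only [List.mem_cons, List.not_mem_nil, or_false] at ha
    rcases ha with rfl | rfl | rfl | rfl | rfl <;>
      rw [F2.arr _ (by decide), F1.arr _ (by decide), h0]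
  have hKS : K ≤ S := by omega
  rw [run_seq]
  refine run_buildBack H hT hD2 fun h3 t3 F3 d3 l3 => ?_
  have hheld3 := hheld.congr (F3.reg _ (by decide)) (F3.arr _ (by decide))
  rw [run_seq]
  refine run_buildTrie H hKS hheld3 hl.le
    (fun x y => by rw [F3.arr _ (by decide)]; exact hz _ (by decide) x y)
    (fun x y => by rw [F3.arr _ (by decide)]; exact hz _ (by decide) x y)
    (fun x y => by rw [F3.arr _ (by decide)]; exact hz _ (by decide) x y) fun h4 t4 F4 d4 l4 => ?_
  have hheld4 := hheld3.congr (F4.reg _ (by decide)) (F4.arr _ (by decide))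
  rw [run_seq]
  refine run_buildFail H hl hKS hheld4 d4
    (fun x y => by rw [F4.arr _ (by decide), F3.arr _ (by decide)]; exact hz _ (by decide) x y)
    (fun x y => by rw [F4.arr _ (by decide), F3.arr _ (by decide)]; exact hz _ (by decide) x y)
    fun h5 t5 F5 d5 l5 => ?_
  have hheld5 := hheld4.congr (F5.reg _ (by decide)) (F5.arr _ (by decide))
  have htrie5 := d4.congr (F5.arr _ (by decide)) (F5.arr _ (by decide)) (F5.arr _ (by decide))
  refine run_buildNum H hl b2 hheld5 htrie5 d5 fun h6 t6 F6 d6 s6 l6 => ?_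
  refine ⟨K, W, ⟨hl, b2, hheld5.congr (F6.reg _ (by decide)) (F6.arr _ (by decide)),
    htrie5.congr (F6.arr _ (by decide)) (F6.arr _ (by decide)) (F6.arr _ (by decide)),
    fun d r a1 a2 a3 => (d5 d r a1 a2 a3).congr (by rw [F6.arr _ (by decide)])
      (by rw [F6.arr _ (by decide)]), fun i hi => ?_, hfirst, ?_⟩, d6, s6, ?_⟩
  · have := d3 i hi
    unfold HoldsBack at this ⊢
    rwa [F6.arr αback (by decide), F5.arr αback (by decide), F4.arr αback (by decide)]
  · rwa [F6.arr αparam (by decide), F5.arr αparam (by decide), F4.arr αparam (by decide),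
      F3.arr αparam (by decide)]
  · rw [em] at hm b2 l1 l2 l3 l4 l5 l6 ⊢
    -- All phases are quadratic because `K ≤ 5 * m`; the constants are crude and use `1 ≤ m`.
    have k1 : m * (K + 1) ≤ m * (6 * m) := Nat.mul_le_mul_left _ (by omega)
    have k2 : m * (3 * K + 1) ≤ m * (16 * m) := Nat.mul_le_mul_left _ (by omega)
    have k3 : (m + 1) * (K + 1) ≤ (2 * m) * (6 * m) := Nat.mul_le_mul (by omega) (by omega)
    have k4 : m ≤ m * m := Nat.le_mul_of_pos_left _ hm
    nlinarith

end

end CTSwap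

namespace CTSwap

/-! ### Scanning the text -/

/-- Report the factor that ends at `ρpos`. -/
def report : HCmd := .emit (§ρpos +ₑ ¢1 -ₑ lenExpr)

/-- Report the factor that ends at `ρpos`, which has the table `ρcurRow`, if it matches the pattern
by a swap. -/
def reportSwap : HCmd :=
  .ite §ρcurRow
    (ρfst ←ₑ §ρpos +ₑ ¢1 -ₑ lenExpr ;; ρswap ←ₑ .arr αparam ¢0 §ρcurRow ;;
      .ite (.arr αparam ¢1 §ρcurRow =ₑ .arr αback ¢4 §ρswap) report
        (.ite (.less .text (§ρfst +ₑ .arr αback ¢0 §ρswap) (§ρfst +ₑ .arr αback ¢1 §ρswap))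
          (.ite (.less .text (§ρfst +ₑ .arr αback ¢2 §ρswap) (§ρfst +ₑ .arr αback ¢3 §ρswap))
            report .skip)
          .skip))
    report

/-- Read the entry of the text at `ρpos`. -/
def scanStep (c : HCmd) : HCmd :=
  prevDist .text ;; ρlabel ←ₑ §ρdist ;; advance ;; .ite (§ρcurDepth =ₑ lenExpr) c .skip

/-- Read the text; `c` is run whenever a final state is reached. -/
def scanText (c : HCmd) : HCmd :=
  ρcurDepth ←ₑ ¢0 ;; ρcurRow ←ₑ ¢0 ;; ρpos ←ₑ ¢0 ;; .upto ρpos (.len .text) (scanStep c)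

/-- In a final state, the program `c` reports the factor if and only if it is in relation `R` to the
pattern. -/
structure Decides (R : List ℤ → List ℤ → Prop) (c : HCmd) : Prop where
  arrs : c.arrs = []
  regs : ∀ r ∈ c.regs, r = ρfst ∨ r = ρswap
  run : ∀ {I : Input} {S B : ℕ} {T : ℕ → ℕ} {K : ℕ} {W : ℕ → ℕ → ℕ} {h : HState},
    Fits I S B → I.pattern.Nodup → I.text.Nodup → IsTable I.pattern.length (entry I.pattern) T →
    Ready I.pattern T K W h → h.reg ρpos < I.text.length → I.pattern.length ≤ h.reg ρpos + 1 →
    h.reg ρcurRow < K →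
    parentDistance ((I.text.drop (h.reg ρpos + 1 - I.pattern.length)).take I.pattern.length) =
      tableList I.pattern.length (W (h.reg ρcurRow)) →
    Run I S B c h fun h' t => t = 0 ∧
      (R I.pattern ((I.text.drop (h.reg ρpos + 1 - I.pattern.length)).take I.pattern.length) →
        h'.out = h.out ++ [h.reg ρpos + 1 - I.pattern.length]) ∧
      (¬ R I.pattern ((I.text.drop (h.reg ρpos + 1 - I.pattern.length)).take I.pattern.length) →
        h'.out = h.out)

section
variable {I : Input} {S B : ℕ} {h : HState} {Q : HState → ℕ → Prop} {T : ℕ → ℕ}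

theorem run_report (hQ : Q (h.emit (h.reg ρpos + 1 - I.pattern.length)) 0) :
    Run I S B report h Q := by
  rw [report, run_emit]
  exact ⟨by simp, hQ⟩

theorem Lists.row_mem {p : List ℤ} {K : ℕ} {W : ℕ → ℕ → ℕ} (hl : Lists p K W) {r : ℕ} (hr : r < K) :
    tableList p.length (W r) ∈ CTSwap.tables p := (hl.tables _).2 ⟨r, hr, rfl⟩

theorem nodup_window {t : List ℤ} (ht : t.Nodup) (j m : ℕ) : ((t.drop j).take m).Nodup :=
  ht.sublist ((List.take_sublist _ _).trans (List.drop_sublist _ _))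

/-- A complete table of the automaton is already a match of trees, so nothing is left to test. -/
theorem decides_report : Decides NeighbourMatch report := by
  refine ⟨rfl, by simp [report, HCmd.regs], ?_⟩
  intro I S B T K W h H hp ht hT hR hj hmj hr he
  refine run_report ⟨rfl, fun _ => rfl, fun hn => absurd ?_ hn⟩
  rw [neighbourMatch_iff (nodup_window ht _ _), he]
  exact hR.lists.row_mem hr

theorem BackData.lt {m : ℕ} {f : ℕ → ℤ} {D : ℕ → ℕ} {i u v e : ℕ} (hb : BackData m f D i u v e)
    (hi : i + 1 < m) : lowFst D i u < m ∧ highFst D i < m ∧ lowSnd D i v e < m ∧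
      highSnd D i v e < m := by
  have h1 := hb.u_mem
  have h2 := hb.v_mem
  unfold lowFst highFst lowSnd highSnd
  refine ⟨?_, ?_, ?_, ?_⟩ <;> split_ifs <;> omega

/-- Row `0` is the tree of the pattern itself. For any other row the swap position is known, and the
factor matches if the pattern's own swap there has the stored parameter or if both precomputed
comparisons in the factor succeed. -/
theorem decides_reportSwap : Decides SwapMatch reportSwap := by
  refine ⟨rfl, by simp [reportSwap, report, HCmd.regs], ?_⟩
  intro I S B T K W h H hp ht hT hR hj hmj hr he
  have hm := H.pos
  have hS := H.side
  have hB := H.le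
  have hBt := H.text
  obtain ⟨w, hw⟩ : ∃ w, (I.text.drop (h.reg ρpos + 1 - I.pattern.length)).take I.pattern.length = w :=
    ⟨_, rfl⟩
  have hlen : w.length = I.pattern.length := by rw [← hw]; simp; omega
  have hnd : w.Nodup := by rw [← hw]; exact nodup_window ht _ _
  have hentry : ∀ k, k < I.pattern.length → entry w k =
      entry I.text (h.reg ρpos + 1 - I.pattern.length + k) := fun k hk => by
    rw [← hw, entry_take hk, entry_drop]
  rw [hw] at he ⊢
  obtain ⟨r, er⟩ : ∃ r, h.reg ρcurRow = r := ⟨_, rfl⟩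
  rw [er] at hr he
  have hbound := hR.bound
  refine run_ite_of (by simp) (fun hne => ?_) (fun heq => ?_)
  · simp [er] at hne
    obtain ⟨hv, htab⟩ := hR.param r (by omega) hr
    obtain ⟨i, ei⟩ : ∃ i, h.arr αparam 0 r = i := ⟨_, rfl⟩
    obtain ⟨z, ez⟩ : ∃ z, h.arr αparam 1 r = z := ⟨_, rfl⟩
    rw [ei, ez] at hv htab
    have hi := hv.lt
    obtain ⟨⟨u, v, e, hb, b0, b1, b2, b3⟩, hq⟩ := hR.back i hi
    obtain ⟨l0, l1, l2, l3⟩ := hb.lt hi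
    rw [tableList_eq_iff.2 htab] at he
    have hiff := swapMatch_iff hp hnd rfl hlen hT hv he
    have hwT := (parentDistance_eq_tableList hlen).1 he
    rw [back_iff hwT (distinct_entry hnd hlen) hT (distinct_entry hp rfl) hi hb] at hiff
    rw [hentry _ l0, hentry _ l1, hentry _ l2, hentry _ l3] at hiff
    obtain ⟨o, eo⟩ : ∃ o, h.reg ρpos + 1 - I.pattern.length = o := ⟨_, rfl⟩
    rw [eo] at hiff ⊢
    rw [run_seq]
    refine run_assign_of (v := o) (by simp) (by simpa using eo) (by omega) ?_
    rw [run_seq]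
    refine run_assign_of (v := i) (by simp [er] <;> omega) (by simp [er, ei]) (by omega) ?_
    refine run_ite_of (by simp [er] <;> omega) (fun hne1 => ?_) (fun heq1 => ?_)
    · simp [er, ez] at hne1
      refine run_report ⟨rfl, fun _ => by simp [eo], fun hn => absurd ?_ hn⟩
      rw [hiff, hne1]
      exact .inl hq
    · simp [er, ez] at heq1
      have hnp : ¬ IsParam I.pattern.length (entry I.pattern) T i z := fun h1 => heq1 (h1.unique' hq)
      simp only [hnp, false_or] at hiff
      refine run_ite_of (by simp [b0, b1] <;> omega) (fun hne2 => ?_) (fun heq2 => ?_)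
      · rw [HExpr.val_less, Ne, Input.cmp_eq_zero, not_le] at hne2
        simp [b0, b1] at hne2
        refine run_ite_of (by simp [b2, b3] <;> omega) (fun hne3 => ?_) (fun heq3 => ?_)
        · rw [HExpr.val_less, Ne, Input.cmp_eq_zero, not_le] at hne3
          simp [b2, b3] at hne3
          refine run_report ⟨rfl, fun _ => by simp [eo], fun hn => absurd ?_ hn⟩
          rw [hiff]
          simpa [entry] using ⟨hne2, hne3⟩
        · rw [HExpr.val_less, Input.cmp_eq_zero] at heq3
          simp [b2, b3] at heq3
          rw [run_skip]
          refine ⟨rfl, fun hn => absurd (hiff.1 hn).2 ?_, fun _ => rfl⟩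
          simpa [entry] using heq3
      · rw [HExpr.val_less, Input.cmp_eq_zero] at heq2
        simp [b0, b1] at heq2
        rw [run_skip]
        refine ⟨rfl, fun hn => absurd (hiff.1 hn).1 ?_, fun _ => rfl⟩
        simpa [entry] using heq2
  · simp [er] at heq
    refine run_report ⟨rfl, fun _ => rfl, fun hn => absurd ⟨hlen.symm, .inl ?_⟩ hn⟩
    rw [cartesianTree_eq_iff hp hnd, he, heq, (parentDistance_eq_tableList rfl).2 hT]
    exact tableList_eq_iff.2 fun k hk => (hR.first k hk).symm

/-- The current state is the longest suffix of the text read so far whose table is a state. The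
truncation of distances to the window is harmless, since no state is longer than `m`. With the depth
and `chainBefore` as potentials, a position costs four units: one for its distance, two for the
transition, one for the loop. -/
theorem run_scanText (H : Fits I S B) {R : List ℤ → List ℤ → Prop} {c : HCmd} (hc : Decides R c)
    (hRN : ∀ y : List ℤ, y.Nodup → R I.pattern y → NeighbourMatch I.pattern y)
    (hp : I.pattern.Nodup) (ht : I.text.Nodup) {K : ℕ} {W : ℕ → ℕ → ℕ}
    (hT : IsTable I.pattern.length (entry I.pattern) T) (hR : Ready I.pattern T K W h)
    (ho : h.out = [])
    (hQ : ∀ h' t, h'.out.Nodup → (∀ j, j ∈ h'.out ↔ j + I.pattern.length ≤ I.text.length ∧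
      R I.pattern ((I.text.drop j).take I.pattern.length)) → t ≤ 4 * I.text.length → Q h' t) :
    Run I S B (scanText c) h Q := by
  have hm := H.pos
  have hS := H.side
  have hB := H.le
  have hBt := H.text
  have hl := hR.lists
  have hKS : K ≤ S := by have := hR.bound; omega
  obtain ⟨D, hD⟩ : ∃ D : ℕ → ℕ, ∀ q, q < I.text.length →
      PrevBelow I.pattern.length (entry I.text) q (entry I.text q) (D q) := by
    choose D hD using fun q => PrevBelow.exists (m := I.pattern.length) (f := entry I.text)
      (i := q) (v := entry I.text q)
    exact ⟨D, fun q _ => hD q⟩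
  rw [scanText, run_seq]
  refine run_assign_of (v := 0) (by simp) (by simp) (by omega) ?_
  rw [run_seq]
  refine run_assign_of (v := 0) (by simp) (by simp) (by omega) ?_
  rw [run_seq]
  refine run_assign_of (v := 0) (by simp) (by simp) (by omega) ?_
  refine run_upto I.text.length (fun j h' t => Ready I.pattern T K W h' ∧
      HoldsDist I.pattern.length D j h' ∧
      IsLongest (states I.pattern) (tableList j D) j (h'.reg ρcurDepth) ∧
      Node K W (tableList j D) (h'.reg ρcurDepth) (h'.reg ρcurRow) ∧
      t + h'.reg ρcurDepth + chainBefore D j ≤ 4 * j ∧ h'.out.Nodup ∧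
      ∀ x, x ∈ h'.out ↔ x + I.pattern.length ≤ j ∧
        R I.pattern ((I.text.drop x).take I.pattern.length))
    (by omega) ?_ (by simp) ?_ (fun h' F => ⟨by simp, by simp⟩) ?_ ?_
  · simp only [HState.setReg_reg, Nat.reduceEqDiff, if_false, if_true]
    refine ⟨hR.congr rfl fun _ _ => rfl, fun q hq => absurd hq (Nat.not_lt_zero _), ⟨le_rfl, ?_, fun l h1 h2 => absurd h1 (by omega)⟩,
      ⟨hl.pos, firstRep_zero, by simp [suffixTable_zero, tableList]⟩, by simp [chainBefore_zero],
      by simp [ho], 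
      fun x => ⟨fun h1 => absurd h1 (by simp [ho]), fun h1 => absurd h1.1 (by omega)⟩⟩
    rw [suffixTable_zero]
    simpa [tableList] using hl.mem (Nat.zero_le _) hl.pos
  · have := hc.regs
    simp only [scanStep, HCmd.regs, List.mem_append, not_or]
    refine ⟨by decide, by decide, by decide, fun h1 => ?_, by decide⟩
    have := this _ h1
    revert this
    decide
  · rintro h' t - - hlt ⟨j1, j2, j3, j4, j5, j6, j7⟩
    obtain ⟨j, ej⟩ : ∃ j, h'.reg ρpos = j := ⟨_, rfl⟩
    rw [ej] at hlt j2 j3 j4 j5 j7 ⊢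
    rw [scanStep, run_seq]
    refine run_prevDist H (s := .text) (T := D) (by rwa [ej]) hD (by rwa [ej]) fun h1 t1 F1 a1 a2 a3 => ?_
    rw [ej] at a1 a2 a3
    have e1 : h1.reg ρpos = j := by rw [F1.reg _ (by decide), ej]
    have hlab := (hD j hlt).lt hm
    have r1 : Ready I.pattern T K W h1 := j1.congr (F1.reg _ (by decide)) fun a ha => F1.arr _ (by
      rw [arrs_prevDist]; simpa using ha)
    rw [← F1.reg ρcurDepth (by decide)] at j3 j4 j5
    rw [← F1.reg ρcurRow (by decide)] at j4
    rw [← F1.out rfl] at j6 j7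
    rw [run_seq]
    refine run_assign_of (v := D j) (by simp) (by simpa using a1) (by omega) ?_
    have r2 : Ready I.pattern T K W (h1.setReg ρlabel (D j)) := r1.congr rfl fun _ _ => rfl
    rw [run_seq]
    refine run_advance H hl hKS r2.held r2.trie (X := tableList j D) (b := j) (c := D j)
      (by rw [length_tableList]) (by simp) (by omega) (by simpa using j3) (by simpa using j4)
      (fun d r b1 b2 b3 => r2.link d r b1 ?_ b3) fun h2 t2 F2 c1 c2 c3 => ?_
    · by_contra hd
      have h5 := j3.mem
      rw [j4.table] at h5
      exact hl.not_mem (by rw [length_tableList]; exact lt_of_lt_of_le (by omega) b2) h5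
    rw [← tableList_succ] at c1 c2
    simp only [HState.setReg_reg, Nat.reduceEqDiff, if_false] at c3
    have e2 : h2.reg ρpos = j := by rw [F2.reg _ (by decide), ← e1]; rfl
    have r3 : Ready I.pattern T K W h2 := r2.congr (F2.reg _ (by decide)) fun a _ => F2.arr _ (by
      simp [advance, HCmd.arrs])
    have d2 : h2.arr αdist = h1.arr αdist := by rw [F2.arr _ (by decide)]; rfl
    have o2 : h2.out = h1.out := by rw [F2.out rfl]; rfl
    rw [← o2] at j6 j7
    clear F1 F2 r1 r2 j1 j2
    have hdep : h2.reg ρcurDepth ≤ I.pattern.length := by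
      by_contra hd
      have h5 := c1.mem
      rw [c2.table] at h5
      exact hl.not_mem (by rw [length_tableList]; omega) h5
    have hsplit : ∀ x, (x + I.pattern.length ≤ j + 1 ∧
        R I.pattern ((I.text.drop x).take I.pattern.length)) ↔ (x + I.pattern.length ≤ j ∧
        R I.pattern ((I.text.drop x).take I.pattern.length)) ∨ (I.pattern.length ≤ j + 1 ∧
        x = j + 1 - I.pattern.length ∧ R I.pattern ((I.text.drop x).take I.pattern.length)) := by
      intro x
      constructor
      · rintro ⟨h5, h6⟩
        by_cases h7 : x + I.pattern.length ≤ j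
        · exact .inl ⟨h7, h6⟩
        · exact .inr ⟨by omega, by omega, h6⟩
      · rintro (⟨h5, h6⟩ | ⟨h5, h7, h6⟩)
        · exact ⟨by omega, h6⟩
        · exact ⟨by omega, h6⟩
    have hfinish : ∀ h3 : HState, h3.reg ρtables = h2.reg ρtables → h3.arr = h2.arr →
        h3.reg ρcurDepth = h2.reg ρcurDepth → h3.reg ρcurRow = h2.reg ρcurRow → h3.out.Nodup →
        (∀ x, x ∈ h3.out ↔ x + I.pattern.length ≤ j + 1 ∧
        R I.pattern ((I.text.drop x).take I.pattern.length)) →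
        Ready I.pattern T K W (h3.setReg ρpos (j + 1)) ∧
        HoldsDist I.pattern.length D (j + 1) (h3.setReg ρpos (j + 1)) ∧
        IsLongest (states I.pattern) (tableList (j + 1) D) (j + 1)
          ((h3.setReg ρpos (j + 1)).reg ρcurDepth) ∧
        Node K W (tableList (j + 1) D) ((h3.setReg ρpos (j + 1)).reg ρcurDepth)
          ((h3.setReg ρpos (j + 1)).reg ρcurRow) ∧
        t + (t1 + (0 + (t2 + 0))) + 1 + (h3.setReg ρpos (j + 1)).reg ρcurDepth +
          chainBefore D (j + 1) ≤ 4 * (j + 1) ∧ (h3.setReg ρpos (j + 1)).out.Nodup ∧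
        ∀ x, x ∈ (h3.setReg ρpos (j + 1)).out ↔ x + I.pattern.length ≤ j + 1 ∧
          R I.pattern ((I.text.drop x).take I.pattern.length) := by
      intro h3 k1 k2 k3 k4 k5 k6
      simp only [HState.setReg_reg, Nat.reduceEqDiff, if_false, HState.setReg_out, k3, k4]
      refine ⟨r3.congr k1 fun a _ => by rw [← k2]; rfl, fun q hq hq' => ?_, c1, c2, by omega, k5, k6⟩
      rw [HState.setReg_arr, k2, d2]
      exact a2 q hq hq'
    refine run_ite_of (by simp) (fun hne => ?_) (fun heq => ?_)
    · simp at hne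
      have hmj : I.pattern.length ≤ j + 1 := by have := c1.le; omega
      have hf := suffixTable_factor (j := j + 1) hmj (by omega) hD
      rw [← hne, c2.table, hne] at hf
      refine (hc.run H hp ht hT r3 (by omega) (by omega) c2.lt (by rw [e2]; exact hf.symm)).mono
        fun h3 t3 F3 q => ?_
      rw [e2] at q
      obtain ⟨rfl, q1, q2⟩ := q
      have hrg : ∀ r, r ≠ ρfst → r ≠ ρswap → h3.reg r = h2.reg r := fun r h6 h7 => F3.reg _ fun h8 => by
        have := hc.regs _ h8
        omega
      have har : h3.arr = h2.arr := by
        funext a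
        exact F3.arr a (by rw [hc.arrs]; simp)
      refine hfinish h3 (hrg _ (by decide) (by decide)) har (hrg _ (by decide) (by decide))
        (hrg _ (by decide) (by decide)) ?_ fun x => ?_
      · by_cases hr : R I.pattern ((I.text.drop (j + 1 - I.pattern.length)).take I.pattern.length)
        · rw [q1 hr]
          -- Factors reported earlier end before position `j`, so the new one starts further to the
          -- right.
          refine List.nodup_append.2 ⟨j6, by simp, fun a ha b hb hab => ?_⟩
          rw [List.mem_singleton] at hb
          have := (j7 a).1 ha
          omega
        · rw [q2 hr]; exact j6
      · rw [hsplit]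
        by_cases hr : R I.pattern ((I.text.drop (j + 1 - I.pattern.length)).take I.pattern.length)
        · rw [q1 hr, List.mem_append, j7, List.mem_singleton]
          refine or_congr_right ⟨?_, fun h6 => h6.2.1⟩
          rintro rfl
          exact ⟨hmj, rfl, hr⟩
        · rw [q2 hr, j7]
          refine ⟨.inl, ?_⟩
          rintro (h6 | ⟨-, rfl, h6⟩)
          · exact h6
          · exact absurd h6 hr
    · simp at heq
      rw [run_skip]
      refine hfinish h2 rfl rfl rfl rfl j6 fun x => ?_
      rw [hsplit, j7]
      refine ⟨.inl, ?_⟩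
      rintro (h6 | ⟨hmj, rfl, h6⟩)
      · exact h6
      · exfalso
        -- A matching factor would be a suffix of length `m` that is a state, while the longest such
        -- suffix has a depth other than `m`, hence smaller.
        have h7 := (neighbourMatch_iff (nodup_window ht _ _)).1 (hRN _ (nodup_window ht _ _) h6)
        have hf := suffixTable_factor (j := j + 1) hmj (by omega) hD
        rw [← hf] at h7
        exact c1.max I.pattern.length (by omega) hmj ⟨_, h7, List.prefix_rfl⟩
  · rintro h' t - - ⟨-, -, -, -, j5, j6, j7⟩
    exact hQ _ _ j6 j7 (by omega)

end

end CTSwap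

namespace CTSwap

/-! ### The programs for the word RAM -/

theorem Represents.mono {S B B' A : ℕ} {σ : Store} {h : HState} (H : Represents S B A σ h)
    (hB : B ≤ B') : Represents S B' A σ h :=
  ⟨H.reg, H.zero, H.side, fun r => (H.lt r).trans_le hB, H.arr,
    fun a x y ha hx hy => (H.arr_lt a x y ha hx hy).trans_le hB, H.fld, H.out⟩

/-- Register `1` does not belong to the representation. -/
theorem Represents.update_one {S B A : ℕ} {σ : Store} {h : HState} (H : Represents S B A σ h)
    (v : ℕ) : Represents S B A { σ with reg := Function.update σ.reg 1 v } h :=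
  ⟨fun r => by simpa using H.reg r, by simpa using H.zero, by simpa using H.side, H.lt, H.arr,
    H.arr_lt, H.fld, H.out⟩

theorem represents_zero {S B A : ℕ} (hB : 0 < B) : Represents S B A
    { Store.init with reg := Function.update Store.init.reg 2 S } HState.zero :=
  ⟨fun r => by simp [Store.init, HState.zero], by simp [Store.init], by simp, fun _ => hB,
    fun _ _ _ _ _ _ => rfl, fun _ _ _ _ _ _ => hB, fun _ _ _ _ => rfl, rfl⟩

/-- The bound for the values if pattern and text have total length `s`. -/
def valueBound (s : ℕ) : ℕ := 100 * (s + 1) ^ 2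

theorem valueBound_mono {s s' : ℕ} (h : s ≤ s') : valueBound s ≤ valueBound s' := by
  unfold valueBound; gcongr

/-- Brings the word length into the form required, a power of `s + 1` with an exponent that depends
on the program only. -/
theorem valueBound_pow_le {s : ℕ} (hs : 1 ≤ s) (q : ℕ) : valueBound s ^ q ≤ (s + 1) ^ (9 * q) := by
  rw [pow_mul]
  refine Nat.pow_le_pow_left ?_ q
  -- `100 ≤ 2 ^ 7`, and `s + 1 ≥ 2`.
  have h : 2 ^ 7 ≤ (s + 1) ^ 7 := Nat.pow_le_pow_left (by omega) 7
  calc valueBound s ≤ (s + 1) ^ 7 * (s + 1) ^ 2 := Nat.mul_le_mul_right _ (by omega)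
    _ = (s + 1) ^ 9 := by ring

theorem fits_valueBound (I : Input) (hI : 0 < I.pattern.length) :
    Fits I (8 * I.pattern.length) (valueBound (I.pattern.length + I.text.length)) := by
  refine ⟨hI, le_rfl, ?_, ?_⟩ <;> unfold valueBound
  · have : I.pattern.length ^ 2 ≤ (I.pattern.length + I.text.length + 1) ^ 2 :=
      Nat.pow_le_pow_left (by omega) 2
    nlinarith
  · nlinarith

theorem suffices_valueBound (I : Input) (hI : 0 < I.pattern.length) {A q C : ℕ}
    (hC : 64 * (A + 5) ≤ C) :
    Suffices I ⟨C * I.pattern.length ^ 2, (I.pattern.length + I.text.length + 1) ^ (9 * q)⟩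
      (8 * I.pattern.length) (valueBound (I.pattern.length + I.text.length)) A q := by
  have H := fits_valueBound I hI
  have h1 := H.le
  have h2 := H.text
  refine ⟨by omega, by omega, fun s => ?_, ?_, valueBound_pow_le (by omega) q⟩
  · cases s
    · simp only [Input.get_pattern]; omega
    · simp only [Input.get_text]; omega
  · calc (A + 5) * (8 * I.pattern.length) * (8 * I.pattern.length)
        = 64 * (A + 5) * I.pattern.length ^ 2 := by ring
      _ ≤ C * I.pattern.length ^ 2 := Nat.mul_le_mul_right _ hC

/-- The program that builds the automaton: set the side length of the arrays, run the construction,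
and copy the number of states to register `1`. -/
def buildCmd : Cmd :=
  .seq (.assign 2 (.op .mul (.const 8) (.len .pattern)))
    (.seq buildAutomaton.compile (.assign 1 (.reg (ρstates + 3))))

/-- The construction runs with an empty text, so its word length depends on the pattern only. The
represented state `h` is returned as well, since the scan relies on more than the automaton. -/
theorem exec_buildCmd {p : List ℤ} (hp : p.Nodup) (hm : 0 < p.length) {A q C : ℕ}
    (hC : 64 * (A + 5) ≤ C) (hA : buildAutomaton.top ≤ A) (hw : buildAutomaton.weight ≤ q)
    (hq : 1 ≤ q) :
    ∃ h σ T K W, Exec ⟨p, []⟩ ⟨C * p.length ^ 2, (p.length + 1) ^ (9 * q)⟩ buildCmd Store.init σ T ∧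
      Represents (8 * p.length) (valueBound p.length) A σ h ∧
      HoldsAutomaton p ⟨C * p.length ^ 2, (p.length + 1) ^ (9 * q)⟩ σ ∧
      Ready p (fun k => (parentDistance p).getD k 0) K W h ∧ h.out = [] ∧
      T ≤ (6 + 101 * buildAutomaton.size) * p.length ^ 2 := by
  have hF : Fits ⟨p, []⟩ (8 * p.length) (valueBound p.length) := fits_valueBound ⟨p, []⟩ hm
  have hL : Suffices ⟨p, []⟩ ⟨C * p.length ^ 2, (p.length + 1) ^ (9 * q)⟩ (8 * p.length)
    (valueBound p.length) A q := suffices_valueBound ⟨p, []⟩ hm hC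
  have hB := hF.le
  have hword : valueBound p.length ≤ (p.length + 1) ^ (9 * q) :=
    (Nat.le_self_pow (by omega) _).trans hL.word
  obtain ⟨h, t, E, e1, K, W, hR, hN, hs, ht⟩ : Run ⟨p, []⟩ (8 * p.length) (valueBound p.length)
      buildAutomaton HState.zero fun h t => h.out = [] ∧ ∃ K W,
        Ready p (fun k => (parentDistance p).getD k 0) K W h ∧
        Numbered p.length W (NodesBefore K W (p.length + 1) 0) h ∧
        h.reg ρstates ≤ (p.length + 1) * K ∧ t ≤ 100 * p.length ^ 2 :=
    run_buildAutomaton hF hp (isTable_parentDistance rfl) (fun _ _ _ => rfl)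
      fun h' t K W F q1 q2 q3 q4 => ⟨F.out rfl, K, W, q1, q2, q3, q4⟩
  obtain ⟨σ, T, E', hRep, hT⟩ := E.compile hL (represents_zero (by omega)) hw hA
  -- From `(m + 1) * K` with `m + 1 ≤ 2 * m` and `K ≤ 5 * m`.
  have hst : h.reg ρstates ≤ 10 * p.length ^ 2 := by
    refine hs.trans ((Nat.mul_le_mul (by omega : p.length + 1 ≤ 2 * p.length) hR.bound).trans ?_)
    exact le_of_eq (by ring)
  refine ⟨h, _, _, K, W, .seq (.assign _ _ _ (8 * p.length) ?_) (.seq E' (.assign _ _ _ _ rfl)),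
    hRep.update_one _, ?_, hR, e1, ?_⟩
  · have f1 : 8 < (p.length + 1) ^ (9 * q) := by omega
    have f2 : p.length < (p.length + 1) ^ (9 * q) := by omega
    have f3 : 8 * p.length < (p.length + 1) ^ (9 * q) := by omega
    simp [Expr.eval, Limits.fit, Input.get, Op.apply, f1, f2, f3]
  · refine hN.automaton hm hR.lists hR.link (by simpa using hRep.zero) ?_ ?_ fun f i hf hi => ?_
    · simpa using hRep.reg ρstates
    · exact (by nlinarith : 4 * h.reg ρstates ≤ C * p.length ^ 2)
    · exact hRep.fld f i hf (by nlinarith)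
  · have h1 : 1 ≤ p.length ^ 2 := Nat.one_le_pow _ _ hm
    have h2 : buildAutomaton.size * (t + 1) ≤ buildAutomaton.size * (101 * p.length ^ 2) :=
      Nat.mul_le_mul_left _ (by omega)
    simp only [Expr.cost]
    nlinarith

theorem exists_decides {R : List ℤ → List ℤ → Prop} (hR : R = NeighbourMatch ∨ R = SwapMatch) :
    (∃ c, Decides R c) ∧ ∀ x y : List ℤ, x.Nodup → y.Nodup → R x y → NeighbourMatch x y := by
  rcases hR with rfl | rfl
  · exact ⟨⟨_, decides_report⟩, fun _ _ _ _ h => h⟩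
  · exact ⟨⟨_, decides_reportSwap⟩, fun _ _ hx hy h => h.neighbourMatch hx hy⟩

/-- The algorithm is linear in `m ^ 2 + n`; since `log (m + 1) ≥ log 2 > 1 / 2`, twice the constant
admits the logarithmic factor. -/
theorem le_mul_log {D m n : ℕ} (hm : 1 ≤ m) : (((D * (m ^ 2 + n) : ℕ)) : ℝ) ≤
    (2 * D : ℕ) * (((m : ℝ) ^ 2 + n) * Real.log (m + 1)) := by
  have h1 : Real.log 2 ≤ Real.log (m + 1) := by
    refine Real.log_le_log (by norm_num) ?_
    have : (1 : ℝ) ≤ m := by exact_mod_cast hm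
    linarith
  have h2 : (1 / 2 : ℝ) ≤ Real.log (m + 1) := by
    have := Real.log_two_gt_d9
    linarith
  have h3 : 0 ≤ (D : ℝ) * ((m : ℝ) ^ 2 + n) := by positivity
  push_cast
  nlinarith

end CTSwap

/-- Two programs: `build` reads only the pattern `p` and leaves the Aho–Corasick automaton in the
memory; `scan` continues from there and reports the (0-based) positions of the text `t` at which a
factor matches `p`. Time, memory and word length are bounded as indicated. This holds both for
matching on the level of Cartesian trees and for `CT_τ` matching of sequences. -/
theorem theorem2 (R : List ℤ → List ℤ → Prop)
    (hR : R = CTSwap.NeighbourMatch ∨ R = CTSwap.SwapMatch) :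
    ∃ (build scan : CTSwap.Cmd) (C k : ℕ),
      ∀ p : List ℤ, p.Nodup → 1 ≤ p.length →
        ∃ (σ₁ : CTSwap.Store) (T₁ : ℕ),
          CTSwap.Exec ⟨p, []⟩ ⟨C * p.length ^ 2, (p.length + 1) ^ k⟩ build CTSwap.Store.init σ₁ T₁ ∧
          CTSwap.HoldsAutomaton p ⟨C * p.length ^ 2, (p.length + 1) ^ k⟩ σ₁ ∧
          ∀ t : List ℤ, t.Nodup →
            ∃ (σ₂ : CTSwap.Store) (T₂ : ℕ),
              CTSwap.Exec ⟨p, t⟩ ⟨C * p.length ^ 2, (p.length + t.length + 1) ^ k⟩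
                scan σ₁ σ₂ T₂ ∧
              σ₂.out.Nodup ∧
              (∀ j, j ∈ σ₂.out ↔
                j + p.length ≤ t.length ∧ R p ((t.drop j).take p.length)) ∧
              ((T₁ + T₂ : ℕ) : ℝ) ≤
                C * (((p.length : ℝ) ^ 2 + t.length) * Real.log (p.length + 1)) := by
  obtain ⟨⟨c, hc⟩, hN⟩ := CTSwap.exists_decides hR
  obtain ⟨A, hA⟩ : ∃ A, A = CTSwap.buildAutomaton.top + (CTSwap.scanText c).top := ⟨_, rfl⟩
  obtain ⟨q, hq⟩ : ∃ q, q = CTSwap.buildAutomaton.weight + (CTSwap.scanText c).weight + 1 := ⟨_, rfl⟩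
  -- The first three summands bound the time of both programs, the last one the space for the
  -- arrays, so that a single constant serves for both.
  obtain ⟨D, hD⟩ : ∃ D, D = 6 + 101 * CTSwap.buildAutomaton.size + 4 * (CTSwap.scanText c).size +
    64 * (A + 5) := ⟨_, rfl⟩
  refine ⟨CTSwap.buildCmd, (CTSwap.scanText c).compile, 2 * D, 9 * q, fun p hp hm => ?_⟩
  obtain ⟨h, σ₁, T₁, K, W, hE, hRep, hH, hRd, ho, hT₁⟩ := CTSwap.exec_buildCmd hp hm (A := A)
    (q := q) (C := 2 * D) (by omega) (by omega) (by omega) (by omega)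
  refine ⟨σ₁, T₁, hE, hH, fun t ht => ?_⟩
  obtain ⟨h', u, E, h1, h2, h3⟩ : CTSwap.Run ⟨p, t⟩ (8 * p.length)
      (CTSwap.valueBound (p.length + t.length)) (CTSwap.scanText c) h fun h' u => h'.out.Nodup ∧
        (∀ j, j ∈ h'.out ↔ j + p.length ≤ t.length ∧ R p ((t.drop j).take p.length)) ∧
        u ≤ 4 * t.length :=
    CTSwap.run_scanText (CTSwap.fits_valueBound ⟨p, t⟩ hm) hc (fun y hy => hN p y hp hy) hp ht
      (CTSwap.isTable_parentDistance rfl) hRd ho fun h' u a b d => ⟨a, b, d⟩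
  obtain ⟨σ₂, T₂, hE₂, hRep₂, hT₂⟩ := E.compile (A := A) (q := q)
    (CTSwap.suffices_valueBound ⟨p, t⟩ hm (C := 2 * D) (by omega))
    -- The store left by the construction is reused under the larger value bound that the text
    -- requires.
    (hRep.mono (CTSwap.valueBound_mono (Nat.le_add_right _ _))) (by omega) (by omega)
  refine ⟨σ₂, T₂, hE₂, by rwa [hRep₂.out], by rwa [hRep₂.out], ?_⟩
  refine le_trans ?_ (CTSwap.le_mul_log (D := D) hm)
  have h4 : 1 ≤ p.length ^ 2 := Nat.one_le_pow _ _ hm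
  have h5 : (CTSwap.scanText c).size * (u + 1) ≤
      (CTSwap.scanText c).size * (4 * (p.length ^ 2 + t.length)) := Nat.mul_le_mul_left _ (by omega)
  have h6 : T₁ + T₂ ≤ D * (p.length ^ 2 + t.length) := by
    rw [hD]
    nlinarith [Nat.zero_le ((6 + 101 * CTSwap.buildAutomaton.size) * t.length),
      Nat.zero_le (64 * (A + 5) * (p.length ^ 2 + t.length))]
  exact_mod_cast h6
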